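/- Let $n\ge 2$ and $\mu>0$. Let $\mathbb{B}^n=\{x\in\mathbb{R}^n:|x|<1\}$ be the Poincaré ball model of hyperbolic space, with metric $\left(\frac{2}{1-|x|^2}\right)^2|dx|^2$, volume $dV_{\mathbb{H}}=\left(\frac{2}{1-|x|^2}\right)^n dx$, Laplace–Beltrami operator $$\Delta_{\mathbb{H}}=\frac{1-|x|^2}{4}\Big((1-|x|^2)\Delta_{\mathbb{R}^n}+2(n-2)\sum_{i=1}^n x_i\frac{\partial}{\partial x_i}\Big),$$ distance to the origin $\rho(x)=\log\frac{1+|x|}{1-|x|}$, and geodesic distance $\rho(x,y)=\rho(T_y(x))$, where $T_a(x)=\frac{|x-a|^2a-(1-|a|^2)(x-a)}{1-2x\cdot a+|x|^2|a|^2}$. Let $\frac{\partial}{\partial\rho}$ be the radial derivative in the polar coordinates $x=\tanh(\rho/2)\,\hat x$, $\hat x = x/|x|$. For $z=-\mu\mathrm{i}$ and $\rho>0$ put $$G_{z}(\rho)=A_{n,z}\frac{(\cosh\rho)^{\frac{n-3}{2}-z}}{(\sinh\rho)^{n-2}}\int_0^\pi\Big(1+\frac{\cos t}{\cosh\rho}\Big)^{\frac{n-3}{2}-z}(\sin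 t)^{2z}\,dt,\qquad A_{n,z}=(2\pi)^{-\frac n2}\frac{\Gamma(\frac{n-1}{2}+z)}{2^{z+\frac12}\Gamma(z+\frac12)}.$$ Let $f\in C_c^\infty(\mathbb{B}^n)$ be complex-valued. A function $u\in C^2(\mathbb{B}^n)$ with complex values is called a radiating solution with source $f$ if $$\Big(-\Delta_{\mathbb{H}}-\frac{(n-1)^2}{4}-\mu^2\Big)u=f\quad\text{in }\mathbb{B}^n$$ and, uniformly with respect to $\hat x$, $$\frac{\partial u}{\partial\rho}-\Big(\mu\mathrm{i}-\frac{n-1}{2}\Big)\tanh\Big(\frac{\rho}{2}\Big)u=o\Big(\sinh^{-\frac{n-1}{2}}\rho\Big)\qquad\text{as }\rho=\rho(x)\to+\infty .$$ Then: 1. If $u$ is a radiating solution with source $f$, then for every $x\in\mathbb{B}^n$ the function $y\mapsto G_{-\mu\mathrm{i}}(\rho(x,y))f(y)$ is integrable with respect to $V_{\mathbb{H}}$ and $$u(x)=\int_{\mathbb{B}^n}G_{-\mu\mathrm{i}}(\rho(x,y))f(y)\,dV_{\mathbb{H}}(y).$$ 2. Any two radiating solutions with the same source $f$ coincide in $\mathbb{B}^n$.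 3. A radiating solution of the homogeneous equation ($f=0$) vanishes identically in $\mathbb{B}^n$. -/

import Mathlib

open Real Set Filter Topology MeasureTheory
open scoped ContDiff

noncomputable section

namespace HypScattering

/-- The ambient Euclidean space `ℝⁿ`. -/
abbrev E (n : ℕ) : Type := EuclideanSpace ℝ (Fin n)

/-- The underlying set of the Poincare ball model `𝔹ⁿ`: the open unit ball of `ℝⁿ`. Functions on
`𝔹ⁿ` are represented by functions on `ℝⁿ` of which only the values on `𝔹ⁿ` matter. -/
abbrev hBall (n : ℕ) : Set (E n) := Metric.ball (0 : E n) 1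

/-- The hyperbolic volume `dV_ℍ = (2 / (1 - |x|²))ⁿ dx` on `𝔹ⁿ`. -/
def hVol (n : ℕ) : Measure (E n) :=
  ((volume : Measure (E n)).restrict (hBall n)).withDensity
    (fun x => ENNReal.ofReal ((2 / (1 - ‖x‖ ^ 2)) ^ n))

/-- The geodesic distance from the origin, `ρ(x) = log ((1 + |x|) / (1 - |x|))`. -/
def hRadius {n : ℕ} (x : E n) : ℝ := Real.log ((1 + ‖x‖) / (1 - ‖x‖))

/-- The Mobius transformation
`T_a(x) = (|x - a|² a - (1 - |a|²)(x - a)) / (1 - 2 x·a + |x|² |a|²)`. -/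
def mobius {n : ℕ} (a x : E n) : E n :=
  (1 - 2 * inner ℝ x a + ‖x‖ ^ 2 * ‖a‖ ^ 2)⁻¹ •
    (‖x - a‖ ^ 2 • a - (1 - ‖a‖ ^ 2) • (x - a))

/-- The geodesic distance `ρ(x, y) = ρ(T_y(x))` between two points of `𝔹ⁿ`. -/
def hDist {n : ℕ} (x y : E n) : ℝ := hRadius (mobius y x)

/-- The Laplace-Beltrami operator of `𝔹ⁿ`,
`Δ_ℍ = (1 - |x|²)/4 * ((1 - |x|²) Δ + 2 (n - 2) ∑ᵢ xᵢ ∂ᵢ)`; the Euler operator `∑ᵢ xᵢ ∂ᵢ u` is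
the derivative of `u` at `x` in the direction `x`. -/
def hLaplacian {n : ℕ} (u : E n → ℂ) (x : E n) : ℂ :=
  (((1 - ‖x‖ ^ 2) / 4 : ℝ) : ℂ) *
    (((1 - ‖x‖ ^ 2 : ℝ) : ℂ) * Laplacian.laplacian u x
      + 2 * ((n : ℂ) - 2) * fderiv ℝ u x x)

/-- The Helmholtz operator `-Δ_ℍ - (n-1)²/4 - μ²`. -/
def helmholtz {n : ℕ} (μ : ℝ) (u : E n → ℂ) (x : E n) : ℂ :=
  -hLaplacian u x - (((n : ℂ) - 1) ^ 2 / 4) * u x - (μ : ℂ) ^ 2 * u x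

/-- The derivative `∂u/∂ρ` in geodesic polar coordinates `x = tanh(ρ/2) x̂`, `x̂ = x/|x|`. -/
def radialDeriv {n : ℕ} (u : E n → ℂ) (x : E n) : ℂ :=
  deriv (fun s : ℝ => u (Real.tanh (s / 2) • (‖x‖⁻¹ • x))) (hRadius x)

/-- The filter on `𝔹ⁿ` of the limit `ρ(x) → +∞`. -/
def atInfinity (n : ℕ) : Filter (E n) :=
  Filter.comap hRadius atTop ⊓ 𝓟 (hBall n)

/-- The outgoing radiation condition
`∂u/∂ρ - (μ i - (n-1)/2) tanh(ρ/2) u = o(sinh(ρ)^(-(n-1)/2))` as `ρ(x) → +∞`. -/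
def Radiating {n : ℕ} (μ : ℝ) (u : E n → ℂ) : Prop :=
  (fun x : E n => radialDeriv u x
      - ((μ : ℂ) * Complex.I - ((n : ℂ) - 1) / 2) * ((Real.tanh (hRadius x / 2) : ℝ) : ℂ) * u x)
    =o[atInfinity n]
  (fun x : E n => Real.sinh (hRadius x) ^ (-(((n : ℝ) - 1) / 2)))

/-- The constant
`A_{n,z} = (2π)^(-n/2) Γ((n-1)/2 + z) / (2^(z + 1/2) Γ(z + 1/2))`. -/
def greenConst (n : ℕ) (z : ℂ) : ℂ :=
  (2 * (π : ℂ)) ^ (-((n : ℂ) / 2)) * Complex.Gamma (((n : ℂ) - 1) / 2 + z)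
    / ((2 : ℂ) ^ (z + 1 / 2) * Complex.Gamma (z + 1 / 2))

/-- `G_z(ρ) = A_{n,z} (cosh ρ)^((n-3)/2 - z) / (sinh ρ)^(n-2)
  * ∫_0^π (1 + cos t / cosh ρ)^((n-3)/2 - z) (sin t)^(2z) dt`, for `n ≥ 2`. -/
def green (n : ℕ) (z : ℂ) (ρ : ℝ) : ℂ :=
  greenConst n z * ((Real.cosh ρ : ℝ) : ℂ) ^ (((n : ℂ) - 3) / 2 - z)
      / ((Real.sinh ρ : ℝ) : ℂ) ^ (n - 2)
    * ∫ t in (0 : ℝ)..π,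
        ((1 + Real.cos t / Real.cosh ρ : ℝ) : ℂ) ^ (((n : ℂ) - 3) / 2 - z)
          * ((Real.sin t : ℝ) : ℂ) ^ (2 * z)

/-- `f ∈ C_c^∞(𝔹ⁿ)`, extended by zero to `ℝⁿ`. -/
structure IsTestFun {n : ℕ} (f : E n → ℂ) : Prop where
  smooth : ContDiff ℝ ∞ f
  compact : HasCompactSupport f
  support_subset : tsupport f ⊆ hBall n

/-- `u ∈ C²(𝔹ⁿ)` solves `(-Δ_ℍ - (n-1)²/4 - μ²) u = f` in `𝔹ⁿ` and satisfies the outgoing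
radiation condition. -/
structure IsRadiatingSolution {n : ℕ} (μ : ℝ) (f u : E n → ℂ) : Prop where
  contDiffOn : ContDiffOn ℝ 2 u (hBall n)
  equation : ∀ x ∈ hBall n, helmholtz μ u x = f x
  radiating : Radiating μ u

end HypScattering

end

/-!
The representation formula is Green's second identity on large balls, applied to the radiating
solution `u` and the Green function with pole at `x`. Three difficulties have to be met.

*The Green function.* As a function `H` of `c = cosh ρ`, it is a power of `c² - 1` times the integral
of `(c + cos t)^a (sin t)^(2z)` over `[0, π]`. A single contiguity relation between these integrals
(`legendreInt_contiguous`, an integration by parts) yields the derivative of `H` in closed form and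
the radial equation `(c² - 1) H'' + n c H' + ((n-1)²/4 - z²) H = 0`, and cancellation between two of
the integrals yields the radiation condition (`norm_greenFun_radiation_le`). At `c = 1` the integral
is a Beta function, whence the strength of the singularity (`greenConst_mul_legendreInt_one`).

*The pole.* Instead of cutting out a ball around `x`, the Green function is replaced by the smooth
function `H (cosh ρ(x, y) + ε)` (`greenReg`). Since `Δ_ℍ` acts on functions of `c = cosh ρ(x, y)` as
`(c² - 1) ∂² + n c ∂` (`hLaplacian_comp_hCosh`), this solves the homogeneous equation up to an
explicit defect, which is shown by scaling and dominated convergence to be an approximate identity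
at `x` (`tendsto_integral_greenDefect`).

*The boundary at infinity.* Balls are replaced by a smooth radial cutoff, so that the boundary terms
become averages over the shells `1 / R ≤ 1 - |y|² ≤ 2 / R` (`green_identity`). Write `D` for the Euler
derivative `y · ∇`, so that `D = sinh ρ ∂/∂ρ`. Green's identity for `u` and its conjugate bounds the
flux `Im (ū D u)` through the shells, and as `μ > 0` the radiation condition turns this into a bound
on the mean of `|u|²` (`IsRadiatingSolution.exists_integral_shellWeight_norm_sq_le`). In
`g D u - u D g` the leading parts of the two radiation conditions cancel, and the remainders are
small against that bound, uniformly in `ε` (`IsRadiatingSolution.exists_norm_boundary_le`).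

Letting first `ε → 0` and then `R → ∞` gives the representation; uniqueness is a consequence, as the
right-hand side depends on the source only.
-/

noncomputable section

namespace HypScattering

/-! ### Legendre-type integrals -/

/-- The integrand `(c + cos t)^a (sin t)^(2z)`. -/
def legendreKernel (a z : ℂ) (c t : ℝ) : ℂ :=
  ((c + Real.cos t : ℝ) : ℂ) ^ a * ((Real.sin t : ℝ) : ℂ) ^ (2 * z)

/-- The Legendre-type integral `∫_0^π (c + cos t)^a (sin t)^(2z) dt`, with `c = cosh ρ`. -/
def legendreInt (a z : ℂ) (c : ℝ) : ℂ :=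
  ∫ t in (0 : ℝ)..π, legendreKernel a z c t

theorem measurable_legendreKernel (a z : ℂ) (c : ℝ) : Measurable (legendreKernel a z c) := by
  unfold legendreKernel
  fun_prop

theorem add_cos_pos {c : ℝ} (hc : 1 < c) (t : ℝ) : 0 < c + Real.cos t := by
  linarith [Real.neg_one_le_cos t]

/-- For `Re z = 0` the factor `(sin t)^(2z)` has modulus at most `1`, also at the zeros of the sine,
where `0 ^ 0 = 1` and otherwise `0 ^ w = 0`. -/
theorem norm_legendreKernel_le {a z : ℂ} (hz : z.re = 0) {c t : ℝ} (hc : 0 < c + Real.cos t)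
    (ht : 0 ≤ Real.sin t) : ‖legendreKernel a z c t‖ ≤ (c + Real.cos t) ^ a.re := by
  have h1 : ‖((Real.sin t : ℝ) : ℂ) ^ (2 * z)‖ ≤ 1 := by
    rcases ht.eq_or_lt with h | h
    · rw [← h]
      by_cases h0 : 2 * z = 0
      · simp [h0]
      · simp [Complex.zero_cpow h0]
    · rw [Complex.norm_cpow_eq_rpow_re_of_pos h]
      simp [hz]
  unfold legendreKernel
  rw [norm_mul, Complex.norm_cpow_eq_rpow_re_of_pos hc]
  exact mul_le_of_le_one_right (Real.rpow_nonneg hc.le _) h1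

theorem rpow_le_rpow_add_rpow {m x M : ℝ} (hm : 0 < m) (h1 : m ≤ x) (h2 : x ≤ M) (r : ℝ) :
    x ^ r ≤ m ^ r + M ^ r := by
  have hx : 0 < x := hm.trans_le h1
  rcases le_total 0 r with hr | hr
  · linarith [Real.rpow_le_rpow hx.le h2 hr, Real.rpow_nonneg hm.le r]
  · linarith [Real.rpow_le_rpow_of_nonpos hm h1 hr, Real.rpow_nonneg (hx.le.trans h2) r]

theorem intervalIntegrable_legendreKernel (a : ℂ) {z : ℂ} (hz : z.re = 0) {c : ℝ} (hc : 1 < c) :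
    IntervalIntegrable (legendreKernel a z c) volume 0 π := by
  rw [intervalIntegrable_iff]
  refine Measure.integrableOn_of_bounded (M := (c - 1) ^ a.re + (c + 1) ^ a.re) (by simp)
    (measurable_legendreKernel a z c).aestronglyMeasurable ?_
  refine (ae_restrict_iff' measurableSet_uIoc).2 (ae_of_all _ fun t ht => ?_)
  rw [uIoc_of_le Real.pi_pos.le] at ht
  refine (norm_legendreKernel_le hz (add_cos_pos hc t)
    (Real.sin_nonneg_of_nonneg_of_le_pi ht.1.le ht.2)).trans ?_
  exact rpow_le_rpow_add_rpow (by linarith) (by linarith [Real.neg_one_le_cos t])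
    (by linarith [Real.cos_le_one t]) _

theorem hasDerivAt_ofReal_cpow {f : ℝ → ℝ} {f' t : ℝ} (hf : HasDerivAt f f' t) (h : 0 < f t)
    (a : ℂ) :
    HasDerivAt (fun s => ((f s : ℝ) : ℂ) ^ a) (a * ((f t : ℝ) : ℂ) ^ (a - 1) * f') t := by
  have h1 := ((hasDerivAt_id ((f t : ℝ) : ℂ)).cpow_const (c := a) (Or.inl (by simpa using h)))
  have h2 := (h1.comp_ofReal).scomp t hf
  refine h2.congr_deriv ?_
  simp
  ring

theorem hasDerivAt_legendreKernel (a z : ℂ) {c : ℝ} (hc : 1 < c) (t : ℝ) :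
    HasDerivAt (fun c => legendreKernel a z c t) (a * legendreKernel (a - 1) z c t) c := by
  have h := add_cos_pos hc t
  have h2 := (hasDerivAt_ofReal_cpow ((hasDerivAt_id c).add_const (Real.cos t)) h a).mul_const
    (((Real.sin t : ℝ) : ℂ) ^ (2 * z))
  refine h2.congr_deriv ?_
  simp [legendreKernel]
  ring

theorem hasDerivAt_legendreInt (a : ℂ) {z : ℂ} (hz : z.re = 0) {c : ℝ} (hc : 1 < c) :
    HasDerivAt (legendreInt a z) (a * legendreInt (a - 1) z c) c := by
  set δ := (c - 1) / 2 with hδ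
  have hδ0 : 0 < δ := by rw [hδ]; linarith
  have key := intervalIntegral.hasDerivAt_integral_of_dominated_loc_of_deriv_le
    (F := fun c t => legendreKernel a z c t) (F' := fun c t => a * legendreKernel (a - 1) z c t)
    (x₀ := c) (s := Metric.ball c δ) (a := 0) (b := π) (μ := volume)
    (bound := fun _ => ‖a‖ * (δ ^ (a - 1).re + (c + δ + 1) ^ (a - 1).re))
    (Metric.ball_mem_nhds c hδ0)
    (Eventually.of_forall fun c => (measurable_legendreKernel a z c).aestronglyMeasurable)
    (intervalIntegrable_legendreKernel a hz hc)
    ((measurable_legendreKernel (a - 1) z c).const_mul a).aestronglyMeasurable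
    (ae_of_all _ ?_) (by simp) (ae_of_all _ ?_)
  · refine key.2.congr_deriv ?_
    simp [legendreInt, intervalIntegral.integral_const_mul]
  · intro t ht x hx
    rw [uIoc_of_le Real.pi_pos.le] at ht
    rw [Metric.mem_ball, Real.dist_eq, abs_lt] at hx
    have hx1 : 1 < x := by linarith
    rw [norm_mul]
    refine mul_le_mul_of_nonneg_left ?_ (norm_nonneg _)
    refine (norm_legendreKernel_le hz (add_cos_pos hx1 t)
      (Real.sin_nonneg_of_nonneg_of_le_pi ht.1.le ht.2)).trans ?_
    exact rpow_le_rpow_add_rpow hδ0 (by linarith [Real.neg_one_le_cos t])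
      (by linarith [Real.cos_le_one t]) _
  · intro t ht x hx
    rw [Metric.mem_ball, Real.dist_eq, abs_lt] at hx
    exact hasDerivAt_legendreKernel a z (by linarith) t

theorem legendreKernel_add_one (a z : ℂ) {c : ℝ} (hc : 1 < c) (t : ℝ) :
    legendreKernel (a + 1) z c t = (c + Real.cos t : ℝ) * legendreKernel a z c t := by
  have h : ((c + Real.cos t : ℝ) : ℂ) ≠ 0 := by exact_mod_cast (add_cos_pos hc t).ne'
  unfold legendreKernel
  rw [Complex.cpow_add _ _ h, Complex.cpow_one]
  ring

/-- The contiguity relation of the Legendre-type integrals: the difference of the two sides is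
the integral over `[0, π]` of the derivative of `(c + cos t)^a (sin t)^(2z+1)`. -/
theorem legendreInt_contiguous (a : ℂ) {z : ℂ} (hz : z.re = 0) {c : ℝ} (hc : 1 < c) :
    ((c : ℂ) ^ 2 - 1) * (a * legendreInt (a - 1) z c)
      = (2 * a + 2 * z + 1) * c * legendreInt a z c
        - (a + 2 * z + 1) * legendreInt (a + 1) z c := by
  have hi1 := intervalIntegrable_legendreKernel (a - 1) hz hc
  have hi2 := intervalIntegrable_legendreKernel a hz hc
  have hi3 := intervalIntegrable_legendreKernel (a + 1) hz hc
  have hftc : ∫ t in (0 : ℝ)..π, ((((c : ℂ) ^ 2 - 1) * a * legendreKernel (a - 1) z c t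
      - (2 * a + 2 * z + 1) * c * legendreKernel a z c t)
        + (a + 2 * z + 1) * legendreKernel (a + 1) z c t) = 0 := by
    have hre : 0 < (2 * z + 1).re := by simp [hz]
    have h0 : 2 * z + 1 ≠ 0 := fun h => by rw [h] at hre; simp at hre
    rw [intervalIntegral.integral_eq_sub_of_hasDerivAt_of_le (a := 0) (b := π)
      (f := fun t => ((c + Real.cos t : ℝ) : ℂ) ^ a * ((Real.sin t : ℝ) : ℂ) ^ (2 * z + 1))
      Real.pi_pos.le ?_ ?_
      (((hi1.const_mul _).sub (hi2.const_mul _)).add (hi3.const_mul _))]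
    · simp [Complex.zero_cpow h0]
    · refine ContinuousOn.mul ?_ ?_
      · refine ContinuousOn.cpow_const (by fun_prop) fun t _ => Or.inl ?_
        rw [Complex.ofReal_re]
        exact add_cos_pos hc t
      · exact ((Complex.continuous_ofReal_cpow_const hre).comp Real.continuous_sin).continuousOn
    · intro t ht
      have hs := Real.sin_pos_of_pos_of_lt_pi ht.1 ht.2
      have hX := add_cos_pos hc t
      have hXc : ((c + Real.cos t : ℝ) : ℂ) ≠ 0 := by exact_mod_cast hX.ne'
      have hsc : ((Real.sin t : ℝ) : ℂ) ≠ 0 := by exact_mod_cast hs.ne'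
      have d := (hasDerivAt_ofReal_cpow ((Real.hasDerivAt_cos t).const_add c) hX a).mul
        (hasDerivAt_ofReal_cpow (Real.hasDerivAt_sin t) hs (2 * z + 1))
      refine d.congr_deriv ?_
      have e2 : legendreKernel a z c t
          = (c + Real.cos t : ℝ) * legendreKernel (a - 1) z c t := by
        rw [← legendreKernel_add_one _ _ hc, sub_add_cancel]
      have e1 : legendreKernel (a + 1) z c t
          = (c + Real.cos t : ℝ) * ((c + Real.cos t : ℝ) * legendreKernel (a - 1) z c t) := by
        rw [legendreKernel_add_one _ _ hc, e2]
      have e3 : ((c + Real.cos t : ℝ) : ℂ) ^ a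
          = (c + Real.cos t : ℝ) * ((c + Real.cos t : ℝ) : ℂ) ^ (a - 1) := by
        rw [Complex.cpow_sub _ _ hXc, Complex.cpow_one]
        field_simp
      have e4 : ((Real.sin t : ℝ) : ℂ) ^ (2 * z + 1)
          = (Real.sin t : ℝ) * ((Real.sin t : ℝ) : ℂ) ^ (2 * z) := by
        rw [Complex.cpow_add _ _ hsc, Complex.cpow_one]
        ring
      have e5 : ((Real.sin t : ℝ) : ℂ) ^ 2 = 1 - ((Real.cos t : ℝ) : ℂ) ^ 2 := by
        have := Real.sin_sq t
        exact_mod_cast this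
      rw [e1, e2, add_sub_cancel_right, e4, e3]
      unfold legendreKernel
      generalize ((c + Real.cos t : ℝ) : ℂ) ^ (a - 1) = P
      generalize ((Real.sin t : ℝ) : ℂ) ^ (2 * z) = Q
      push_cast at e5 ⊢
      linear_combination (-a * P * Q) * e5
  rw [intervalIntegral.integral_add ((hi1.const_mul _).sub (hi2.const_mul _)) (hi3.const_mul _),
    intervalIntegral.integral_sub (hi1.const_mul _) (hi2.const_mul _),
    intervalIntegral.integral_const_mul, intervalIntegral.integral_const_mul,
    intervalIntegral.integral_const_mul] at hftc
  unfold legendreInt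
  linear_combination hftc

/-- For `Re a ≥ -1/2` the singularity of the integrand at `t = π`, `c = 1` is at worst that of
`(c - 1)^(-1/2)`. -/
theorem rpow_add_cos_le {r c : ℝ} (hr : -1 / 2 ≤ r) (hc : 1 < c) (t : ℝ) :
    (c + Real.cos t) ^ r ≤ (c + 1) ^ (r + 1 / 2) * (c - 1) ^ (-(1 / 2) : ℝ) := by
  have h := add_cos_pos hc t
  have e : (c + Real.cos t) ^ r
      = (c + Real.cos t) ^ (r + 1 / 2) * (c + Real.cos t) ^ (-(1 / 2) : ℝ) := by
    rw [← Real.rpow_add h]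
    congr 1
    ring
  rw [e]
  refine mul_le_mul (Real.rpow_le_rpow h.le (by linarith [Real.cos_le_one t]) (by linarith))
    (Real.rpow_le_rpow_of_nonpos (by linarith) (by linarith [Real.neg_one_le_cos t]) (by norm_num))
    (Real.rpow_nonneg h.le _) (Real.rpow_nonneg (by linarith) _)

theorem norm_legendreInt_le {a z : ℂ} (hz : z.re = 0) (ha : -1 / 2 ≤ a.re) {c : ℝ} (hc : 1 < c) :
    ‖legendreInt a z c‖ ≤ π * ((c + 1) ^ (a.re + 1 / 2) * (c - 1) ^ (-(1 / 2) : ℝ)) := by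
  have := intervalIntegral.norm_integral_le_of_norm_le_const (a := 0) (b := π)
    (f := legendreKernel a z c) (C := (c + 1) ^ (a.re + 1 / 2) * (c - 1) ^ (-(1 / 2) : ℝ)) ?_
  · rw [sub_zero, abs_of_pos Real.pi_pos, mul_comm] at this
    exact this
  · intro t ht
    rw [uIoc_of_le Real.pi_pos.le] at ht
    exact (norm_legendreKernel_le hz (add_cos_pos hc t)
      (Real.sin_nonneg_of_nonneg_of_le_pi ht.1.le ht.2)).trans (rpow_add_cos_le ha hc t)

theorem norm_legendreInt_le_of_nonneg {a z : ℂ} (hz : z.re = 0) (ha : 0 ≤ a.re) {c : ℝ}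
    (hc : 1 < c) : ‖legendreInt a z c‖ ≤ π * (c + 1) ^ a.re := by
  have := intervalIntegral.norm_integral_le_of_norm_le_const (a := 0) (b := π)
    (f := legendreKernel a z c) (C := (c + 1) ^ a.re) ?_
  · rw [sub_zero, abs_of_pos Real.pi_pos, mul_comm] at this
    exact this
  · intro t ht
    rw [uIoc_of_le Real.pi_pos.le] at ht
    exact (norm_legendreKernel_le hz (add_cos_pos hc t)
      (Real.sin_nonneg_of_nonneg_of_le_pi ht.1.le ht.2)).trans
      (Real.rpow_le_rpow (add_cos_pos hc t).le (by linarith [Real.cos_le_one t]) ha)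

/-- The leading terms at `c → ∞` of the two integrals cancel: the combination is the integral of
`-(1 + c cos t) (c + cos t)^a (sin t)^(2z)`. -/
theorem norm_legendreInt_comb_le {a z : ℂ} (hz : z.re = 0) (ha : -1 / 2 ≤ a.re) {c : ℝ}
    (hc : 1 < c) :
    ‖((c : ℂ) ^ 2 - 1) * legendreInt a z c - c * legendreInt (a + 1) z c‖
      ≤ π * ((c + 1) * ((c + 1) ^ (a.re + 1 / 2) * (c - 1) ^ (-(1 / 2) : ℝ))) := by
  have hi2 := intervalIntegrable_legendreKernel a hz hc
  have hi3 := intervalIntegrable_legendreKernel (a + 1) hz hc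
  have e : ((c : ℂ) ^ 2 - 1) * legendreInt a z c - c * legendreInt (a + 1) z c
      = ∫ t in (0 : ℝ)..π, (-(1 + c * Real.cos t : ℝ) : ℂ) * legendreKernel a z c t := by
    unfold legendreInt
    rw [← intervalIntegral.integral_const_mul, ← intervalIntegral.integral_const_mul,
      ← intervalIntegral.integral_sub (hi2.const_mul _) (hi3.const_mul _)]
    refine intervalIntegral.integral_congr fun t _ => ?_
    simp only [legendreKernel_add_one _ _ hc]
    push_cast
    ring
  rw [e]
  have := intervalIntegral.norm_integral_le_of_norm_le_const (a := 0) (b := π)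
    (f := fun t => (-(1 + c * Real.cos t : ℝ) : ℂ) * legendreKernel a z c t)
    (C := (c + 1) * ((c + 1) ^ (a.re + 1 / 2) * (c - 1) ^ (-(1 / 2) : ℝ))) ?_
  · rw [sub_zero, abs_of_pos Real.pi_pos, mul_comm] at this
    exact this
  · intro t ht
    rw [uIoc_of_le Real.pi_pos.le] at ht
    rw [norm_mul, norm_neg, Complex.norm_real]
    refine mul_le_mul ?_ ((norm_legendreKernel_le hz (add_cos_pos hc t)
      (Real.sin_nonneg_of_nonneg_of_le_pi ht.1.le ht.2)).trans (rpow_add_cos_le ha hc t))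
      (norm_nonneg _) (by linarith)
    rw [Real.norm_eq_abs, abs_le]
    constructor <;> nlinarith [Real.cos_le_one t, Real.neg_one_le_cos t]

theorem tendsto_legendreInt_one {a z : ℂ} (hz : z.re = 0) (ha : 0 < a.re) :
    Tendsto (legendreInt a z) (𝓝[>] 1) (𝓝 (legendreInt a z 1)) := by
  refine intervalIntegral.tendsto_integral_filter_of_dominated_convergence
    (fun _ => (3 : ℝ) ^ a.re)
    (Eventually.of_forall fun c => (measurable_legendreKernel a z c).aestronglyMeasurable)
    ?_ (by simp) (ae_of_all _ ?_)
  · have h2 : ∀ᶠ c : ℝ in 𝓝[>] 1, c < 2 :=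
      (eventually_lt_nhds (by norm_num)).filter_mono nhdsWithin_le_nhds
    filter_upwards [self_mem_nhdsWithin, h2] with c hc hc2
    refine ae_of_all _ fun t ht => ?_
    rw [uIoc_of_le Real.pi_pos.le] at ht
    exact (norm_legendreKernel_le hz (add_cos_pos hc t)
      (Real.sin_nonneg_of_nonneg_of_le_pi ht.1.le ht.2)).trans
      (Real.rpow_le_rpow (add_cos_pos hc t).le (by linarith [Real.cos_le_one t]) ha.le)
  · intro t _
    have : Continuous fun c : ℝ => legendreKernel a z c t := by
      unfold legendreKernel
      exact ((Complex.continuous_ofReal_cpow_const ha).comp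
        (continuous_id.add continuous_const)).mul continuous_const
    exact (this.tendsto 1).mono_left nhdsWithin_le_nhds

/-! ### The Green function in the variable `cosh ρ` -/

theorem ofReal_cpow_eq_exp {r : ℝ} (hr : 0 < r) (w : ℂ) :
    (r : ℂ) ^ w = Complex.exp (Real.log r * w) := by
  rw [Complex.cpow_def_of_ne_zero (by exact_mod_cast hr.ne'), Complex.ofReal_log hr.le]

/-- At `c = 1` the Legendre-type integral is a Beta integral, by the substitution
`x = (1 + cos t) / 2`. -/
theorem legendreInt_one (a z : ℂ) :
    legendreInt a z 1 = (2 : ℂ) ^ (a + 2 * z) * Complex.betaIntegral (a + z + 1 / 2) (z + 1 / 2) := by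
  have himg : (fun t : ℝ => (1 + Real.cos t) / 2) '' Ioo 0 π = Ioo 0 1 := by
    ext x
    constructor
    · rintro ⟨t, ht, rfl⟩
      have h1 : Real.cos t < Real.cos 0 :=
        Real.cos_lt_cos_of_nonneg_of_le_pi le_rfl ht.2.le ht.1
      have h2 : Real.cos π < Real.cos t :=
        Real.cos_lt_cos_of_nonneg_of_le_pi ht.1.le le_rfl ht.2
      rw [Real.cos_zero] at h1
      rw [Real.cos_pi] at h2
      constructor <;> simp only <;> linarith
    · intro hx
      refine ⟨Real.arccos (2 * x - 1), ⟨Real.arccos_pos.2 (by linarith [hx.2]), ?_⟩, ?_⟩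
      · refine lt_of_le_of_ne (Real.arccos_le_pi _) fun h => ?_
        rw [Real.arccos_eq_pi] at h
        linarith [hx.1]
      · simp only
        rw [Real.cos_arccos (by linarith [hx.1]) (by linarith [hx.2])]
        ring
  have hinj : InjOn (fun t : ℝ => (1 + Real.cos t) / 2) (Ioo 0 π) := by
    intro s hs t ht h
    simp only at h
    exact Real.injOn_cos ⟨hs.1.le, hs.2.le⟩ ⟨ht.1.le, ht.2.le⟩ (by linarith)
  have hder : ∀ t ∈ Ioo (0 : ℝ) π,
      HasDerivWithinAt (fun t : ℝ => (1 + Real.cos t) / 2) (-Real.sin t / 2) (Ioo 0 π) t :=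
    fun t _ => (((Real.hasDerivAt_cos t).const_add 1).div_const 2).hasDerivWithinAt
  unfold legendreInt Complex.betaIntegral
  rw [intervalIntegral.integral_of_le Real.pi_pos.le, intervalIntegral.integral_of_le zero_le_one,
    integral_Ioc_eq_integral_Ioo, integral_Ioc_eq_integral_Ioo, ← himg,
    integral_image_eq_integral_abs_deriv_smul measurableSet_Ioo hder hinj,
    ← integral_const_mul]
  refine setIntegral_congr_fun measurableSet_Ioo fun t ht => ?_
  have hp : 0 < Real.cos (t / 2) :=
    Real.cos_pos_of_mem_Ioo ⟨by linarith [ht.1, Real.pi_pos], by linarith [ht.2]⟩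
  have hq : 0 < Real.sin (t / 2) :=
    Real.sin_pos_of_pos_of_lt_pi (by linarith [ht.1]) (by linarith [ht.2, Real.pi_pos])
  have e1 : 1 + Real.cos t = 2 * (Real.cos (t / 2) * Real.cos (t / 2)) := by
    have := Real.cos_two_mul (t / 2)
    rw [show 2 * (t / 2) = t by ring] at this
    rw [this]
    ring
  have e2 : Real.sin t = 2 * (Real.cos (t / 2) * Real.sin (t / 2)) := by
    have := Real.sin_two_mul (t / 2)
    rw [show 2 * (t / 2) = t by ring] at this
    rw [this]
    ring
  have e3 : (1 : ℂ) - ((1 + Real.cos t) / 2 : ℝ) = (Real.sin (t / 2) * Real.sin (t / 2) : ℝ) := by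
    rw [e1]
    have := Real.sin_sq_add_cos_sq (t / 2)
    have h : 1 - 2 * (Real.cos (t / 2) * Real.cos (t / 2)) / 2
        = Real.sin (t / 2) * Real.sin (t / 2) := by nlinarith
    exact_mod_cast h
  have hs : 0 < Real.sin t := Real.sin_pos_of_pos_of_lt_pi ht.1 ht.2
  have e4 : |(-Real.sin t / 2)| = Real.cos (t / 2) * Real.sin (t / 2) := by
    rw [abs_of_neg (by linarith), e2]
    ring
  unfold legendreKernel
  rw [e3, e4, e1, e2, show 2 * (Real.cos (t / 2) * Real.cos (t / 2)) / 2
    = Real.cos (t / 2) * Real.cos (t / 2) by ring]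
  generalize Real.cos (t / 2) = p at hp
  generalize Real.sin (t / 2) = q at hq
  have h2 : (2 : ℂ) ^ (a + 2 * z) = Complex.exp (Real.log 2 * (a + 2 * z)) := by
    rw [← ofReal_cpow_eq_exp two_pos]
    norm_num
  have h5 : ((p * q : ℝ) : ℂ) = Complex.exp (Real.log p + Real.log q) := by
    rw [← Complex.ofReal_add, ← Real.log_mul hp.ne' hq.ne', ← Complex.ofReal_exp,
      Real.exp_log (by positivity)]
  rw [Complex.real_smul, h2, h5, ofReal_cpow_eq_exp (by positivity),
    ofReal_cpow_eq_exp (by positivity), ofReal_cpow_eq_exp (by positivity),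
    ofReal_cpow_eq_exp (by positivity), Real.log_mul two_ne_zero (by positivity),
    Real.log_mul two_ne_zero (by positivity), Real.log_mul hp.ne' hp.ne',
    Real.log_mul hp.ne' hq.ne', Real.log_mul hq.ne' hq.ne', ← Complex.exp_add, ← Complex.exp_add,
    ← Complex.exp_add, ← Complex.exp_add]
  congr 1
  push_cast
  ring

/-- The Green function as a function of `c = cosh ρ`. -/
def greenFun (n : ℕ) (z : ℂ) (c : ℝ) : ℂ :=
  greenConst n z * (((c ^ 2 - 1) ^ (-(((n : ℝ) - 2) / 2)) : ℝ) : ℂ)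
    * legendreInt (((n : ℂ) - 3) / 2 - z) z c

/-- The derivative of `greenFun` with respect to `c = cosh ρ`. -/
def greenFunDeriv (n : ℕ) (z : ℂ) (c : ℝ) : ℂ :=
  -((((n : ℂ) - 1) / 2 + z) * greenConst n z) * (((c ^ 2 - 1) ^ (-((n : ℝ) / 2)) : ℝ) : ℂ)
    * legendreInt (((n : ℂ) - 1) / 2 - z) z c

/-- The second derivative of `greenFun`, read off from the radial Helmholtz equation
`(c² - 1) H'' + n c H' + ((n-1)²/4 - z²) H = 0`. -/
def greenFunDeriv₂ (n : ℕ) (z : ℂ) (c : ℝ) : ℂ :=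
  -(n * c * greenFunDeriv n z c + (((n : ℂ) - 1) ^ 2 / 4 - z ^ 2) * greenFun n z c)
    / ((c : ℂ) ^ 2 - 1)

section radial

variable {n : ℕ} {z : ℂ} {c : ℝ}

theorem sq_sub_one_pos (hc : 1 < c) : 0 < c ^ 2 - 1 := by nlinarith

theorem ofReal_sq_sub_one_ne_zero (hc : 1 < c) : (c : ℂ) ^ 2 - 1 ≠ 0 := by
  have := (sq_sub_one_pos hc).ne'
  exact_mod_cast this

theorem rpow_sq_sub_one_succ (hc : 1 < c) :
    (c ^ 2 - 1) ^ (-(((n : ℝ) - 2) / 2)) = (c ^ 2 - 1) * (c ^ 2 - 1) ^ (-((n : ℝ) / 2)) := by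
  rw [show -(((n : ℝ) - 2) / 2) = 1 + -((n : ℝ) / 2) by ring,
    Real.rpow_add (sq_sub_one_pos hc), Real.rpow_one]

theorem hasDerivAt_rpow_sq_sub_one (hc : 1 < c) (r : ℝ) :
    HasDerivAt (fun c : ℝ => (((c ^ 2 - 1) ^ r : ℝ) : ℂ))
      ((2 * c * r * (c ^ 2 - 1) ^ (r - 1) : ℝ) : ℂ) c := by
  have h := sq_sub_one_pos hc
  have h1 : HasDerivAt (fun c : ℝ => c ^ 2 - 1) (2 * c) c := by
    simpa using (hasDerivAt_pow 2 c).sub_const 1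
  exact (h1.rpow_const (p := r) (Or.inl h.ne')).ofReal_comp

theorem hasDerivAt_greenFun (hz : z.re = 0) (hc : 1 < c) :
    HasDerivAt (greenFun n z) (greenFunDeriv n z c) c := by
  have h := ((hasDerivAt_rpow_sq_sub_one hc (-(((n : ℝ) - 2) / 2))).const_mul
    (greenConst n z)).mul (hasDerivAt_legendreInt (((n : ℂ) - 3) / 2 - z) hz hc)
  refine h.congr_deriv ?_
  have hr := legendreInt_contiguous (((n : ℂ) - 3) / 2 - z) hz hc
  rw [show ((n : ℂ) - 3) / 2 - z + 1 = ((n : ℂ) - 1) / 2 - z by ring] at hr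
  rw [rpow_sq_sub_one_succ hc, show -(((n : ℝ) - 2) / 2) - 1 = -((n : ℝ) / 2) by ring]
  unfold greenFunDeriv
  push_cast
  generalize (((c ^ 2 - 1) ^ (-((n : ℝ) / 2)) : ℝ) : ℂ) = P
  linear_combination (greenConst n z * P) * hr

theorem hasDerivAt_greenFunDeriv (hz : z.re = 0) (hc : 1 < c) :
    HasDerivAt (greenFunDeriv n z) (greenFunDeriv₂ n z c) c := by
  have h := ((hasDerivAt_rpow_sq_sub_one hc (-((n : ℝ) / 2))).const_mul
    (-((((n : ℂ) - 1) / 2 + z) * greenConst n z))).mul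
      (hasDerivAt_legendreInt (((n : ℂ) - 1) / 2 - z) hz hc)
  refine h.congr_deriv ?_
  rw [show ((n : ℂ) - 1) / 2 - z - 1 = ((n : ℂ) - 3) / 2 - z by ring]
  have h0 := ofReal_sq_sub_one_ne_zero hc
  have e : (c ^ 2 - 1) ^ (-((n : ℝ) / 2) - 1) = (c ^ 2 - 1) ^ (-((n : ℝ) / 2)) / (c ^ 2 - 1) := by
    rw [Real.rpow_sub (sq_sub_one_pos hc), Real.rpow_one]
  unfold greenFunDeriv₂ greenFunDeriv greenFun
  rw [rpow_sq_sub_one_succ hc, e]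
  push_cast
  generalize (((c ^ 2 - 1) ^ (-((n : ℝ) / 2)) : ℝ) : ℂ) = P
  field_simp
  ring

theorem greenFun_ode (hc : 1 < c) :
    ((c : ℂ) ^ 2 - 1) * greenFunDeriv₂ n z c + n * c * greenFunDeriv n z c
      = -((((n : ℂ) - 1) ^ 2 / 4 - z ^ 2) * greenFun n z c) := by
  have h0 := ofReal_sq_sub_one_ne_zero hc
  unfold greenFunDeriv₂
  field_simp
  ring

theorem rpow_sq_sub_one_eq (hc : 1 < c) (r : ℝ) :
    (c ^ 2 - 1) ^ r = (c - 1) ^ r * (c + 1) ^ r := by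
  rw [← Real.mul_rpow (by linarith) (by linarith)]
  congr 1
  ring

theorem norm_greenFun_le (hn : 2 ≤ n) (hz : z.re = 0) (hc : 1 < c) :
    ‖greenFun n z c‖ ≤ π * ‖greenConst n z‖ * (c - 1) ^ (-(((n : ℝ) - 1) / 2)) := by
  have hn' : (2 : ℝ) ≤ n := by exact_mod_cast hn
  have hre : (((n : ℂ) - 3) / 2 - z).re = ((n : ℝ) - 3) / 2 := by simp [hz]
  have hJ := norm_legendreInt_le (a := ((n : ℂ) - 3) / 2 - z) hz (by rw [hre]; linarith) hc
  rw [hre] at hJ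
  have h1 : 0 < c - 1 := by linarith
  have h2 : 0 < c + 1 := by linarith
  unfold greenFun
  rw [norm_mul, norm_mul, Complex.norm_real, Real.norm_of_nonneg
    (Real.rpow_nonneg (sq_sub_one_pos hc).le _)]
  calc _ ≤ ‖greenConst n z‖ * (c ^ 2 - 1) ^ (-(((n : ℝ) - 2) / 2)) * (π *
        ((c + 1) ^ (((n : ℝ) - 3) / 2 + 1 / 2) * (c - 1) ^ (-(1 / 2) : ℝ))) := by
        refine mul_le_mul_of_nonneg_left hJ ?_
        exact mul_nonneg (norm_nonneg _) (Real.rpow_nonneg (sq_sub_one_pos hc).le _)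
    _ = π * ‖greenConst n z‖ * (((c - 1) ^ (-(((n : ℝ) - 2) / 2)) * (c - 1) ^ (-(1 / 2) : ℝ)) *
        ((c + 1) ^ (-(((n : ℝ) - 2) / 2)) * (c + 1) ^ (((n : ℝ) - 3) / 2 + 1 / 2))) := by
        rw [rpow_sq_sub_one_eq hc]
        ring
    _ = _ := by
        rw [← Real.rpow_add h1, ← Real.rpow_add h2,
          show -(((n : ℝ) - 2) / 2) + (((n : ℝ) - 3) / 2 + 1 / 2) = 0 by ring, Real.rpow_zero,
          mul_one]
        congr 2
        ring

theorem norm_greenFunDeriv_le_mul (hn : 2 ≤ n) (hz : z.re = 0) (hc : 1 < c) :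
    ‖greenFunDeriv n z c‖ ≤ π * ‖(((n : ℂ) - 1) / 2 + z) * greenConst n z‖ *
      ((c - 1) ^ (-((n : ℝ) / 2)) * (c + 1) ^ (-(1 / 2) : ℝ)) := by
  have hn' : (2 : ℝ) ≤ n := by exact_mod_cast hn
  have hre : (((n : ℂ) - 1) / 2 - z).re = ((n : ℝ) - 1) / 2 := by simp [hz]
  have hJ := norm_legendreInt_le_of_nonneg (a := ((n : ℂ) - 1) / 2 - z) hz
    (by rw [hre]; linarith) hc
  rw [hre] at hJ
  have h2 : 0 < c + 1 := by linarith
  unfold greenFunDeriv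
  rw [norm_mul, norm_mul, norm_neg, Complex.norm_real, Real.norm_of_nonneg
    (Real.rpow_nonneg (sq_sub_one_pos hc).le _)]
  calc _ ≤ ‖(((n : ℂ) - 1) / 2 + z) * greenConst n z‖ * (c ^ 2 - 1) ^ (-((n : ℝ) / 2)) *
        (π * (c + 1) ^ (((n : ℝ) - 1) / 2)) := by
        refine mul_le_mul_of_nonneg_left hJ ?_
        exact mul_nonneg (norm_nonneg _) (Real.rpow_nonneg (sq_sub_one_pos hc).le _)
    _ = π * ‖(((n : ℂ) - 1) / 2 + z) * greenConst n z‖ * ((c - 1) ^ (-((n : ℝ) / 2)) *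
        ((c + 1) ^ (-((n : ℝ) / 2)) * (c + 1) ^ (((n : ℝ) - 1) / 2))) := by
        rw [rpow_sq_sub_one_eq hc]
        ring
    _ = _ := by
        rw [← Real.rpow_add h2]
        congr 3
        ring

theorem norm_greenFunDeriv_le_near (hn : 2 ≤ n) (hz : z.re = 0) (hc : 1 < c) :
    ‖greenFunDeriv n z c‖ ≤ π * ‖(((n : ℂ) - 1) / 2 + z) * greenConst n z‖ *
      (c - 1) ^ (-((n : ℝ) / 2)) := by
  refine (norm_greenFunDeriv_le_mul hn hz hc).trans (mul_le_mul_of_nonneg_left ?_ (by positivity))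
  refine mul_le_of_le_one_right (Real.rpow_nonneg (by linarith) _) ?_
  exact Real.rpow_le_one_of_one_le_of_nonpos (by linarith) (by norm_num)

theorem norm_greenFunDeriv_le (hn : 2 ≤ n) (hz : z.re = 0) (hc : 1 < c) :
    ‖greenFunDeriv n z c‖ ≤ π * ‖(((n : ℂ) - 1) / 2 + z) * greenConst n z‖ *
      (c - 1) ^ (-(((n : ℝ) + 1) / 2)) := by
  refine (norm_greenFunDeriv_le_mul hn hz hc).trans (mul_le_mul_of_nonneg_left ?_ (by positivity))
  rw [show -(((n : ℝ) + 1) / 2) = -((n : ℝ) / 2) + -(1 / 2) by ring,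
    Real.rpow_add (by linarith)]
  refine mul_le_mul_of_nonneg_left ?_ (Real.rpow_nonneg (by linarith) _)
  exact Real.rpow_le_rpow_of_nonpos (by linarith) (by linarith) (by norm_num)

/-- The radiation condition for the Green function, in the variable `c = cosh ρ`. -/
theorem norm_greenFun_radiation_le (hn : 2 ≤ n) (hz : z.re = 0) (hc : 1 < c) :
    ‖c * greenFunDeriv n z c + (((n : ℂ) - 1) / 2 + z) * greenFun n z c‖
      ≤ π * ‖(((n : ℂ) - 1) / 2 + z) * greenConst n z‖ * (c - 1) ^ (-(((n : ℝ) + 1) / 2)) := by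
  have hn' : (2 : ℝ) ≤ n := by exact_mod_cast hn
  have hre : (((n : ℂ) - 3) / 2 - z).re = ((n : ℝ) - 3) / 2 := by simp [hz]
  have hJ := norm_legendreInt_comb_le (a := ((n : ℂ) - 3) / 2 - z) hz (by rw [hre]; linarith) hc
  rw [hre, show ((n : ℂ) - 3) / 2 - z + 1 = ((n : ℂ) - 1) / 2 - z by ring] at hJ
  have h1 : 0 < c - 1 := by linarith
  have h2 : 0 < c + 1 := by linarith
  have e : c * greenFunDeriv n z c + (((n : ℂ) - 1) / 2 + z) * greenFun n z c
      = ((((n : ℂ) - 1) / 2 + z) * greenConst n z) * (((c ^ 2 - 1) ^ (-((n : ℝ) / 2)) : ℝ) : ℂ) *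
        (((c : ℂ) ^ 2 - 1) * legendreInt (((n : ℂ) - 3) / 2 - z) z c
          - c * legendreInt (((n : ℂ) - 1) / 2 - z) z c) := by
    unfold greenFunDeriv greenFun
    rw [rpow_sq_sub_one_succ hc]
    push_cast
    ring
  rw [e, norm_mul, norm_mul _ (((_ : ℝ) : ℂ)), Complex.norm_real, Real.norm_of_nonneg
    (Real.rpow_nonneg (sq_sub_one_pos hc).le _)]
  calc _ ≤ ‖(((n : ℂ) - 1) / 2 + z) * greenConst n z‖ * (c ^ 2 - 1) ^ (-((n : ℝ) / 2)) *
        (π * ((c + 1) * ((c + 1) ^ (((n : ℝ) - 3) / 2 + 1 / 2) * (c - 1) ^ (-(1 / 2) : ℝ)))) := by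
        refine mul_le_mul_of_nonneg_left hJ ?_
        exact mul_nonneg (norm_nonneg _) (Real.rpow_nonneg (sq_sub_one_pos hc).le _)
    _ = π * ‖(((n : ℂ) - 1) / 2 + z) * greenConst n z‖ *
        (((c - 1) ^ (-((n : ℝ) / 2)) * (c - 1) ^ (-(1 / 2) : ℝ)) *
        ((c + 1) ^ (-((n : ℝ) / 2)) * (c + 1) ^ (1 : ℝ) * (c + 1) ^ (((n : ℝ) - 3) / 2 + 1 / 2))) := by
        rw [rpow_sq_sub_one_eq hc, Real.rpow_one]
        ring
    _ = _ := by
        rw [← Real.rpow_add h1, ← Real.rpow_add h2, ← Real.rpow_add h2,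
          show -((n : ℝ) / 2) + 1 + (((n : ℝ) - 3) / 2 + 1 / 2) = 0 by ring, Real.rpow_zero,
          mul_one]
        congr 2
        ring

/-- The normalization `A_{n,z}` makes the flux of the Green function through a small geodesic
sphere equal to `-1`: in the limit `(sinh ρ)^(n-1) ∂G/∂ρ` is the negative inverse of the area
`2 π^(n/2) / Γ(n/2)` of the unit sphere. -/
theorem greenConst_mul_legendreInt_one (hn : 2 ≤ n) (hz : z.re = 0) :
    (((n : ℂ) - 1) / 2 + z) * greenConst n z * legendreInt (((n : ℂ) - 1) / 2 - z) z 1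
      = ((Real.Gamma (n / 2) / (2 * π ^ ((n : ℝ) / 2)) : ℝ) : ℂ) := by
  have hn' : (2 : ℝ) ≤ n := by exact_mod_cast hn
  have hre1 : 0 < ((n : ℂ) / 2).re := by
    simp
    linarith
  have hre2 : 0 < (z + 1 / 2).re := by simp [hz]
  have hβ : ((n : ℂ) - 1) / 2 + z ≠ 0 := by
    intro h
    have := congrArg Complex.re h
    simp [hz] at this
    linarith
  have hB := Complex.Gamma_mul_Gamma_eq_betaIntegral hre1 hre2
  have hG1 : Complex.Gamma (z + 1 / 2) ≠ 0 := Complex.Gamma_ne_zero_of_re_pos hre2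
  have hG2 : Complex.Gamma ((n : ℂ) / 2 + (z + 1 / 2)) ≠ 0 :=
    Complex.Gamma_ne_zero_of_re_pos (by rw [Complex.add_re]; linarith)
  have hG3 : Complex.Gamma ((n : ℂ) / 2 + (z + 1 / 2))
      = (((n : ℂ) - 1) / 2 + z) * Complex.Gamma (((n : ℂ) - 1) / 2 + z) := by
    rw [← Complex.Gamma_add_one _ hβ]
    congr 1
    ring
  have hp1 : (2 * (π : ℂ)) ^ (-((n : ℂ) / 2))
      = Complex.exp (-(n / 2) * (Real.log 2 + Real.log π)) := by
    have : (2 * (π : ℂ)) = ((2 * π : ℝ) : ℂ) := by push_cast; ring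
    rw [this, ofReal_cpow_eq_exp (by positivity), Real.log_mul two_ne_zero Real.pi_ne_zero]
    congr 1
    push_cast
    ring
  have h2p : ∀ w : ℂ, (2 : ℂ) ^ w = Complex.exp (Real.log 2 * w) := fun w => by
    rw [← ofReal_cpow_eq_exp two_pos]
    norm_num
  have hp2 : ((π ^ ((n : ℝ) / 2) : ℝ) : ℂ) = Complex.exp (Real.log π * (n / 2)) := by
    rw [Complex.ofReal_cpow Real.pi_pos.le, ofReal_cpow_eq_exp Real.pi_pos]
    push_cast
    rfl
  rw [legendreInt_one, show ((n : ℂ) - 1) / 2 - z + z + 1 / 2 = (n : ℂ) / 2 by ring]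
  have hB' : Complex.betaIntegral ((n : ℂ) / 2) (z + 1 / 2)
      = Complex.Gamma (n / 2) * Complex.Gamma (z + 1 / 2)
        / Complex.Gamma ((n : ℂ) / 2 + (z + 1 / 2)) := by
    rw [hB, mul_div_cancel_left₀ _ hG2]
  have hGr : ((Real.Gamma (n / 2) : ℝ) : ℂ) = Complex.Gamma (n / 2) := by
    rw [← Complex.Gamma_ofReal]
    push_cast
    rfl
  have hexp : (2 : ℂ) * (Complex.exp (-(n / 2) * (Real.log 2 + Real.log π)) *
      Complex.exp (Real.log 2 * (((n : ℂ) - 1) / 2 - z + 2 * z)) *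
      Complex.exp (Real.log π * (n / 2))) = Complex.exp (Real.log 2 * (z + 1 / 2)) := by
    have h2e : (2 : ℂ) = Complex.exp (Real.log 2) := by
      rw [← Complex.ofReal_exp, Real.exp_log two_pos]
      norm_num
    nth_rewrite 1 [h2e]
    rw [← Complex.exp_add, ← Complex.exp_add, ← Complex.exp_add]
    congr 1
    ring
  unfold greenConst
  push_cast
  rw [hB', hp1, h2p, h2p, hGr, hp2, hG3]
  rw [hG3] at hG2
  have hG4 := right_ne_zero_of_mul hG2
  have hx1 := Complex.exp_ne_zero (Real.log 2 * (z + 1 / 2))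
  have hx2 := Complex.exp_ne_zero (Real.log π * (n / 2))
  generalize Complex.exp (Real.log 2 * (z + 1 / 2)) = X1 at *
  generalize Complex.exp (Real.log π * (n / 2)) = X2 at *
  generalize Complex.exp (-(n / 2) * (Real.log 2 + Real.log π)) = X3 at *
  generalize Complex.exp (Real.log 2 * (((n : ℂ) - 1) / 2 - z + 2 * z)) = X4 at *
  generalize Complex.Gamma (((n : ℂ) - 1) / 2 + z) = G1 at *
  generalize ((n : ℂ) - 1) / 2 + z = β at *
  generalize Complex.Gamma (z + 1 / 2) = G2 at *
  generalize Complex.Gamma (n / 2) = G3 at *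
  field_simp
  linear_combination G3 * hexp

end radial

/-! ### The singularity of the Green function at the pole -/

section radial

variable {n : ℕ} {z : ℂ}

/-- The leading singularity of the Green function: `H'` blows up like `(c - 1)^(-n/2)`, with the
universal constant fixed by the normalization. -/
theorem tendsto_rpow_mul_greenFunDeriv (hn : 2 ≤ n) (hz : z.re = 0) :
    Tendsto (fun c : ℝ => (((c - 1) ^ ((n : ℝ) / 2) : ℝ) : ℂ) * greenFunDeriv n z c) (𝓝[>] 1)
      (𝓝 ((-(Real.Gamma (n / 2) / (2 * π ^ ((n : ℝ) / 2)) * 2 ^ (-((n : ℝ) / 2))) : ℝ) : ℂ)) := by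
  have hn' : (2 : ℝ) ≤ n := by exact_mod_cast hn
  have hre : 0 < (((n : ℂ) - 1) / 2 - z).re := by
    simp [hz]
    linarith
  have h1 := tendsto_legendreInt_one hz hre
  have h2 : Tendsto (fun c : ℝ => (((c + 1) ^ (-((n : ℝ) / 2)) : ℝ) : ℂ)) (𝓝[>] 1)
      (𝓝 ((2 ^ (-((n : ℝ) / 2)) : ℝ) : ℂ)) := by
    refine (Complex.continuous_ofReal.tendsto _).comp ?_
    have : ContinuousAt (fun c : ℝ => (c + 1) ^ (-((n : ℝ) / 2))) 1 :=
      ContinuousAt.rpow_const (by fun_prop) (Or.inl (by norm_num))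
    have h3 := this.tendsto.mono_left (nhdsWithin_le_nhds (s := Ioi 1))
    rwa [show (1 : ℝ) + 1 = 2 by norm_num] at h3
  have h3 := (h2.mul h1).const_mul (-((((n : ℂ) - 1) / 2 + z) * greenConst n z))
  have e : -((((n : ℂ) - 1) / 2 + z) * greenConst n z) * (((2 ^ (-((n : ℝ) / 2)) : ℝ) : ℂ) *
      legendreInt (((n : ℂ) - 1) / 2 - z) z 1)
      = ((-(Real.Gamma (n / 2) / (2 * π ^ ((n : ℝ) / 2)) * 2 ^ (-((n : ℝ) / 2))) : ℝ) : ℂ) := by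
    have := greenConst_mul_legendreInt_one hn hz
    rw [Complex.ofReal_neg, Complex.ofReal_mul, ← this]
    ring
  rw [e] at h3
  refine h3.congr' ?_
  filter_upwards [self_mem_nhdsWithin] with c hc
  have hc : 1 < c := hc
  have e2 : (c - 1) ^ ((n : ℝ) / 2) * (c - 1) ^ (-((n : ℝ) / 2)) = 1 := by
    rw [← Real.rpow_add (by linarith)]
    simp
  have e3 : (((c - 1) ^ ((n : ℝ) / 2) : ℝ) : ℂ) * (((c - 1) ^ (-((n : ℝ) / 2)) : ℝ) : ℂ) = 1 := by
    exact_mod_cast e2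
  unfold greenFunDeriv
  rw [rpow_sq_sub_one_eq hc, Complex.ofReal_mul]
  linear_combination (((((n : ℂ) - 1) / 2 + z) * greenConst n z) *
    (((c + 1) ^ (-((n : ℝ) / 2)) : ℝ) : ℂ) * legendreInt (((n : ℂ) - 1) / 2 - z) z c) * e3

theorem norm_rpow_mul_greenFun_le (hn : 2 ≤ n) (hz : z.re = 0) {c : ℝ} (hc : 1 < c) :
    ‖(((c - 1) ^ ((n : ℝ) / 2) : ℝ) : ℂ) * greenFun n z c‖
      ≤ π * ‖greenConst n z‖ * (c - 1) ^ (1 / 2 : ℝ) := by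
  have h0 : 0 < c - 1 := by linarith
  rw [norm_mul, Complex.norm_real, Real.norm_of_nonneg (Real.rpow_nonneg h0.le _)]
  calc _ ≤ (c - 1) ^ ((n : ℝ) / 2) *
        (π * ‖greenConst n z‖ * (c - 1) ^ (-(((n : ℝ) - 1) / 2))) :=
        mul_le_mul_of_nonneg_left (norm_greenFun_le hn hz hc) (Real.rpow_nonneg h0.le _)
    _ = π * ‖greenConst n z‖ * ((c - 1) ^ ((n : ℝ) / 2) * (c - 1) ^ (-(((n : ℝ) - 1) / 2))) := by
        ring
    _ = _ := by
        rw [← Real.rpow_add h0]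
        congr 2
        ring

theorem norm_rpow_mul_greenFunDeriv_le (hn : 2 ≤ n) (hz : z.re = 0) {c : ℝ} (hc : 1 < c) :
    ‖(((c - 1) ^ ((n : ℝ) / 2) : ℝ) : ℂ) * greenFunDeriv n z c‖
      ≤ π * ‖(((n : ℂ) - 1) / 2 + z) * greenConst n z‖ := by
  have h0 : 0 < c - 1 := by linarith
  rw [norm_mul, Complex.norm_real, Real.norm_of_nonneg (Real.rpow_nonneg h0.le _)]
  calc _ ≤ (c - 1) ^ ((n : ℝ) / 2) *
        (π * ‖(((n : ℂ) - 1) / 2 + z) * greenConst n z‖ * (c - 1) ^ (-((n : ℝ) / 2))) :=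
        mul_le_mul_of_nonneg_left (norm_greenFunDeriv_le_near hn hz hc) (Real.rpow_nonneg h0.le _)
    _ = π * ‖(((n : ℂ) - 1) / 2 + z) * greenConst n z‖ *
          ((c - 1) ^ ((n : ℝ) / 2) * (c - 1) ^ (-((n : ℝ) / 2))) := by
        ring
    _ = _ := by
        rw [← Real.rpow_add h0]
        simp

theorem tendsto_rpow_mul_greenFun (hn : 2 ≤ n) (hz : z.re = 0) :
    Tendsto (fun c : ℝ => (((c - 1) ^ ((n : ℝ) / 2) : ℝ) : ℂ) * greenFun n z c) (𝓝[>] 1)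
      (𝓝 0) := by
  rw [tendsto_zero_iff_norm_tendsto_zero]
  have h : Tendsto (fun c : ℝ => π * ‖greenConst n z‖ * (c - 1) ^ (1 / 2 : ℝ)) (𝓝[>] 1) (𝓝 0) := by
    have : ContinuousAt (fun c : ℝ => π * ‖greenConst n z‖ * (c - 1) ^ (1 / 2 : ℝ)) 1 :=
      continuousAt_const.mul (ContinuousAt.rpow_const (by fun_prop) (Or.inr (by norm_num)))
    have h3 := this.tendsto.mono_left (nhdsWithin_le_nhds (s := Ioi 1))
    simpa using h3
  refine tendsto_of_tendsto_of_tendsto_of_le_of_le' tendsto_const_nhds h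
    (Eventually.of_forall fun _ => norm_nonneg _) ?_
  filter_upwards [self_mem_nhdsWithin] with c hc
  exact norm_rpow_mul_greenFun_le hn hz hc

/-- The radial equation, rescaled so that both sides stay bounded as `c → 1`. -/
theorem rpow_mul_greenFunDeriv₂ {c : ℝ} (hc : 1 < c) :
    (((c - 1) ^ ((n : ℝ) / 2 + 1) : ℝ) : ℂ) * greenFunDeriv₂ n z c
      = -(n * c * ((((c - 1) ^ ((n : ℝ) / 2) : ℝ) : ℂ) * greenFunDeriv n z c)
        + (((n : ℂ) - 1) ^ 2 / 4 - z ^ 2) *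
          ((((c - 1) ^ ((n : ℝ) / 2) : ℝ) : ℂ) * greenFun n z c)) / ((c : ℂ) + 1) := by
  have h0 : 0 < c - 1 := by linarith
  have h1 : (c : ℂ) - 1 ≠ 0 := by exact_mod_cast h0.ne'
  have h2 : (c : ℂ) + 1 ≠ 0 := by
    have : c + 1 ≠ 0 := by linarith
    exact_mod_cast this
  have h3 := ofReal_sq_sub_one_ne_zero hc
  unfold greenFunDeriv₂
  rw [Real.rpow_add h0, Real.rpow_one, show (c : ℂ) ^ 2 - 1 = ((c : ℂ) - 1) * (c + 1) by ring]
  push_cast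
  field_simp

/-- The value of `(-Δ - (n-1)²/4 + z²) (greenFun n z (c + ε)) / ε` at `c = s - ε`. -/
def greenDefect (n : ℕ) (z : ℂ) (ε s : ℝ) : ℂ :=
  (2 * s - ε) * greenFunDeriv₂ n z s + n * greenFunDeriv n z s

theorem rpow_mul_greenDefect {ε c : ℝ} (hc : 1 < c) :
    (((c - 1) ^ ((n : ℝ) / 2 + 1) : ℝ) : ℂ) * greenDefect n z ε c
      = (2 * c - ε) * (((((c - 1) ^ ((n : ℝ) / 2 + 1) : ℝ) : ℂ)) * greenFunDeriv₂ n z c)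
        + n * (c - 1) * ((((c - 1) ^ ((n : ℝ) / 2) : ℝ) : ℂ) * greenFunDeriv n z c) := by
  unfold greenDefect
  have h0 : 0 < c - 1 := by linarith
  rw [Real.rpow_add h0, Real.rpow_one]
  push_cast
  ring

theorem volume_unit_ball_toReal (hn : 2 ≤ n) :
    (volume (Metric.ball (0 : E n) 1)).toReal
      = (n * (Real.Gamma (n / 2) / (2 * π ^ ((n : ℝ) / 2))))⁻¹ := by
  have : NeZero n := ⟨by omega⟩
  have hn' : (0 : ℝ) < n := by
    have : 0 < n := by omega
    exact_mod_cast this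
  have hG : Real.Gamma ((n : ℝ) / 2) ≠ 0 := (Real.Gamma_pos_of_pos (by positivity)).ne'
  rw [EuclideanSpace.volume_ball, Fintype.card_fin, ENNReal.ofReal_one, one_pow, one_mul,
    ENNReal.toReal_ofReal (by
      refine div_nonneg (by positivity) (Real.Gamma_pos_of_pos (by positivity)).le),
    Real.Gamma_add_one (by positivity), Real.sqrt_eq_rpow, ← Real.rpow_natCast,
    ← Real.rpow_mul Real.pi_pos.le, show (1 / 2 : ℝ) * n = n / 2 by ring]
  have : π ^ ((n : ℝ) / 2) ≠ 0 := (Real.rpow_pos_of_pos Real.pi_pos _).ne'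
  field_simp

/-- The limit profile of the defect near the pole; its constant is such that the total mass of the
rescaled defect is `1`. -/
theorem tendsto_rpow_mul_greenDefect (hn : 2 ≤ n) (hz : z.re = 0) {ι : Type*} {l : Filter ι}
    {ε s : ι → ℝ} (hε : Tendsto ε l (𝓝 0)) (hs : Tendsto s l (𝓝[>] 1)) :
    Tendsto (fun i => (((s i - 1) ^ ((n : ℝ) / 2 + 1) : ℝ) : ℂ) * greenDefect n z (ε i) (s i)) l
      (𝓝 ((2 ^ (-((n : ℝ) / 2)) / (volume (Metric.ball (0 : E n) 1)).toReal : ℝ) : ℂ)) := by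
  have hs1 : Tendsto s l (𝓝 1) := hs.mono_right nhdsWithin_le_nhds
  have hsc : Tendsto (fun i => (s i : ℂ)) l (𝓝 1) := by
    have := (Complex.continuous_ofReal.tendsto 1).comp hs1
    rwa [Complex.ofReal_one] at this
  have hεc : Tendsto (fun i => (ε i : ℂ)) l (𝓝 0) := by
    have := (Complex.continuous_ofReal.tendsto 0).comp hε
    rwa [Complex.ofReal_zero] at this
  have t1 := (tendsto_rpow_mul_greenFunDeriv (n := n) hn hz).comp hs
  have t2 := (tendsto_rpow_mul_greenFun (n := n) hn hz).comp hs
  have t3 := ((((hsc.const_mul (n : ℂ)).mul t1).add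
    (t2.const_mul (((n : ℂ) - 1) ^ 2 / 4 - z ^ 2))).neg).div (hsc.add_const 1) (by norm_num)
  have t4 := (((hsc.const_mul 2).sub hεc).mul t3).add
    (((hsc.sub_const 1).const_mul (n : ℂ)).mul t1)
  rw [volume_unit_ball_toReal hn]
  have e : ∀ K : ℝ, (2 * 1 - 0) * (-((n : ℂ) * 1 * ((-K : ℝ) : ℂ)
      + (((n : ℂ) - 1) ^ 2 / 4 - z ^ 2) * 0) / (1 + 1)) + n * (1 - 1) * ((-K : ℝ) : ℂ)
      = ((n * K : ℝ) : ℂ) := by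
    intro K
    push_cast
    ring
  rw [e] at t4
  have e2 : (n * (Real.Gamma (n / 2) / (2 * π ^ ((n : ℝ) / 2)) * 2 ^ (-((n : ℝ) / 2))) : ℝ)
      = 2 ^ (-((n : ℝ) / 2)) / (n * (Real.Gamma (n / 2) / (2 * π ^ ((n : ℝ) / 2))))⁻¹ := by
    rw [div_inv_eq_mul]
    ring
  rw [← e2]
  refine t4.congr' ?_
  filter_upwards [hs self_mem_nhdsWithin] with i hi
  have hi : 1 < s i := hi
  rw [rpow_mul_greenDefect hi, rpow_mul_greenFunDeriv₂ hi]
  simp only [Function.comp, Pi.div_apply]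

/-- The majorant for the dominated convergence of the rescaled defect, uniform for `c` bounded. -/
theorem exists_norm_greenDefect_le (hn : 2 ≤ n) (hz : z.re = 0) (C₀ : ℝ) :
    ∃ C, 0 ≤ C ∧ ∀ ε s : ℝ, 0 ≤ ε → ε ≤ 1 → 1 < s → s ≤ C₀ →
      ‖greenDefect n z ε s‖ ≤ C * (s - 1) ^ (-((n : ℝ) / 2 + 1)) := by
  set C1 := π * ‖(((n : ℂ) - 1) / 2 + z) * greenConst n z‖
  set C2 := π * ‖greenConst n z‖ * |C₀|
  set κ := ‖((n : ℂ) - 1) ^ 2 / 4 - z ^ 2‖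
  refine ⟨(2 * |C₀| + 1) * (n * |C₀| * C1 + κ * C2) + n * |C₀| * C1, by positivity,
    fun ε s h0 h1 hs hs0 => ?_⟩
  have hs' : 0 < s - 1 := by linarith
  have hC : s ≤ |C₀| := hs0.trans (le_abs_self _)
  have b1 := norm_rpow_mul_greenFunDeriv_le (n := n) hn hz hs
  have b2 : ‖(((s - 1) ^ ((n : ℝ) / 2) : ℝ) : ℂ) * greenFun n z s‖ ≤ C2 := by
    refine (norm_rpow_mul_greenFun_le hn hz hs).trans
      (mul_le_mul_of_nonneg_left ?_ (by positivity))
    rw [← Real.sqrt_eq_rpow, Real.sqrt_le_left (by positivity)]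
    nlinarith
  have b3 : ‖(((s - 1) ^ ((n : ℝ) / 2 + 1) : ℝ) : ℂ) * greenFunDeriv₂ n z s‖
      ≤ n * |C₀| * C1 + κ * C2 := by
    rw [rpow_mul_greenFunDeriv₂ hs, norm_div, norm_neg]
    have hd : 1 ≤ ‖(s : ℂ) + 1‖ := by
      have : ‖((s + 1 : ℝ) : ℂ)‖ = s + 1 := by
        rw [Complex.norm_real, Real.norm_of_nonneg (by linarith)]
      push_cast at this
      rw [this]
      linarith
    refine (div_le_self (norm_nonneg _) hd).trans ((norm_add_le _ _).trans ?_)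
    rw [norm_mul, norm_mul (_ - _)]
    refine add_le_add (mul_le_mul ?_ b1 (norm_nonneg _) (by positivity))
      (mul_le_mul_of_nonneg_left b2 (norm_nonneg _))
    rw [norm_mul, Complex.norm_natCast, Complex.norm_real, Real.norm_of_nonneg (by linarith)]
    exact mul_le_mul_of_nonneg_left hC (by positivity)
  have b4 : ‖(((s - 1) ^ ((n : ℝ) / 2 + 1) : ℝ) : ℂ) * greenDefect n z ε s‖
      ≤ (2 * |C₀| + 1) * (n * |C₀| * C1 + κ * C2) + n * |C₀| * C1 := by
    rw [rpow_mul_greenDefect hs]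
    refine (norm_add_le _ _).trans ?_
    rw [norm_mul, norm_mul (_ * _)]
    refine add_le_add (mul_le_mul ?_ b3 (norm_nonneg _) (by positivity))
      (mul_le_mul ?_ b1 (norm_nonneg _) (by positivity))
    · have : (2 * (s : ℂ) - ε) = ((2 * s - ε : ℝ) : ℂ) := by push_cast; ring
      rw [this, Complex.norm_real, Real.norm_of_nonneg (by linarith)]
      linarith
    · have : ((s : ℂ) - 1) = ((s - 1 : ℝ) : ℂ) := by push_cast; ring
      rw [norm_mul, this, Complex.norm_natCast, Complex.norm_real, Real.norm_of_nonneg hs'.le]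
      exact mul_le_mul_of_nonneg_left (by linarith) (by positivity)
  rw [norm_mul, Complex.norm_real, Real.norm_of_nonneg (Real.rpow_nonneg hs'.le _)] at b4
  rw [Real.rpow_neg hs'.le, ← div_eq_mul_inv, le_div_iff₀ (Real.rpow_pos_of_pos hs' _), mul_comm]
  exact b4

end radial

/-! ### Geometry of the Poincaré ball -/

/-- The conformal factor `1 - |x|²`, so that the metric is `(2 / lam x)² |dx|²`. -/
def lam {n : ℕ} (x : E n) : ℝ := 1 - ‖x‖ ^ 2

/-- The hyperbolic cosine `1 + 2 |x - y|² / ((1 - |x|²) (1 - |y|²))` of the geodesic distance. -/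
def hCosh {n : ℕ} (x y : E n) : ℝ := 1 + 2 * ‖y - x‖ ^ 2 / (lam x * lam y)

section geometry

variable {n : ℕ} {x y : E n}

theorem norm_lt_one (hy : y ∈ hBall n) : ‖y‖ < 1 := by simpa using hy

theorem lam_pos (hy : y ∈ hBall n) : 0 < lam y := by
  have := norm_lt_one hy
  have h0 := norm_nonneg y
  unfold lam
  nlinarith

theorem lam_le_one (y : E n) : lam y ≤ 1 := by
  unfold lam
  nlinarith [norm_nonneg y]

theorem continuous_lam : Continuous (lam : E n → ℝ) := by
  unfold lam
  fun_prop

theorem contDiff_lam {k : WithTop ℕ∞} : ContDiff ℝ k (lam : E n → ℝ) := by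
  unfold lam
  exact contDiff_const.sub (contDiff_norm_sq ℝ)

theorem one_le_hCosh (hx : x ∈ hBall n) (hy : y ∈ hBall n) : 1 ≤ hCosh x y := by
  have h1 := lam_pos hx
  have h2 := lam_pos hy
  unfold hCosh
  have : 0 ≤ 2 * ‖y - x‖ ^ 2 / (lam x * lam y) := by positivity
  linarith

theorem one_lt_hCosh (hx : x ∈ hBall n) (hy : y ∈ hBall n) (hxy : y ≠ x) : 1 < hCosh x y := by
  have h1 := lam_pos hx
  have h2 := lam_pos hy
  have h3 : 0 < ‖y - x‖ := norm_pos_iff.2 (sub_ne_zero.2 hxy)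
  unfold hCosh
  have : 0 < 2 * ‖y - x‖ ^ 2 / (lam x * lam y) := by positivity
  linarith

theorem exp_hRadius (hy : ‖y‖ < 1) : Real.exp (hRadius y) = (1 + ‖y‖) / (1 - ‖y‖) := by
  unfold hRadius
  exact Real.exp_log (div_pos (by linarith [norm_nonneg y]) (by linarith))

theorem cosh_hRadius (hy : ‖y‖ < 1) : Real.cosh (hRadius y) = (1 + ‖y‖ ^ 2) / (1 - ‖y‖ ^ 2) := by
  have h0 := norm_nonneg y
  have h1 : 1 - ‖y‖ ≠ 0 := by linarith
  have h2 : 1 + ‖y‖ ≠ 0 := by linarith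
  rw [Real.cosh_eq, Real.exp_neg, exp_hRadius hy,
    show 1 - ‖y‖ ^ 2 = (1 - ‖y‖) * (1 + ‖y‖) by ring]
  field_simp
  ring

theorem sinh_hRadius (hy : ‖y‖ < 1) : Real.sinh (hRadius y) = 2 * ‖y‖ / (1 - ‖y‖ ^ 2) := by
  have h0 := norm_nonneg y
  have h1 : 1 - ‖y‖ ≠ 0 := by linarith
  have h2 : 1 + ‖y‖ ≠ 0 := by linarith
  rw [Real.sinh_eq, Real.exp_neg, exp_hRadius hy,
    show 1 - ‖y‖ ^ 2 = (1 - ‖y‖) * (1 + ‖y‖) by ring]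
  field_simp
  ring

theorem tanh_half_hRadius (hy : ‖y‖ < 1) : Real.tanh (hRadius y / 2) = ‖y‖ := by
  have h0 := norm_nonneg y
  have h1 : 1 - ‖y‖ ≠ 0 := by linarith
  have he : Real.exp (hRadius y / 2) * Real.exp (hRadius y / 2) = (1 + ‖y‖) / (1 - ‖y‖) := by
    rw [← Real.exp_add, add_halves, exp_hRadius hy]
  have hp := Real.exp_pos (hRadius y / 2)
  rw [Real.tanh_eq_sinh_div_cosh, Real.sinh_eq, Real.cosh_eq, Real.exp_neg]
  generalize Real.exp (hRadius y / 2) = e at *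
  have hne : e * e + 1 ≠ 0 := by positivity
  rw [eq_div_iff h1] at he
  field_simp
  linear_combination he

theorem mobius_denom_mul_lam (x y : E n) :
    (1 - 2 * inner ℝ x y + ‖x‖ ^ 2 * ‖y‖ ^ 2) = lam x * lam y + ‖y - x‖ ^ 2 := by
  rw [norm_sub_sq_real, real_inner_comm]
  unfold lam
  ring

theorem norm_mobius_sq (hx : x ∈ hBall n) (hy : y ∈ hBall n) :
    ‖mobius y x‖ ^ 2 = ‖y - x‖ ^ 2 / (lam x * lam y + ‖y - x‖ ^ 2) := by
  have hD : 0 < lam x * lam y + ‖y - x‖ ^ 2 := by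
    have := mul_pos (lam_pos hx) (lam_pos hy)
    positivity
  have hv : ‖‖x - y‖ ^ 2 • y - (1 - ‖y‖ ^ 2) • (x - y)‖ ^ 2
      = ‖x - y‖ ^ 2 * (lam x * lam y + ‖x - y‖ ^ 2) := by
    have hN : ‖x - y‖ ^ 2 = ‖x‖ ^ 2 - 2 * inner ℝ y x + ‖y‖ ^ 2 := by
      rw [norm_sub_sq_real, real_inner_comm]
    rw [norm_sub_sq_real (‖x - y‖ ^ 2 • y), norm_smul, norm_smul, inner_smul_left,
      inner_smul_right, inner_sub_right, real_inner_self_eq_norm_sq, mul_pow, mul_pow]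
    simp only [Real.norm_eq_abs, sq_abs, conj_trivial]
    rw [hN]
    unfold lam
    ring
  unfold mobius
  rw [mobius_denom_mul_lam, norm_smul, mul_pow, hv, norm_sub_rev y x, norm_inv,
    Real.norm_eq_abs, inv_pow, sq_abs]
  rw [norm_sub_rev y x] at hD
  field_simp

theorem norm_mobius_lt_one (hx : x ∈ hBall n) (hy : y ∈ hBall n) : ‖mobius y x‖ < 1 := by
  have h := mul_pos (lam_pos hx) (lam_pos hy)
  have h1 : ‖mobius y x‖ ^ 2 < 1 := by
    rw [norm_mobius_sq hx hy, div_lt_one (by positivity)]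
    linarith
  nlinarith [norm_nonneg (mobius y x)]

theorem cosh_hDist (hx : x ∈ hBall n) (hy : y ∈ hBall n) :
    Real.cosh (hDist x y) = hCosh x y := by
  have h1 := lam_pos hx
  have h2 := lam_pos hy
  have h := mul_pos h1 h2
  have hD : 0 < lam x * lam y + ‖y - x‖ ^ 2 := by positivity
  unfold hDist hCosh
  rw [cosh_hRadius (norm_mobius_lt_one hx hy), norm_mobius_sq hx hy]
  have e : 1 - ‖y - x‖ ^ 2 / (lam x * lam y + ‖y - x‖ ^ 2)
      = (lam x * lam y) / (lam x * lam y + ‖y - x‖ ^ 2) := by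
    field_simp
    ring
  rw [e]
  field_simp
  ring

theorem hDist_pos (hx : x ∈ hBall n) (hy : y ∈ hBall n) (hxy : y ≠ x) : 0 < hDist x y := by
  have h := mul_pos (lam_pos hx) (lam_pos hy)
  have h3 : 0 < ‖y - x‖ := norm_pos_iff.2 (sub_ne_zero.2 hxy)
  have h4 : 0 < ‖mobius y x‖ := by
    have : 0 < ‖mobius y x‖ ^ 2 := by
      rw [norm_mobius_sq hx hy]
      positivity
    exact (norm_nonneg _).lt_of_ne fun h => by simp [← h] at this
  have h5 := norm_mobius_lt_one hx hy
  unfold hDist hRadius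
  refine Real.log_pos ?_
  rw [lt_div_iff₀ (by linarith)]
  linarith

theorem green_hDist (hn : 2 ≤ n) (z : ℂ) (hx : x ∈ hBall n) (hy : y ∈ hBall n) (hxy : y ≠ x) :
    green n z (hDist x y) = greenFun n z (hCosh x y) := by
  have hc := one_lt_hCosh hx hy hxy
  have hs := Real.sinh_pos_iff.2 (hDist_pos hx hy hxy)
  have hcosh := cosh_hDist hx hy
  have hsq : Real.sinh (hDist x y) ^ 2 = hCosh x y ^ 2 - 1 := by
    rw [Real.sinh_sq, hcosh]
  unfold green greenFun legendreInt
  rw [hcosh]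
  generalize hDist x y = ρ at *
  generalize hCosh x y = c at *
  have e1 : ((Real.sinh ρ : ℝ) : ℂ) ^ (n - 2) = (((c ^ 2 - 1) ^ (((n : ℝ) - 2) / 2) : ℝ) : ℂ) := by
    rw [← hsq, ← Real.rpow_natCast (Real.sinh ρ) 2, ← Real.rpow_mul hs.le,
      show ((2 : ℕ) : ℝ) * (((n : ℝ) - 2) / 2) = ((n - 2 : ℕ) : ℝ) by push_cast [hn]; ring,
      Real.rpow_natCast]
    push_cast
    rfl
  have e2 : (c : ℂ) ^ (((n : ℂ) - 3) / 2 - z) * (∫ t in (0 : ℝ)..π,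
      ((1 + Real.cos t / c : ℝ) : ℂ) ^ (((n : ℂ) - 3) / 2 - z) * ((Real.sin t : ℝ) : ℂ) ^ (2 * z))
      = ∫ t in (0 : ℝ)..π, legendreKernel (((n : ℂ) - 3) / 2 - z) z c t := by
    rw [← intervalIntegral.integral_const_mul]
    refine intervalIntegral.integral_congr fun t _ => ?_
    unfold legendreKernel
    have h0 : 0 < c := by linarith
    have hX := add_cos_pos hc t
    have e3 : 1 + Real.cos t / c = (c + Real.cos t) / c := by field_simp
    rw [← mul_assoc, ← Complex.mul_cpow_ofReal_nonneg h0.le (by rw [e3]; positivity),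
      ← Complex.ofReal_mul, e3, mul_div_cancel₀ _ h0.ne']
  rw [e1, ← e2, Real.rpow_neg (sq_sub_one_pos hc).le, Complex.ofReal_inv]
  ring

theorem hasFDerivAt_norm_sub_sq (x y : E n) :
    HasFDerivAt (fun w : E n => ‖w - x‖ ^ 2) (2 • innerSL ℝ (y - x)) y := by
  have := ((hasFDerivAt_id y).sub_const x).norm_sq
  simpa using this

theorem hasFDerivAt_lam (y : E n) : HasFDerivAt lam (-(2 • innerSL ℝ y)) y := by
  have := (hasFDerivAt_norm_sub_sq 0 y).const_sub 1
  simp only [sub_zero] at this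
  exact this

/-- The differential of `hCosh x` at `w`. -/
def hCoshDeriv (x w : E n) : E n →L[ℝ] ℝ :=
  (4 / (lam x * lam w)) • innerSL ℝ (w - x)
    + (4 * ‖w - x‖ ^ 2 / (lam x * lam w ^ 2)) • innerSL ℝ w

theorem hCoshDeriv_apply (x w v : E n) :
    hCoshDeriv x w v = 4 / (lam x * lam w) * inner ℝ (w - x) v
      + 4 * ‖w - x‖ ^ 2 / (lam x * lam w ^ 2) * inner ℝ w v := by
  simp only [hCoshDeriv, _root_.add_apply, _root_.smul_apply,
    innerSL_apply_apply, smul_eq_mul]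

theorem hasFDerivAt_hCosh (hx : x ∈ hBall n) (hy : y ∈ hBall n) :
    HasFDerivAt (hCosh x) (hCoshDeriv x y) y := by
  have h1 := (lam_pos hx).ne'
  have h2 := (lam_pos hy).ne'
  have h := (((hasFDerivAt_norm_sub_sq x y).const_mul 2).mul
    ((hasDerivAt_inv (mul_ne_zero h1 h2)).comp_hasFDerivAt y
      ((hasFDerivAt_lam y).const_mul (lam x)))).const_add 1
  refine (h.congr_fderiv ?_).congr_of_eventuallyEq (Eventually.of_forall fun w => ?_)
  · ext v
    simp only [hCoshDeriv_apply, _root_.add_apply, _root_.smul_apply,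
      _root_.neg_apply, innerSL_apply_apply, smul_eq_mul, nsmul_eq_mul,
      Function.comp_apply]
    field_simp
    push_cast
    ring
  · simp [hCosh, div_eq_mul_inv]

theorem contDiffOn_hCosh (hx : x ∈ hBall n) {k : WithTop ℕ∞} :
    ContDiffOn ℝ k (hCosh x) (hBall n) := by
  unfold hCosh
  refine contDiffOn_const.add (ContDiffOn.div ?_ ?_ fun y hy => ?_)
  · exact (contDiff_const.mul ((contDiff_id.sub contDiff_const).norm_sq ℝ)).contDiffOn
  · exact (contDiff_const.mul contDiff_lam).contDiffOn
  · exact (mul_pos (lam_pos hx) (lam_pos hy)).ne'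

theorem laplacian_eq_sum_of_hasDerivAt {F : E n → ℂ} (hF : ContDiffAt ℝ 2 F y)
    {G : E n → E n → ℂ} (hG : ∀ᶠ w in 𝓝 y, ∀ v, fderiv ℝ F w v = G w v) {d : Fin n → ℂ}
    (hd : ∀ i, HasDerivAt (fun t : ℝ => G (y + t • EuclideanSpace.basisFun (Fin n) ℝ i)
      (EuclideanSpace.basisFun (Fin n) ℝ i)) (d i) 0) :
    Laplacian.laplacian F y = ∑ i, d i := by
  rw [InnerProductSpace.laplacian_eq_iteratedFDeriv_orthonormalBasis F
    (EuclideanSpace.basisFun (Fin n) ℝ)]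
  refine Finset.sum_congr rfl fun i _ => ?_
  set e := EuclideanSpace.basisFun (Fin n) ℝ i
  rw [iteratedFDeriv_two_apply]
  simp only [Matrix.cons_val_zero, Matrix.cons_val_one]
  have hdiff : DifferentiableAt ℝ (fderiv ℝ F) y :=
    (hF.fderiv_right (m := 1) (by norm_num)).differentiableAt (by norm_num)
  have hline : HasDerivAt (fun t : ℝ => y + t • e) e 0 := by
    have := ((hasDerivAt_id (0 : ℝ)).smul_const e).const_add y
    simpa using this
  have h0 : y + (0 : ℝ) • e = y := by simp
  have h1 : HasDerivAt (fun t : ℝ => fderiv ℝ F (y + t • e) e) (fderiv ℝ (fderiv ℝ F) y e e) 0 := by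
    have h2 : HasFDerivAt (fderiv ℝ F) (fderiv ℝ (fderiv ℝ F) y) (y + (0 : ℝ) • e) := by
      rw [h0]
      exact hdiff.hasFDerivAt
    have h3 := h2.comp_hasDerivAt (0 : ℝ) hline
    exact ((ContinuousLinearMap.apply ℝ ℂ e).hasFDerivAt.comp_hasDerivAt (0 : ℝ) h3)
  refine h1.unique ((hd i).congr_of_eventuallyEq ?_)
  have ht : Tendsto (fun t : ℝ => y + t • e) (𝓝 0) (𝓝 y) := by
    have := hline.continuousAt.tendsto
    rwa [h0] at this
  filter_upwards [ht.eventually hG] with t ht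
  exact ht e

/-- For a function of the distance to `x` the Laplace-Beltrami operator is the ordinary
differential operator `(c² - 1) ∂² + n c ∂` in `c = cosh ρ`. -/
theorem hLaplacian_comp_hCosh (hx : x ∈ hBall n) (hy : y ∈ hBall n) {h h₁ : ℝ → ℂ} {h₂ : ℂ}
    (hh : ∀ᶠ s in 𝓝 (hCosh x y), HasDerivAt h (h₁ s) s) (hh₁ : HasDerivAt h₁ h₂ (hCosh x y))
    (hC : ContDiffAt ℝ 2 (fun w => h (hCosh x w)) y) :
    hLaplacian (fun w => h (hCosh x w)) y
      = ((hCosh x y : ℂ) ^ 2 - 1) * h₂ + n * hCosh x y * h₁ (hCosh x y) := by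
  have hlx := (lam_pos hx).ne'
  have hly := (lam_pos hy).ne'
  have hfd : ∀ᶠ w in 𝓝 y, ∀ v, fderiv ℝ (fun w => h (hCosh x w)) w v
      = (hCoshDeriv x w v : ℂ) * h₁ (hCosh x w) := by
    have hcont : ContinuousAt (hCosh x) y := (hasFDerivAt_hCosh hx hy).continuousAt
    filter_upwards [hcont.eventually hh, Metric.isOpen_ball.mem_nhds hy] with w hw hwb v
    have := hw.hasFDerivAt.comp w (hasFDerivAt_hCosh hx hwb)
    rw [show (fun w => h (hCosh x w)) = h ∘ hCosh x from rfl, this.fderiv]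
    simp
  set e := EuclideanSpace.basisFun (Fin n) ℝ with he
  set P : Fin n → ℝ := fun i => inner ℝ (y - x) (e i) with hP
  set Q : Fin n → ℝ := fun i => inner ℝ y (e i) with hQ
  set N := ‖y - x‖ ^ 2 with hN
  have hPP : ∑ i, P i * P i = N := by
    have := e.sum_inner_mul_inner (y - x) (y - x)
    rw [real_inner_self_eq_norm_sq] at this
    rw [hN, ← this]
    exact Finset.sum_congr rfl fun i _ => congrArg _ (real_inner_comm (e i) (y - x))
  have hQQ : ∑ i, Q i * Q i = ‖y‖ ^ 2 := by
    have := e.sum_inner_mul_inner y y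
    rw [real_inner_self_eq_norm_sq] at this
    rw [← this]
    exact Finset.sum_congr rfl fun i _ => congrArg _ (real_inner_comm (e i) y)
  have hPQ : ∑ i, P i * Q i = inner ℝ (y - x) y := by
    rw [← e.sum_inner_mul_inner (y - x) y]
    exact Finset.sum_congr rfl fun i _ => congrArg _ (real_inner_comm (e i) y)
  have hd : ∀ i, HasDerivAt (fun t : ℝ => (hCoshDeriv x (y + t • e i) (e i) : ℂ)
      * h₁ (hCosh x (y + t • e i)))
      (((4 / lam x * (4 * (P i * Q i) / lam y ^ 2 + 1 / lam y + 4 * N * (Q i * Q i) / lam y ^ 3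
        + N / lam y ^ 2) : ℝ) : ℂ) * h₁ (hCosh x y)
      + ((16 / lam x ^ 2 * (P i * P i / lam y ^ 2 + 2 * N * (P i * Q i) / lam y ^ 3
        + N ^ 2 * (Q i * Q i) / lam y ^ 4) : ℝ) : ℂ) * h₂) 0 := by
    intro i
    have h0 : y + (0 : ℝ) • e i = y := by simp
    have hline : HasDerivAt (fun t : ℝ => y + t • e i) (e i) 0 := by
      have := ((hasDerivAt_id (0 : ℝ)).smul_const (e i)).const_add y
      simpa using this
    have dlam : HasDerivAt (fun t : ℝ => lam (y + t • e i)) (-(2 * Q i)) 0 := by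
      have := (hasFDerivAt_lam (y + (0 : ℝ) • e i)).comp_hasDerivAt (0 : ℝ) hline
      refine HasDerivAt.congr_deriv this ?_
      simp [hQ]
    have dN : HasDerivAt (fun t : ℝ => ‖y + t • e i - x‖ ^ 2) (2 * P i) 0 := by
      have := (hasFDerivAt_norm_sub_sq x (y + (0 : ℝ) • e i)).comp_hasDerivAt (0 : ℝ) hline
      refine HasDerivAt.congr_deriv this ?_
      simp [hP, inner_sub_left]
    have dP : HasDerivAt (fun t : ℝ => inner ℝ (y + t • e i - x) (e i)) 1 0 := by
      have := (hline.sub_const x).inner ℝ (hasDerivAt_const (0 : ℝ) (e i))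
      simpa using this
    have dQ : HasDerivAt (fun t : ℝ => inner ℝ (y + t • e i) (e i)) 1 0 := by
      have := hline.inner ℝ (hasDerivAt_const (0 : ℝ) (e i))
      simpa using this
    have dc : HasDerivAt (fun t : ℝ => hCosh x (y + t • e i)) (hCoshDeriv x y (e i)) 0 := by
      have hfd := hasFDerivAt_hCosh hx hy
      rw [← h0] at hfd
      have := hfd.comp_hasDerivAt (0 : ℝ) hline
      simpa [h0, Function.comp_def] using this
    have dh : HasDerivAt (fun t : ℝ => h₁ (hCosh x (y + t • e i)))
        ((hCoshDeriv x y (e i) : ℂ) * h₂) 0 := by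
      rw [← h0] at hh₁
      have := hh₁.scomp (0 : ℝ) dc
      simpa [h0, Function.comp_def] using this
    have dα : HasDerivAt (fun t : ℝ => 4 / (lam x * lam (y + t • e i)))
        (4 / lam x * (2 * Q i / lam y ^ 2)) 0 := by
      have := (hasDerivAt_const (0 : ℝ) (4 : ℝ)).fun_div (dlam.const_mul (lam x))
        (by rw [h0]; exact mul_ne_zero hlx hly)
      refine this.congr_deriv ?_
      rw [h0]
      field_simp
      ring
    have dβ : HasDerivAt (fun t : ℝ => 4 * ‖y + t • e i - x‖ ^ 2 / (lam x * lam (y + t • e i) ^ 2))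
        (4 / lam x * (2 * P i / lam y ^ 2 + 4 * N * Q i / lam y ^ 3)) 0 := by
      have := (dN.const_mul 4).fun_div ((dlam.fun_pow 2).const_mul (lam x))
        (by rw [h0]; exact mul_ne_zero hlx (pow_ne_zero 2 hly))
      refine this.congr_deriv ?_
      rw [h0, ← hN]
      field_simp
      push_cast
      ring
    have dD : HasDerivAt (fun t : ℝ => hCoshDeriv x (y + t • e i) (e i))
        (4 / lam x * (4 * (P i * Q i) / lam y ^ 2 + 1 / lam y + 4 * N * (Q i * Q i) / lam y ^ 3
        + N / lam y ^ 2)) 0 := by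
      simp only [hCoshDeriv_apply]
      have := (dα.fun_mul dP).fun_add (dβ.fun_mul dQ)
      refine this.congr_deriv ?_
      rw [h0, ← hN]
      change 4 / lam x * (2 * Q i / lam y ^ 2) * P i + _ + (_ * Q i + _) = _
      field_simp
      ring
    have := dD.ofReal_comp.fun_mul dh
    refine this.congr_deriv ?_
    rw [h0, hCoshDeriv_apply]
    change _ + ((_ * P i + _ * Q i : ℝ) : ℂ) * (((_ * P i + _ * Q i : ℝ) : ℂ) * h₂) = _
    have key : (4 / (lam x * lam y) * P i + 4 * N / (lam x * lam y ^ 2) * Q i) *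
        (4 / (lam x * lam y) * P i + 4 * N / (lam x * lam y ^ 2) * Q i)
        = 16 / lam x ^ 2 * (P i * P i / lam y ^ 2 + 2 * N * (P i * Q i) / lam y ^ 3
          + N ^ 2 * (Q i * Q i) / lam y ^ 4) := by
      field_simp
      ring
    rw [← hN, ← key, Complex.ofReal_mul (_ + _)]
    ring
  have hlap := laplacian_eq_sum_of_hasDerivAt hC hfd hd
  have hsum : (∑ i, (4 / lam x * (4 * (P i * Q i) / lam y ^ 2 + 1 / lam y
      + 4 * N * (Q i * Q i) / lam y ^ 3 + N / lam y ^ 2)))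
      = 4 / lam x * (4 * inner ℝ (y - x) y / lam y ^ 2 + n / lam y
        + 4 * N * ‖y‖ ^ 2 / lam y ^ 3 + n * N / lam y ^ 2) := by
    rw [← hPQ, ← hQQ, ← Finset.mul_sum, Finset.sum_add_distrib, Finset.sum_add_distrib,
      Finset.sum_add_distrib, ← Finset.sum_div, ← Finset.sum_div, ← Finset.sum_div,
      ← Finset.mul_sum, ← Finset.mul_sum]
    simp only [Finset.sum_const, Finset.card_univ, Fintype.card_fin, nsmul_eq_mul, mul_one,
      mul_div_assoc]
  have hsum2 : (∑ i, (16 / lam x ^ 2 * (P i * P i / lam y ^ 2 + 2 * N * (P i * Q i) / lam y ^ 3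
        + N ^ 2 * (Q i * Q i) / lam y ^ 4)))
      = 16 / lam x ^ 2 * (N / lam y ^ 2 + 2 * N * inner ℝ (y - x) y / lam y ^ 3
        + N ^ 2 * ‖y‖ ^ 2 / lam y ^ 4) := by
    rw [← hPQ, ← hQQ, ← Finset.mul_sum, Finset.sum_add_distrib, Finset.sum_add_distrib,
      ← Finset.sum_div, ← Finset.sum_div, ← Finset.sum_div, ← Finset.mul_sum,
      ← Finset.mul_sum, hPP]
  rw [Finset.sum_add_distrib, ← Finset.sum_mul, ← Finset.sum_mul, ← Complex.ofReal_sum,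
    ← Complex.ofReal_sum, hsum, hsum2] at hlap
  unfold hLaplacian
  rw [hlap, hfd.self_of_nhds y, hCoshDeriv_apply]
  have k1 : lam y / 4 * (lam y * (16 / lam x ^ 2 * (N / lam y ^ 2
      + 2 * N * inner ℝ (y - x) y / lam y ^ 3 + N ^ 2 * ‖y‖ ^ 2 / lam y ^ 4)))
      = hCosh x y ^ 2 - 1 := by
    have r : lam x + N = lam y + 2 * inner ℝ (y - x) y := by
      rw [hN, norm_sub_sq_real, inner_sub_left, real_inner_self_eq_norm_sq, real_inner_comm x y]
      unfold lam
      ring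
    have r2 : ‖y‖ ^ 2 = 1 - lam y := by unfold lam; ring
    unfold hCosh
    rw [← hN, r2]
    generalize (inner ℝ (y - x) y : ℝ) = s at *
    field_simp
    linear_combination (-16 * N * lam y) * r
  have k2 : lam y / 4 * (lam y * (4 / lam x * (4 * inner ℝ (y - x) y / lam y ^ 2 + n / lam y
        + 4 * N * ‖y‖ ^ 2 / lam y ^ 3 + n * N / lam y ^ 2))
      + 2 * (n - 2) * (4 / (lam x * lam y) * inner ℝ (y - x) y
        + 4 * N / (lam x * lam y ^ 2) * ‖y‖ ^ 2)) = n * hCosh x y := by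
    have r : lam x + N = lam y + 2 * inner ℝ (y - x) y := by
      rw [hN, norm_sub_sq_real, inner_sub_left, real_inner_self_eq_norm_sq, real_inner_comm x y]
      unfold lam
      ring
    have r2 : ‖y‖ ^ 2 = 1 - lam y := by unfold lam; ring
    unfold hCosh
    rw [← hN, r2]
    generalize (inner ℝ (y - x) y : ℝ) = s at *
    field_simp
    linear_combination (-(n : ℝ) * lam y) * r
  have k1' := congrArg (fun r : ℝ => (r : ℂ)) k1
  have k2' := congrArg (fun r : ℝ => (r : ℂ)) k2
  rw [real_inner_self_eq_norm_sq, ← hN]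
  change ((lam y / 4 : ℝ) : ℂ) * ((lam y : ℂ) * _ + _) = _
  push_cast at k1' k2' ⊢
  linear_combination h₂ * k1' + h₁ (hCosh x y) * k2'

/-- In Euclidean terms `sinh ρ ∂/∂ρ` is the Euler operator `∑ᵢ yᵢ ∂ᵢ`. -/
theorem radialDeriv_mul_sinh {u : E n → ℂ} (hy : y ∈ hBall n) (hy0 : y ≠ 0)
    (hu : DifferentiableAt ℝ u y) :
    radialDeriv u y * ((Real.sinh (hRadius y) : ℝ) : ℂ) = fderiv ℝ u y y := by
  have hn0 : ‖y‖ ≠ 0 := norm_ne_zero_iff.2 hy0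
  have h1 := norm_lt_one hy
  have hl := (lam_pos hy).ne'
  have hpt : Real.tanh (hRadius y / 2) • (‖y‖⁻¹ • y) = y := by
    rw [tanh_half_hRadius h1, smul_smul, mul_inv_cancel₀ hn0, one_smul]
  have ht : HasDerivAt (fun s : ℝ => Real.tanh (s / 2)) ((1 - ‖y‖ ^ 2) / 2) (hRadius y) := by
    have h2 : HasDerivAt (fun s : ℝ => s / 2) (1 / 2) (hRadius y) :=
      (hasDerivAt_id (hRadius y)).div_const 2
    have hd := h2.sinh.fun_div h2.cosh (Real.cosh_pos _).ne'
    refine (hd.congr_deriv ?_).congr_of_eventuallyEq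
      (Eventually.of_forall fun s => Real.tanh_eq_sinh_div_cosh _)
    rw [← tanh_half_hRadius h1, Real.tanh_eq_sinh_div_cosh]
    have := (Real.cosh_pos (hRadius y / 2)).ne'
    field_simp
  have hc : HasDerivAt (fun s : ℝ => u (Real.tanh (s / 2) • (‖y‖⁻¹ • y)))
      (fderiv ℝ u y (((1 - ‖y‖ ^ 2) / 2) • (‖y‖⁻¹ • y))) (hRadius y) := by
    have hu' : HasFDerivAt u (fderiv ℝ u y) (Real.tanh (hRadius y / 2) • (‖y‖⁻¹ • y)) := by
      rw [hpt]
      exact hu.hasFDerivAt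
    exact hu'.comp_hasDerivAt (hRadius y) (ht.smul_const (‖y‖⁻¹ • y))
  unfold radialDeriv
  rw [hc.deriv, sinh_hRadius h1, smul_smul, map_smul, Complex.real_smul, mul_right_comm,
    ← Complex.ofReal_mul]
  have : (1 - ‖y‖ ^ 2) / 2 * ‖y‖⁻¹ * (2 * ‖y‖ / (1 - ‖y‖ ^ 2)) = 1 := by
    have : 1 - ‖y‖ ^ 2 ≠ 0 := hl
    field_simp
  rw [this, Complex.ofReal_one, one_mul]

end geometry

/-! ### Hyperbolic volume, radial cutoffs and Green's identity -/

section volume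

variable {n : ℕ} {G : Type*} [NormedAddCommGroup G] [NormedSpace ℝ G]

theorem measurable_hDensity :
    Measurable fun x : E n => ENNReal.ofReal ((2 / (1 - ‖x‖ ^ 2)) ^ n) := by fun_prop

theorem toReal_hDensity {y : E n} (hy : y ∈ hBall n) :
    (ENNReal.ofReal ((2 / (1 - ‖y‖ ^ 2)) ^ n)).toReal = (2 / lam y) ^ n := by
  have h : 0 < 1 - ‖y‖ ^ 2 := lam_pos hy
  exact ENNReal.toReal_ofReal (by positivity)

theorem integrable_hVol_iff {F : E n → G} :
    Integrable F (hVol n) ↔ IntegrableOn (fun y => ((2 / lam y) ^ n : ℝ) • F y) (hBall n) := by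
  unfold hVol
  rw [integrable_withDensity_iff_integrable_smul' measurable_hDensity
    (ae_of_all _ fun _ => ENNReal.ofReal_lt_top)]
  refine integrable_congr ((ae_restrict_iff' measurableSet_ball).2 (ae_of_all _ fun y hy => ?_))
  simp only
  rw [toReal_hDensity hy]

theorem integral_hVol (F : E n → G) :
    ∫ y, F y ∂(hVol n) = ∫ y in hBall n, ((2 / lam y) ^ n : ℝ) • F y := by
  unfold hVol
  rw [integral_withDensity_eq_integral_toReal_smul measurable_hDensity
    (ae_of_all _ fun _ => ENNReal.ofReal_lt_top)]
  refine setIntegral_congr_fun measurableSet_ball fun y hy => ?_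
  rw [toReal_hDensity hy]

theorem ae_hVol_mem_hBall : ∀ᵐ y ∂(hVol n), y ∈ hBall n := by
  have h : hVol n ≪ volume.restrict (hBall n) := withDensity_absolutelyContinuous _ _
  exact h (ae_restrict_mem measurableSet_ball)

theorem ae_hVol_ne (hn : 2 ≤ n) (x : E n) : ∀ᵐ y ∂(hVol n), y ≠ x := by
  have : Nonempty (Fin n) := ⟨⟨0, by omega⟩⟩
  have h : hVol n ≪ volume.restrict (hBall n) := withDensity_absolutelyContinuous _ _
  refine h (ae_restrict_of_ae ?_)
  have : (volume : Measure (E n)) {x} = 0 := measure_singleton x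
  rw [ae_iff]
  simp [this]

theorem continuousOn_hDensity : ContinuousOn (fun y : E n => ((2 / lam y) ^ n : ℝ)) (hBall n) :=
  (continuousOn_const.div continuous_lam.continuousOn fun _ hy => (lam_pos hy).ne').pow n

theorem integrable_hVol_of_isCompact {K : Set (E n)} (hK : IsCompact K) (hKb : K ⊆ hBall n)
    {F : E n → G} (hF : ContinuousOn F (hBall n)) (h0 : ∀ y ∈ hBall n, y ∉ K → F y = 0) :
    Integrable F (hVol n) := by
  rw [integrable_hVol_iff]
  have h1 : IntegrableOn (fun y => ((2 / lam y) ^ n : ℝ) • F y) K :=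
    ((continuousOn_hDensity.smul hF).mono hKb).integrableOn_compact hK
  refine h1.of_forall_sdiff_eq_zero measurableSet_ball fun y hy => ?_
  rw [h0 y hy.1 hy.2, smul_zero]

end volume

section cutoff

variable {n : ℕ} {R : ℝ} {y : E n}

/-- A smooth radial cutoff: it is `1` where `1 - |y|² ≥ 2 / R` and `0` where
`1 - |y|² ≤ 1 / R`, in particular outside the unit ball. -/
def cutoff (R : ℝ) (y : E n) : ℝ := Real.smoothTransition (R * lam y - 1)

/-- The weight `-(1 - |y|²)² / 4` times the radial factor of the gradient of `cutoff R`: the density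
with which the boundary terms of Green's identity are averaged over the shell
`1 / R ≤ 1 - |y|² ≤ 2 / R`. -/
def shellWeight (R : ℝ) (y : E n) : ℝ :=
  R * lam y ^ 2 / 2 * deriv Real.smoothTransition (R * lam y - 1)

/-- The ball `1 - |y|² ≥ 1 / R`, which carries `cutoff R`. -/
def cutoffSupport (n : ℕ) (R : ℝ) : Set (E n) := {y | 1 ≤ R * lam y}

theorem deriv_smoothTransition_of_nonpos {t : ℝ} (ht : t ≤ 0) :
    deriv Real.smoothTransition t = 0 := by
  refine IsLocalMin.deriv_eq_zero (Eventually.of_forall fun s => ?_)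
  rw [Real.smoothTransition.zero_of_nonpos ht]
  exact Real.smoothTransition.nonneg s

theorem deriv_smoothTransition_of_one_le {t : ℝ} (ht : 1 ≤ t) :
    deriv Real.smoothTransition t = 0 := by
  refine IsLocalMax.deriv_eq_zero (Eventually.of_forall fun s => ?_)
  rw [Real.smoothTransition.one_of_one_le ht]
  exact Real.smoothTransition.le_one s

theorem contDiff_smoothTransition_one : ContDiff ℝ 1 Real.smoothTransition :=
  Real.smoothTransition.contDiff (n := 1)

theorem continuous_deriv_smoothTransition : Continuous (deriv Real.smoothTransition) :=
  contDiff_smoothTransition_one.continuous_deriv le_rfl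

theorem exists_deriv_smoothTransition_le :
    ∃ M, 0 ≤ M ∧ ∀ t, deriv Real.smoothTransition t ≤ M := by
  obtain ⟨M, hM⟩ := isCompact_Icc.exists_bound_of_continuousOn (s := Icc (0 : ℝ) 1)
    continuous_deriv_smoothTransition.continuousOn
  refine ⟨max M 0, le_max_right _ _, fun t => ?_⟩
  rcases le_or_gt t 0 with h | h
  · rw [deriv_smoothTransition_of_nonpos h]
    exact le_max_right _ _
  rcases le_or_gt 1 t with h1 | h1
  · rw [deriv_smoothTransition_of_one_le h1]
    exact le_max_right _ _
  · exact ((le_abs_self _).trans (hM t ⟨h.le, h1.le⟩)).trans (le_max_left _ _)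

theorem shellWeight_nonneg (hR : 0 < R) (y : E n) : 0 ≤ shellWeight R y :=
  mul_nonneg (by positivity) Real.smoothTransition.monotone.deriv_nonneg

theorem shellWeight_eq_zero (h : R * lam y ≤ 1 ∨ 2 ≤ R * lam y) : shellWeight R y = 0 := by
  unfold shellWeight
  rcases h with h | h
  · rw [deriv_smoothTransition_of_nonpos (by linarith), mul_zero]
  · rw [deriv_smoothTransition_of_one_le (by linarith), mul_zero]

theorem continuous_shellWeight : Continuous (shellWeight R : E n → ℝ) := by
  have := continuous_lam (n := n)
  have h2 := continuous_deriv_smoothTransition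
  unfold shellWeight
  fun_prop

theorem contDiff_cutoff : ContDiff ℝ 1 (cutoff R : E n → ℝ) := by
  unfold cutoff
  exact contDiff_smoothTransition_one.comp ((contDiff_const.mul contDiff_lam).sub contDiff_const)

theorem cutoff_eq_one (h : 2 ≤ R * lam y) : cutoff R y = 1 :=
  Real.smoothTransition.one_of_one_le (by linarith)

theorem cutoff_eq_zero (h : R * lam y ≤ 1) : cutoff R y = 0 :=
  Real.smoothTransition.zero_of_nonpos (by linarith)

theorem abs_cutoff_le_one (y : E n) : |cutoff R y| ≤ 1 := by
  unfold cutoff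
  rw [abs_of_nonneg (Real.smoothTransition.nonneg _)]
  exact Real.smoothTransition.le_one _

theorem cutoffSupport_subset (hR : 0 < R) : cutoffSupport n R ⊆ hBall n := by
  intro y hy
  have hy : 1 ≤ R * lam y := hy
  have h : 0 < lam y := by
    by_contra h
    have := mul_nonpos_of_nonneg_of_nonpos hR.le (not_lt.1 h)
    linarith
  unfold lam at h
  rw [mem_ball_zero_iff]
  nlinarith [norm_nonneg y]

theorem isClosed_cutoffSupport : IsClosed (cutoffSupport n R) :=
  isClosed_le continuous_const (continuous_const.mul continuous_lam)

theorem isCompact_cutoffSupport (hR : 0 < R) : IsCompact (cutoffSupport n R) :=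
  Metric.isCompact_of_isClosed_isBounded isClosed_cutoffSupport
    (Metric.isBounded_ball.subset (cutoffSupport_subset hR))

theorem hasFDerivAt_cutoff (y : E n) :
    HasFDerivAt (cutoff R) ((-(2 * R) * deriv Real.smoothTransition (R * lam y - 1)) •
      innerSL ℝ y) y := by
  have h1 := (contDiff_smoothTransition_one.differentiable one_ne_zero (R * lam y - 1)).hasDerivAt
  have h2 := h1.comp_hasFDerivAt y (((hasFDerivAt_lam y).const_mul R).sub_const 1)
  refine HasFDerivAt.congr_fderiv h2 ?_
  ext v
  simp
  ring

theorem continuousOn_fderiv_apply_self {u : E n → ℂ} (hu : ContDiffOn ℝ 2 u (hBall n)) :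
    ContinuousOn (fun y => fderiv ℝ u y y) (hBall n) :=
  (hu.continuousOn_fderiv_of_isOpen Metric.isOpen_ball (by norm_num)).clm_apply continuousOn_id

theorem contDiffAt_of_mem_hBall {k : WithTop ℕ∞} {u : E n → ℂ} (hu : ContDiffOn ℝ k u (hBall n))
    (hy : y ∈ hBall n) : ContDiffAt ℝ k u y := hu.contDiffAt (Metric.isOpen_ball.mem_nhds hy)

theorem contDiffOn_fderiv_apply {u : E n → ℂ} (hu : ContDiffOn ℝ 2 u (hBall n)) (v : E n) :
    ContDiffOn ℝ 1 (fun y => fderiv ℝ u y v) (hBall n) :=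
  (hu.fderiv_of_isOpen Metric.isOpen_ball (by norm_num)).clm_apply contDiffOn_const

theorem laplacian_eq_sum (u : E n → ℂ) (hu : ContDiffOn ℝ 2 u (hBall n)) (hy : y ∈ hBall n) :
    Laplacian.laplacian u y = ∑ i, fderiv ℝ (fun w => fderiv ℝ u w
      (EuclideanSpace.basisFun (Fin n) ℝ i)) y (EuclideanSpace.basisFun (Fin n) ℝ i) := by
  rw [InnerProductSpace.laplacian_eq_iteratedFDeriv_orthonormalBasis u
    (EuclideanSpace.basisFun (Fin n) ℝ)]
  refine Finset.sum_congr rfl fun i _ => ?_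
  rw [iteratedFDeriv_two_apply]
  have hd : DifferentiableAt ℝ (fderiv ℝ u) y :=
    ((contDiffAt_of_mem_hBall hu hy).fderiv_right (m := 1) (by norm_num)).differentiableAt
      (by norm_num)
  have := (hd.hasFDerivAt.clm_apply (hasFDerivAt_const
    (EuclideanSpace.basisFun (Fin n) ℝ i) y)).fderiv
  rw [this]
  simp

theorem continuousOn_laplacian {u : E n → ℂ} (hu : ContDiffOn ℝ 2 u (hBall n)) :
    ContinuousOn (fun y => Laplacian.laplacian u y) (hBall n) := by
  refine ContinuousOn.congr ?_ fun y hy => laplacian_eq_sum u hu hy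
  refine continuousOn_finsetSum _ fun i _ => ?_
  exact ((contDiffOn_fderiv_apply hu _).continuousOn_fderiv_of_isOpen Metric.isOpen_ball
    le_rfl).clm_apply continuousOn_const

theorem continuousOn_hLaplacian {u : E n → ℂ} (hu : ContDiffOn ℝ 2 u (hBall n)) :
    ContinuousOn (hLaplacian u) (hBall n) := by
  have h1 := continuousOn_laplacian hu
  have h2 := continuousOn_fderiv_apply_self hu
  have h3 : Continuous fun y : E n => ((1 - ‖y‖ ^ 2 : ℝ) : ℂ) := by fun_prop
  have h4 : Continuous fun y : E n => (((1 - ‖y‖ ^ 2) / 4 : ℝ) : ℂ) := by fun_prop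
  unfold hLaplacian
  exact h4.continuousOn.mul ((h3.continuousOn.mul h1).add (continuousOn_const.mul h2))

theorem integral_fderiv_apply_eq_zero {F : E n → ℂ} (hF : ContDiff ℝ 1 F)
    (hc : HasCompactSupport F) (v : E n) : ∫ y, fderiv ℝ F y v = 0 := by
  have h1 : Continuous fun y => fderiv ℝ F y v :=
    (hF.continuous_fderiv one_ne_zero).clm_apply continuous_const
  have h2 : HasCompactSupport fun y => fderiv ℝ F y v := hc.fderiv_apply (𝕜 := ℝ) v
  have := integral_mul_fderiv_eq_neg_fderiv_mul_of_integrable (μ := (volume : Measure (E n)))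
    (f := fun _ => (1 : ℂ)) (g := F) (v := v) (by simp)
    (by simpa using h1.integrable_of_hasCompactSupport h2)
    (by simpa using hF.continuous.integrable_of_hasCompactSupport hc)
    (fun _ _ => by fun_prop) (fun y _ => hF.differentiable one_ne_zero y)
  simpa using this

/-- Green's second identity with a cutoff, with the boundary term averaged over a shell. In
Euclidean terms `(2/λ)^n Δ_ℍ = div ((2/λ)^(n-2) ∇)` with `λ = 1 - |y|²`, and the integrand is the
divergence of a compactly supported field. -/
theorem green_identity (hn : 2 ≤ n) (hR : 0 < R) {g u : E n → ℂ} (hg : ContDiffOn ℝ 2 g (hBall n))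
    (hu : ContDiffOn ℝ 2 u (hBall n)) :
    ∫ y, (cutoff R y : ℂ) * (g y * hLaplacian u y - u y * hLaplacian g y) ∂(hVol n)
      = ∫ y, (shellWeight R y : ℂ) * (g y * fderiv ℝ u y y - u y * fderiv ℝ g y y) ∂(hVol n) := by
  obtain ⟨m, rfl⟩ : ∃ m, n = m + 2 := ⟨n - 2, by omega⟩
  set e := EuclideanSpace.basisFun (Fin (m + 2)) ℝ with he
  set K := cutoffSupport (m + 2) R with hKdef
  have hK := isCompact_cutoffSupport (n := m + 2) hR
  have hKb : K ⊆ hBall (m + 2) := cutoffSupport_subset hR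
  have hKc : ∀ y : E (m + 2), y ∉ K → R * lam y ≤ 1 := fun y hy => (not_le.1 hy).le
  have hcutc : Continuous fun y : E (m + 2) => (cutoff R y : ℂ) :=
    Complex.continuous_ofReal.comp contDiff_cutoff.continuous
  have hwc : Continuous fun y : E (m + 2) => (shellWeight R y : ℂ) :=
    Complex.continuous_ofReal.comp continuous_shellWeight
  have hi1 : Integrable (fun y => (cutoff R y : ℂ) *
      (g y * hLaplacian u y - u y * hLaplacian g y)) (hVol (m + 2)) := by
    refine integrable_hVol_of_isCompact hK hKb (hcutc.continuousOn.mul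
      ((hg.continuousOn.mul (continuousOn_hLaplacian hu)).sub
        (hu.continuousOn.mul (continuousOn_hLaplacian hg)))) fun y _ hy => ?_
    rw [cutoff_eq_zero (hKc y hy)]
    simp
  have hi2 : Integrable (fun y => (shellWeight R y : ℂ) *
      (g y * fderiv ℝ u y y - u y * fderiv ℝ g y y)) (hVol (m + 2)) := by
    refine integrable_hVol_of_isCompact hK hKb (hwc.continuousOn.mul
      ((hg.continuousOn.mul (continuousOn_fderiv_apply_self hu)).sub
        (hu.continuousOn.mul (continuousOn_fderiv_apply_self hg)))) fun y _ hy => ?_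
    rw [shellWeight_eq_zero (Or.inl (hKc y hy))]
    simp
  rw [← sub_eq_zero, ← integral_sub hi1 hi2, integral_hVol]
  -- the components of the compactly supported field
  set F : Fin (m + 2) → E (m + 2) → ℂ := fun i y => ((cutoff R y : ℝ) : ℂ) *
    (((2 / lam y) ^ m : ℝ) : ℂ) * (g y * fderiv ℝ u y (e i) - u y * fderiv ℝ g y (e i)) with hF
  have hF0 : ∀ i y, y ∉ K → F i y = 0 := fun i y hy => by
    simp only [hF]
    rw [cutoff_eq_zero (hKc y hy)]
    simp
  have hFC : ∀ i, ContDiff ℝ 1 (F i) := by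
    intro i
    rw [contDiff_iff_contDiffAt]
    intro y
    by_cases hy : y ∈ hBall (m + 2)
    · have h1 : ContDiffAt ℝ 1 (fun y : E (m + 2) => ((cutoff R y : ℝ) : ℂ)) y :=
        Complex.ofRealCLM.contDiff.contDiffAt.comp y contDiff_cutoff.contDiffAt
      have h2 : ContDiffAt ℝ 1 (fun y : E (m + 2) => (((2 / lam y) ^ m : ℝ) : ℂ)) y :=
        Complex.ofRealCLM.contDiff.contDiffAt.comp y
          ((contDiffAt_const.div contDiff_lam.contDiffAt (lam_pos hy).ne').pow m)
      have hg1 := (contDiffAt_of_mem_hBall hg hy).of_le (m := 1) (by norm_num)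
      have hu1 := (contDiffAt_of_mem_hBall hu hy).of_le (m := 1) (by norm_num)
      have hg2 := contDiffAt_of_mem_hBall (contDiffOn_fderiv_apply hg (e i)) hy
      have hu2 := contDiffAt_of_mem_hBall (contDiffOn_fderiv_apply hu (e i)) hy
      exact (h1.mul h2).mul ((hg1.mul hu2).sub (hu1.mul hg2))
    · have hyK : y ∈ Kᶜ := fun h => hy (hKb h)
      refine (contDiffAt_const (c := (0 : ℂ))).congr_of_eventuallyEq ?_
      filter_upwards [isClosed_cutoffSupport.isOpen_compl.mem_nhds hyK] with w hw
      exact hF0 i w hw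
  have hFs : ∀ i, HasCompactSupport (F i) := fun i =>
    HasCompactSupport.intro hK fun y hy => hF0 i y hy
  have hsum : ∫ y, ∑ i, fderiv ℝ (F i) y (e i) = 0 := by
    rw [integral_finsetSum]
    · exact Finset.sum_eq_zero fun i _ => integral_fderiv_apply_eq_zero (hFC i) (hFs i) (e i)
    · intro i _
      exact (((hFC i).continuous_fderiv one_ne_zero).clm_apply
        continuous_const).integrable_of_hasCompactSupport ((hFs i).fderiv_apply (𝕜 := ℝ) (e i))
  have hball : ∫ y in hBall (m + 2), ∑ i, fderiv ℝ (F i) y (e i) = 0 := by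
    rw [setIntegral_eq_integral_of_forall_compl_eq_zero, hsum]
    intro y hy
    refine Finset.sum_eq_zero fun i _ => ?_
    have hyK : y ∈ Kᶜ := fun h => hy (hKb h)
    have : F i =ᶠ[𝓝 y] fun _ => 0 := by
      filter_upwards [isClosed_cutoffSupport.isOpen_compl.mem_nhds hyK] with w hw
      exact hF0 i w hw
    rw [this.fderiv_eq]
    simp
  rw [← hball]
  refine setIntegral_congr_fun measurableSet_ball fun y hy => ?_
  have hl := (lam_pos hy).ne'
  have hgd := (contDiffAt_of_mem_hBall hg hy).differentiableAt (by norm_num)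
  have hud := (contDiffAt_of_mem_hBall hu hy).differentiableAt (by norm_num)
  set S' := deriv Real.smoothTransition (R * lam y - 1) with hS'
  -- the divergence of the field
  have hdiv : ∀ i, fderiv ℝ (F i) y (e i) =
      ((-(2 * R) * S' * (2 / lam y) ^ m + cutoff R y * ((2 / lam y) ^ m * (m * (2 / lam y))) : ℝ) : ℂ)
        * ((inner ℝ y (e i) : ℝ) * (g y * fderiv ℝ u y (e i) - u y * fderiv ℝ g y (e i)))
      + ((cutoff R y * (2 / lam y) ^ m : ℝ) : ℂ) *
        (g y * fderiv ℝ (fun w => fderiv ℝ u w (e i)) y (e i)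
          - u y * fderiv ℝ (fun w => fderiv ℝ g w (e i)) y (e i)) := by
    intro i
    have h0 : y + (0 : ℝ) • e i = y := by simp
    have hline : HasDerivAt (fun t : ℝ => y + t • e i) (e i) 0 := by
      have := ((hasDerivAt_id (0 : ℝ)).smul_const (e i)).const_add y
      simpa using this
    have comp : ∀ {G : Type} [NormedAddCommGroup G] [NormedSpace ℝ G] {f : E (m + 2) → G}
        {f' : E (m + 2) →L[ℝ] G}, HasFDerivAt f f' y →
        HasDerivAt (fun t : ℝ => f (y + t • e i)) (f' (e i)) 0 := by
      intro G _ _ f f' hf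
      rw [← h0] at hf
      exact hf.comp_hasDerivAt (0 : ℝ) hline
    have d1 := (comp (hasFDerivAt_cutoff (R := R) y)).ofReal_comp
    have d2 : HasDerivAt (fun t : ℝ => (((2 / lam (y + t • e i)) ^ m : ℝ) : ℂ))
        (((2 / lam y) ^ m * (m * (2 / lam y)) * inner ℝ y (e i) : ℝ) : ℂ) 0 := by
      have hlam := comp (hasFDerivAt_lam y)
      have := ((hasDerivAt_const (0 : ℝ) (2 : ℝ)).fun_div hlam (by rw [h0]; exact hl)).fun_pow m
      refine HasDerivAt.ofReal_comp (this.congr_deriv ?_)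
      rw [h0]
      rcases m with _ | k
      · simp
      · simp only [Nat.add_sub_cancel, pow_succ, _root_.neg_apply, _root_.smul_apply,
          innerSL_apply_apply, nsmul_eq_mul]
        field_simp
        push_cast
        ring
    have d3 := comp hgd.hasFDerivAt
    have d4 := comp hud.hasFDerivAt
    have d5 := comp ((contDiffAt_of_mem_hBall (contDiffOn_fderiv_apply hg (e i))
      hy).differentiableAt one_ne_zero).hasFDerivAt
    have d6 := comp ((contDiffAt_of_mem_hBall (contDiffOn_fderiv_apply hu (e i))
      hy).differentiableAt one_ne_zero).hasFDerivAt
    have d := (d1.fun_mul d2).fun_mul ((d3.fun_mul d6).fun_sub (d4.fun_mul d5))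
    have d' := comp ((hFC i).differentiable one_ne_zero y).hasFDerivAt
    rw [d'.unique d]
    simp only [h0, _root_.smul_apply, innerSL_apply_apply, smul_eq_mul]
    push_cast
    ring
  have hinner : ∀ f : E (m + 2) →L[ℝ] ℂ, ∑ i, ((inner ℝ y (e i) : ℝ) : ℂ) * f (e i) = f y := by
    intro f
    conv_rhs => rw [← e.sum_repr y, map_sum]
    refine Finset.sum_congr rfl fun i _ => ?_
    rw [map_smul, Complex.real_smul, e.repr_apply_apply, real_inner_comm]
  have hinner2 : ∑ i, ((inner ℝ y (e i) : ℝ) : ℂ) *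
      (g y * fderiv ℝ u y (e i) - u y * fderiv ℝ g y (e i))
      = g y * fderiv ℝ u y y - u y * fderiv ℝ g y y := by
    rw [← hinner (fderiv ℝ u y), ← hinner (fderiv ℝ g y), Finset.mul_sum, Finset.mul_sum,
      ← Finset.sum_sub_distrib]
    exact Finset.sum_congr rfl fun i _ => by ring
  rw [Finset.sum_congr rfl fun i _ => hdiv i, Finset.sum_add_distrib, ← Finset.mul_sum,
    ← Finset.mul_sum, hinner2, Finset.sum_sub_distrib, ← Finset.mul_sum, ← Finset.mul_sum,
    ← laplacian_eq_sum u hu hy, ← laplacian_eq_sum g hg hy]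
  unfold hLaplacian shellWeight
  rw [Complex.real_smul, ← hS']
  change (((2 / lam y) ^ (m + 2) : ℝ) : ℂ) * (_ * (_ * (((lam y / 4 : ℝ) : ℂ) *
    (((lam y : ℝ) : ℂ) * _ + _)) - _ * (((lam y / 4 : ℝ) : ℂ) * (((lam y : ℝ) : ℂ) * _ + _))) - _) = _
  have hlc : (lam y : ℂ) ≠ 0 := by exact_mod_cast hl
  push_cast
  rw [pow_add]
  field_simp
  ring

end cutoff

/-! ### Regularized Green functions -/

section concentration

variable {n : ℕ} {z : ℂ}

/-- The total mass of the profile to which the defect of the regularized Green function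
concentrates. -/
theorem integral_one_add_mul_norm_sq_rpow (hn : 2 ≤ n) {b : ℝ} (hb : 0 < b) :
    ∫ w : E n, (1 + b * ‖w‖ ^ 2) ^ (-((n : ℝ) / 2 + 1))
      = b ^ (-((n : ℝ) / 2)) * (volume (Metric.ball (0 : E n) 1)).toReal := by
  have : Nonempty (Fin n) := ⟨⟨0, by omega⟩⟩
  have hn0 : (0 : ℝ) < n := by
    have : 0 < n := by omega
    exact_mod_cast this
  have h1 := integral_fun_norm_addHaar (volume : Measure (E n))
    (fun r : ℝ => (1 + b * r ^ 2) ^ (-((n : ℝ) / 2 + 1)))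
  rw [finrank_euclideanSpace_fin] at h1
  have hpos : ∀ r : ℝ, 0 < 1 + b * r ^ 2 := fun r => by positivity
  have hder : ∀ r : ℝ, HasDerivAt (fun r : ℝ => r ^ n * (1 + b * r ^ 2) ^ (-((n : ℝ) / 2)) / n)
      (r ^ (n - 1) • (1 + b * r ^ 2) ^ (-((n : ℝ) / 2 + 1))) r := by
    intro r
    have d1 : HasDerivAt (fun r : ℝ => 1 + b * r ^ 2) (b * (2 * r)) r := by
      simpa using ((hasDerivAt_pow 2 r).const_mul b).const_add 1
    have d2 := d1.rpow_const (p := -((n : ℝ) / 2)) (Or.inl (hpos r).ne')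
    have d := ((hasDerivAt_pow n r).fun_mul d2).div_const (n : ℝ)
    refine d.congr_deriv ?_
    have e1 : (1 + b * r ^ 2) ^ (-((n : ℝ) / 2))
        = (1 + b * r ^ 2) * (1 + b * r ^ 2) ^ (-((n : ℝ) / 2 + 1)) := by
      rw [← Real.rpow_one_add' (hpos r).le (by linarith)]
      congr 1
      ring
    have e2 : r ^ n = r * r ^ (n - 1) := by
      rw [← pow_succ']
      congr 1
      omega
    rw [show -((n : ℝ) / 2) - 1 = -((n : ℝ) / 2 + 1) by ring, e1, e2, smul_eq_mul]
    field_simp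
    ring
  have hlim : Tendsto (fun r : ℝ => r ^ n * (1 + b * r ^ 2) ^ (-((n : ℝ) / 2)) / n) atTop
      (𝓝 (b ^ (-((n : ℝ) / 2)) / n)) := by
    refine Tendsto.div_const ?_ _
    have h2 : Tendsto (fun r : ℝ => (r⁻¹) ^ 2 + b) atTop (𝓝 b) := by
      simpa using (tendsto_inv_atTop_zero.pow 2).add_const b
    have h3 := h2.rpow_const (p := -((n : ℝ) / 2)) (Or.inl hb.ne')
    refine h3.congr' ?_
    filter_upwards [eventually_gt_atTop 0] with r hr
    have e : (r⁻¹) ^ 2 + b = (1 + b * r ^ 2) / r ^ 2 := by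
      field_simp
    have e2 : (r ^ 2 : ℝ) ^ (-((n : ℝ) / 2)) = (r ^ n)⁻¹ := by
      rw [← Real.rpow_natCast r 2, ← Real.rpow_mul hr.le, ← Real.rpow_natCast r n,
        ← Real.rpow_neg hr.le]
      congr 1
      push_cast
      ring
    rw [e, Real.div_rpow (hpos r).le (by positivity), e2, div_inv_eq_mul, mul_comm]
  have h2 := integral_Ioi_of_hasDerivAt_of_nonneg (a := 0) (hder 0).continuousAt.continuousWithinAt
    (fun r _ => hder r) (fun r (hr : 0 < r) => by
      rw [smul_eq_mul]
      exact mul_nonneg (by positivity) (Real.rpow_nonneg (hpos r).le _)) hlim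
  rw [h1, h2, zero_pow (by omega)]
  simp only [zero_mul, zero_div, sub_zero, nsmul_eq_mul, smul_eq_mul, measureReal_def]
  field_simp

/-- The regularization `y ↦ H(c(x, y) + ε)` of the Green function with pole at `x`. -/
def greenReg (n : ℕ) (z : ℂ) (x : E n) (ε : ℝ) (y : E n) : ℂ := greenFun n z (hCosh x y + ε)

theorem contDiffOn_greenFun (hz : z.re = 0) : ContDiffOn ℝ 2 (greenFun n z) (Ioi 1) := by
  have h1 : ∀ c ∈ Ioi (1 : ℝ), HasDerivAt (greenFun n z) (greenFunDeriv n z c) c :=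
    fun c hc => hasDerivAt_greenFun hz hc
  have h2 : ∀ c ∈ Ioi (1 : ℝ), HasDerivAt (greenFunDeriv n z) (greenFunDeriv₂ n z c) c :=
    fun c hc => hasDerivAt_greenFunDeriv hz hc
  have h3 : ContinuousOn (greenFunDeriv₂ n z) (Ioi 1) := by
    have k1 : ContinuousOn (greenFun n z) (Ioi 1) :=
      fun c hc => (h1 c hc).continuousAt.continuousWithinAt
    have k2 : ContinuousOn (greenFunDeriv n z) (Ioi 1) :=
      fun c hc => (h2 c hc).continuousAt.continuousWithinAt
    have k3 : Continuous fun c : ℝ => (c : ℂ) := Complex.continuous_ofReal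
    unfold greenFunDeriv₂
    refine ContinuousOn.div ?_ (by fun_prop) fun c hc => ofReal_sq_sub_one_ne_zero hc
    exact (((continuousOn_const.mul k3.continuousOn).mul k2).add (continuousOn_const.mul k1)).neg
  have h4 : ContDiffOn ℝ 1 (greenFunDeriv n z) (Ioi 1) := by
    rw [show (1 : WithTop ℕ∞) = 0 + 1 from (zero_add 1).symm,
      contDiffOn_succ_iff_deriv_of_isOpen isOpen_Ioi]
    refine ⟨fun c hc => (h2 c hc).differentiableAt.differentiableWithinAt, by simp, ?_⟩
    rw [contDiffOn_zero]
    exact h3.congr fun c hc => (h2 c hc).deriv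
  rw [show (2 : WithTop ℕ∞) = 1 + 1 from one_add_one_eq_two.symm,
    contDiffOn_succ_iff_deriv_of_isOpen isOpen_Ioi]
  exact ⟨fun c hc => (h1 c hc).differentiableAt.differentiableWithinAt, by simp,
    h4.congr fun c hc => (h1 c hc).deriv⟩

variable {x y : E n} {ε : ℝ}

theorem contDiffOn_greenReg (hz : z.re = 0) (hx : x ∈ hBall n) (hε : 0 < ε) :
    ContDiffOn ℝ 2 (greenReg n z x ε) (hBall n) :=
  (contDiffOn_greenFun hz).comp ((contDiffOn_hCosh hx).add contDiffOn_const) fun y hy => by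
    have := one_le_hCosh hx hy
    show 1 < hCosh x y + ε
    linarith

theorem fderiv_greenReg (hz : z.re = 0) (hx : x ∈ hBall n) (hy : y ∈ hBall n) (hε : 0 < ε)
    (v : E n) : fderiv ℝ (greenReg n z x ε) y v
      = greenFunDeriv n z (hCosh x y + ε) * (hCoshDeriv x y v : ℝ) := by
  have hc : 1 < hCosh x y + ε := by linarith [one_le_hCosh hx hy]
  have h : HasFDerivAt (greenReg n z x ε) _ y :=
    (hasDerivAt_greenFun hz hc).hasFDerivAt.comp y ((hasFDerivAt_hCosh hx hy).add_const ε)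
  rw [h.fderiv]
  simp [mul_comm]

/-- The regularized Green function solves the homogeneous equation up to `ε` times the defect: the
shift by `ε` spoils only the coefficients `c² - 1` and `n c` of the radial equation. -/
theorem hLaplacian_greenReg (hz : z.re = 0) (hx : x ∈ hBall n) (hy : y ∈ hBall n) (hε : 0 < ε) :
    hLaplacian (greenReg n z x ε) y
      = -((((n : ℂ) - 1) ^ 2 / 4 - z ^ 2) * greenReg n z x ε y)
        - ε * greenDefect n z ε (hCosh x y + ε) := by
  have hc : 1 < hCosh x y + ε := by linarith [one_le_hCosh hx hy]
  have hev : ∀ᶠ s in 𝓝 (hCosh x y), HasDerivAt (fun s => greenFun n z (s + ε))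
      (greenFunDeriv n z (s + ε)) s := by
    have : ∀ᶠ s in 𝓝 (hCosh x y), 1 < s + ε :=
      (continuous_id.add continuous_const).continuousAt.eventually (lt_mem_nhds hc)
    filter_upwards [this] with s hs
    exact (hasDerivAt_greenFun hz hs).comp_add_const s ε
  have h2 : HasDerivAt (fun s => greenFunDeriv n z (s + ε)) (greenFunDeriv₂ n z (hCosh x y + ε))
      (hCosh x y) := (hasDerivAt_greenFunDeriv hz hc).comp_add_const (hCosh x y) ε
  have h := hLaplacian_comp_hCosh hx hy hev h2
    (contDiffAt_of_mem_hBall (contDiffOn_greenReg hz hx hε) hy)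
  have ho := greenFun_ode (n := n) (z := z) hc
  change hLaplacian (fun w => greenFun n z (hCosh x w + ε)) y = _
  rw [h]
  unfold greenDefect greenReg
  push_cast at ho ⊢
  linear_combination ho

/-- The exponent is that of the bound for `H`; it is not sharp, but integrable in `n` dimensions. -/
theorem integrableOn_norm_sub_rpow (hn : 2 ≤ n) (hx : x ∈ hBall n) :
    IntegrableOn (fun y : E n => ‖y - x‖ ^ (-((n : ℝ) - 1))) (hBall n) := by
  have h1 : LocallyIntegrable (fun y : E n => ‖y‖ ^ (-((n : ℝ) - 1))) volume := by
    refine locallyIntegrable_of_norm_le_rpow (C := 1) (α := (n : ℝ) - 1) ?_ ?_ ?_ ?_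
    · rw [finrank_euclideanSpace_fin]
      omega
    · rw [finrank_euclideanSpace_fin]
      linarith
    · refine ae_of_all _ fun y => ?_
      rw [one_mul, Real.norm_of_nonneg (Real.rpow_nonneg (norm_nonneg _) _)]
    · exact (measurable_norm.pow_const _).aestronglyMeasurable
  have h2 : IntegrableOn (fun y : E n => ‖y‖ ^ (-((n : ℝ) - 1))) (Metric.closedBall 0 2) :=
    h1.integrableOn_isCompact (isCompact_closedBall 0 2)
  rw [← integrable_indicator_iff measurableSet_closedBall] at h2
  refine (h2.comp_sub_right x).integrableOn.congr_fun (fun y hy => ?_) measurableSet_ball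
  refine indicator_of_mem ?_ _
  rw [mem_closedBall_zero_iff]
  have h3 := norm_lt_one hx
  have h4 := norm_lt_one hy
  linarith [norm_sub_le y x]

theorem norm_sub_sq_le_hCosh_sub_one (hx : x ∈ hBall n) (hy : y ∈ hBall n) :
    ‖y - x‖ ^ 2 ≤ hCosh x y - 1 := by
  have h1 := lam_pos hx
  have h2 := lam_pos hy
  unfold hCosh
  rw [add_sub_cancel_left, le_div_iff₀ (by positivity)]
  have h3 : lam x * lam y ≤ 1 := mul_le_one₀ (lam_le_one x) h2.le (lam_le_one y)
  nlinarith [sq_nonneg ‖y - x‖]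

theorem norm_greenFun_hCosh_add_le (hn : 2 ≤ n) (hz : z.re = 0) (hx : x ∈ hBall n)
    (hy : y ∈ hBall n) (hxy : y ≠ x) (hε : 0 ≤ ε) :
    ‖greenFun n z (hCosh x y + ε)‖
      ≤ π * ‖greenConst n z‖ * ‖y - x‖ ^ (-((n : ℝ) - 1)) := by
  have hn' : (2 : ℝ) ≤ n := by exact_mod_cast hn
  have hc := one_lt_hCosh hx hy hxy
  have h3 : 0 < ‖y - x‖ := norm_pos_iff.2 (sub_ne_zero.2 hxy)
  refine (norm_greenFun_le hn hz (by linarith)).trans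
    (mul_le_mul_of_nonneg_left ?_ (by positivity))
  have e : ‖y - x‖ ^ (-((n : ℝ) - 1)) = (‖y - x‖ ^ 2) ^ (-(((n : ℝ) - 1) / 2)) := by
    rw [← Real.rpow_natCast ‖y - x‖ 2, ← Real.rpow_mul h3.le]
    congr 1
    push_cast
    ring
  rw [e]
  exact Real.rpow_le_rpow_of_nonpos (by positivity)
    (by linarith [norm_sub_sq_le_hCosh_sub_one hx hy]) (by linarith)

/-- The potential of a source converges as the regularization of the Green function is removed;
the singularity `|x - y|^(-(n-1))` of the majorant is locally integrable. -/
theorem tendsto_integral_greenReg (hn : 2 ≤ n) (hz : z.re = 0) (hx : x ∈ hBall n) {f : E n → ℂ}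
    (hf : Continuous f) (hfc : HasCompactSupport f) (hfs : tsupport f ⊆ hBall n) :
    Integrable (fun y => greenFun n z (hCosh x y) * f y) (hVol n) ∧
    Tendsto (fun ε => ∫ y, greenReg n z x ε y * f y ∂(hVol n)) (𝓝[>] 0)
      (𝓝 (∫ y, greenFun n z (hCosh x y) * f y ∂(hVol n))) := by
  have hcontf : ContinuousOn (fun y : E n => ((2 / lam y) ^ n : ℝ) • f y) (tsupport f) :=
    (continuousOn_hDensity.mono hfs).smul hf.continuousOn
  obtain ⟨B, hB⟩ := hfc.isCompact.exists_bound_of_continuousOn hcontf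
  set bound : E n → ℝ := fun y => π * ‖greenConst n z‖ * ‖y - x‖ ^ (-((n : ℝ) - 1)) * ‖f y‖ with hbd
  have hbound : Integrable bound (hVol n) := by
    have h1 : Integrable (fun y => ((bound y : ℝ) : ℂ)) (hVol n) := by
      rw [integrable_hVol_iff]
      refine Integrable.mono' (((integrableOn_norm_sub_rpow hn hx).const_mul
        (π * ‖greenConst n z‖)).mul_const |B|) ?_ ?_
      · have h5 : AEStronglyMeasurable (fun y : E n => ((2 / lam y) ^ n : ℝ))
            (volume.restrict (hBall n)) :=
          continuousOn_hDensity.aestronglyMeasurable measurableSet_ball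
        have h6 : Measurable bound := by
          have := hf.measurable
          fun_prop
        exact h5.smul (Complex.measurable_ofReal.comp h6).aestronglyMeasurable
      · refine (ae_restrict_iff' measurableSet_ball).2 (ae_of_all _ fun y hy => ?_)
        have h2 : (0 : ℝ) ≤ (2 / lam y) ^ n := by
          have := lam_pos hy
          positivity
        have h3 : (2 / lam y) ^ n * ‖f y‖ ≤ |B| := by
          by_cases hyf : y ∈ tsupport f
          · refine le_trans ?_ ((hB y hyf).trans (le_abs_self B))
            rw [norm_smul, Real.norm_of_nonneg h2]
          · rw [image_eq_zero_of_notMem_tsupport hyf]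
            simp
        have h4 : (0 : ℝ) ≤ π * ‖greenConst n z‖ * ‖y - x‖ ^ (-((n : ℝ) - 1)) := by
          have := Real.rpow_nonneg (norm_nonneg (y - x)) (-((n : ℝ) - 1))
          positivity
        rw [norm_smul, Complex.norm_real, Real.norm_of_nonneg h2, hbd,
          Real.norm_of_nonneg (mul_nonneg h4 (norm_nonneg _)), mul_left_comm]
        exact mul_le_mul_of_nonneg_left h3 h4
    exact h1.re
  have hmem := ae_hVol_mem_hBall (n := n)
  have hne := ae_hVol_ne hn x
  have hcont : ContinuousOn (fun y => greenFun n z (hCosh x y)) (hBall n \ {x}) := by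
    intro y hy
    have hc := one_lt_hCosh hx hy.1 hy.2
    exact ((hasDerivAt_greenFun hz hc).continuousAt.comp
      (hasFDerivAt_hCosh hx hy.1).continuousAt).continuousWithinAt
  have hmeas0 : AEStronglyMeasurable (fun y => greenFun n z (hCosh x y) * f y) (hVol n) := by
    have hset : MeasurableSet (hBall n \ {x}) := measurableSet_ball.diff (measurableSet_singleton x)
    have h1 : AEStronglyMeasurable (fun y => greenFun n z (hCosh x y) * f y)
        ((hVol n).restrict (hBall n \ {x})) :=
      (hcont.mul hf.continuousOn).aestronglyMeasurable hset
    rwa [Measure.restrict_eq_self_of_ae_mem] at h1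
    filter_upwards [hmem, hne] with y h1 h2
    exact ⟨h1, h2⟩
  refine ⟨hbound.mono' hmeas0 ?_, ?_⟩
  · filter_upwards [hmem, hne] with y h1 h2
    have := norm_greenFun_hCosh_add_le hn hz hx h1 h2 le_rfl
    rw [add_zero] at this
    rw [norm_mul]
    exact mul_le_mul_of_nonneg_right this (norm_nonneg _)
  · refine tendsto_integral_filter_of_dominated_convergence bound ?_ ?_ hbound ?_
    · filter_upwards [self_mem_nhdsWithin] with ε hε
      have h1 : AEStronglyMeasurable (fun y => greenReg n z x ε y * f y)
          ((hVol n).restrict (hBall n)) :=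
        ((contDiffOn_greenReg hz hx hε).continuousOn.mul hf.continuousOn).aestronglyMeasurable
          measurableSet_ball
      rwa [Measure.restrict_eq_self_of_ae_mem hmem] at h1
    · filter_upwards [self_mem_nhdsWithin] with ε hε
      filter_upwards [hmem, hne] with y h1 h2
      rw [norm_mul]
      exact mul_le_mul_of_nonneg_right
        (norm_greenFun_hCosh_add_le hn hz hx h1 h2 (le_of_lt hε)) (norm_nonneg _)
    · filter_upwards [hmem, hne] with y h1 h2
      refine Tendsto.mul_const _ ?_
      have hc := (hasDerivAt_greenFun (n := n) hz (one_lt_hCosh hx h1 h2)).continuousAt.tendsto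
      refine hc.comp ?_
      have : Tendsto (fun ε : ℝ => hCosh x y + ε) (𝓝 0) (𝓝 (hCosh x y + 0)) :=
        (continuous_const.add continuous_id).tendsto 0
      rw [add_zero] at this
      exact this.mono_left nhdsWithin_le_nhds

end concentration

/-! ### Concentration of the defect at the pole -/

section concentration

variable {n : ℕ} {z : ℂ} {x : E n}

/-- The defects of the regularized Green functions form an approximate identity at the pole. In the
variables `ε = δ²`, `y = x + δ w` they converge to a multiple of `(1 + 2 |w|² / (1 - |x|²)²)` to the
power `-(n/2 + 1)`, whose total mass is fixed by the normalization of the Green function. -/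
theorem tendsto_integral_greenDefect (hn : 2 ≤ n) (hz : z.re = 0) (hx : x ∈ hBall n) {R : ℝ}
    (hR : 0 < R) {ψ : E n → ℂ} (hψ : ContinuousOn ψ (hBall n))
    (h0 : ∀ y, y ∉ cutoffSupport n R → ψ y = 0) :
    Tendsto (fun ε : ℝ => ∫ y, ψ y * (ε * greenDefect n z ε (hCosh x y + ε)) ∂(hVol n)) (𝓝[>] 0)
      (𝓝 (ψ x)) := by
  have hlx := lam_pos hx
  have hKb : cutoffSupport n R ⊆ hBall n := cutoffSupport_subset hR
  set r : ℝ := (n : ℝ) / 2 + 1 with hr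
  set Ψ : E n → ℂ := fun y => ((2 / lam y) ^ n : ℝ) • ψ y with hΨ
  have hΨc : ContinuousOn Ψ (hBall n) := continuousOn_hDensity.smul hψ
  have hΨ0 : ∀ y, y ∉ cutoffSupport n R → Ψ y = 0 := fun y hy => by simp [hΨ, h0 y hy]
  obtain ⟨B, hB⟩ := (isCompact_cutoffSupport (n := n) hR).exists_bound_of_continuousOn
    (hΨc.mono hKb)
  obtain ⟨C, hC0, hC⟩ := exists_norm_greenDefect_le (n := n) hn hz (2 + 8 * R / lam x)
  set Φ : ℝ → E n → ℂ := fun δ y =>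
    Ψ y * ((δ ^ 2 : ℝ) * greenDefect n z (δ ^ 2) (hCosh x y + δ ^ 2)) with hΦ
  set τ : ℝ → E n → ℝ := fun δ w => 2 * ‖w‖ ^ 2 / (lam x * lam (x + δ • w)) with hτ
  set s : ℝ → E n → ℝ := fun δ w => hCosh x (x + δ • w) + δ ^ 2 with hs
  have hΦm : ∀ δ, 0 < δ → Measurable (Φ δ) := by
    intro δ hδ
    have hε : 0 < δ ^ 2 := by positivity
    have h1 : ContinuousOn (Φ δ) (hBall n) := by
      refine hΨc.mul (ContinuousOn.congr (f := fun y => -((((n : ℂ) - 1) ^ 2 / 4 - z ^ 2) *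
        greenReg n z x (δ ^ 2) y) - hLaplacian (greenReg n z x (δ ^ 2)) y) ?_ fun y hy => ?_)
      · have hreg := contDiffOn_greenReg (n := n) hz hx hε
        exact (continuousOn_const.mul hreg.continuousOn).neg.sub (continuousOn_hLaplacian hreg)
      · simp only
        rw [hLaplacian_greenReg hz hx hy hε]
        ring
    classical
    have h2 : Φ δ = (hBall n).piecewise (Φ δ) (fun _ => 0) := by
      ext y
      by_cases hy : y ∈ hBall n
      · rw [piecewise_eq_of_mem _ _ _ hy]
      · rw [piecewise_eq_of_notMem _ _ _ hy]
        simp only [hΦ]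
        rw [hΨ0 y fun h => hy (hKb h), zero_mul]
    rw [h2]
    exact h1.measurable_piecewise continuousOn_const measurableSet_ball
  have hs1 : ∀ δ w, s δ w - 1 = δ ^ 2 * (1 + τ δ w) := by
    intro δ w
    simp only [hs, hτ, hCosh]
    rw [add_sub_cancel_left, norm_smul, mul_pow, Real.norm_eq_abs, sq_abs]
    ring
  have hτ0 : ∀ δ w, x + δ • w ∈ hBall n → 0 ≤ τ δ w := by
    intro δ w hw
    have := lam_pos hw
    simp only [hτ]
    positivity
  -- the rescaled integrand
  have hform : ∀ δ w, 0 < δ → x + δ • w ∈ hBall n → ((δ ^ n : ℝ) : ℂ) * Φ δ (x + δ • w)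
      = Ψ (x + δ • w) * (((1 + τ δ w) ^ (-r) : ℝ) : ℂ) *
        ((((s δ w - 1) ^ r : ℝ) : ℂ) * greenDefect n z (δ ^ 2) (s δ w)) := by
    intro δ w hδ hw
    have h1 : 0 < 1 + τ δ w := by linarith [hτ0 δ w hw]
    have e : (1 + τ δ w) ^ (-r) * (s δ w - 1) ^ r = δ ^ n * δ ^ 2 := by
      rw [hs1, Real.mul_rpow (by positivity) h1.le, mul_left_comm, ← Real.rpow_add h1,
        neg_add_cancel, Real.rpow_zero, mul_one, ← Real.rpow_natCast δ 2, ← Real.rpow_mul hδ.le,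
        ← Real.rpow_natCast δ n, ← Real.rpow_add hδ]
      congr 1
      rw [hr]
      push_cast
      ring
    have e' : (((1 + τ δ w) ^ (-r) : ℝ) : ℂ) * (((s δ w - 1) ^ r : ℝ) : ℂ)
        = ((δ ^ n : ℝ) : ℂ) * ((δ ^ 2 : ℝ) : ℂ) := by exact_mod_cast e
    simp only [hΦ]
    change _ * (_ * (_ * greenDefect n z (δ ^ 2) (s δ w))) = _
    linear_combination -(Ψ (x + δ • w) * greenDefect n z (δ ^ 2) (s δ w)) * e'
  have hscale : ∀ δ : ℝ, 0 < δ → ∫ y, ψ y * ((δ ^ 2 : ℝ) *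
      greenDefect n z (δ ^ 2) (hCosh x y + δ ^ 2)) ∂(hVol n)
      = ∫ w, ((δ ^ n : ℝ) : ℂ) * Φ δ (x + δ • w) := by
    intro δ hδ
    have h1 : ∫ y in hBall n, Φ δ y = ∫ y, Φ δ y := by
      refine setIntegral_eq_integral_of_forall_compl_eq_zero fun y hy => ?_
      simp only [hΦ]
      rw [hΨ0 y fun h => hy (hKb h), zero_mul]
    have h2 := Measure.integral_comp_smul (volume : Measure (E n)) (fun y => Φ δ (x + y)) δ
    rw [integral_add_left_eq_self (fun y => Φ δ y) x, finrank_euclideanSpace_fin,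
      abs_of_pos (by positivity)] at h2
    rw [integral_const_mul, h2, integral_hVol, Complex.real_smul, ← mul_assoc, ← Complex.ofReal_mul,
      mul_inv_cancel₀ (by positivity), Complex.ofReal_one, one_mul, ← h1]
    refine setIntegral_congr_fun measurableSet_ball fun y _ => ?_
    simp only [hΦ, hΨ]
    rw [Complex.real_smul, Complex.real_smul]
    ring
  have hpt : ∀ w : E n, Tendsto (fun δ : ℝ => x + δ • w) (𝓝[>] 0) (𝓝 x) := by
    intro w
    have : Tendsto (fun δ : ℝ => x + δ • w) (𝓝 0) (𝓝 (x + (0 : ℝ) • w)) := by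
      have hc : Continuous fun δ : ℝ => x + δ • w := by fun_prop
      exact hc.tendsto 0
    rw [zero_smul, add_zero] at this
    exact this.mono_left nhdsWithin_le_nhds
  have hball : ∀ w : E n, ∀ᶠ δ : ℝ in 𝓝[>] 0, x + δ • w ∈ hBall n := fun w =>
    (hpt w).eventually (Metric.isOpen_ball.mem_nhds hx)
  have hsq : Tendsto (fun δ : ℝ => δ ^ 2) (𝓝[>] 0) (𝓝 0) := by
    have : Tendsto (fun δ : ℝ => δ ^ 2) (𝓝 0) (𝓝 (0 ^ 2)) := (continuous_pow 2).tendsto 0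
    rw [zero_pow two_ne_zero] at this
    exact this.mono_left nhdsWithin_le_nhds
  set V := (volume (Metric.ball (0 : E n) 1)).toReal with hV
  have hlim : ∀ w : E n, Tendsto (fun δ : ℝ => ((δ ^ n : ℝ) : ℂ) * Φ δ (x + δ • w)) (𝓝[>] 0)
      (𝓝 (Ψ x * (((1 + 2 / lam x ^ 2 * ‖w‖ ^ 2) ^ (-r) : ℝ) : ℂ)
        * ((2 ^ (-((n : ℝ) / 2)) / V : ℝ) : ℂ))) := by
    intro w
    have hτl : Tendsto (fun δ : ℝ => τ δ w) (𝓝[>] 0) (𝓝 (2 / lam x ^ 2 * ‖w‖ ^ 2)) := by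
      have h1 := ((continuous_lam.tendsto x).comp (hpt w)).const_mul (lam x)
      have h2 := (tendsto_const_nhds (x := 2 * ‖w‖ ^ 2)).div h1 (mul_pos hlx hlx).ne'
      rw [show 2 / lam x ^ 2 * ‖w‖ ^ 2 = 2 * ‖w‖ ^ 2 / (lam x * lam x) by ring]
      exact h2
    have hsl : Tendsto (fun δ : ℝ => s δ w) (𝓝[>] 0) (𝓝[>] 1) := by
      refine tendsto_nhdsWithin_iff.2 ⟨?_, ?_⟩
      · have h1 : Tendsto (fun δ : ℝ => 1 + δ ^ 2 * (1 + τ δ w)) (𝓝[>] 0) (𝓝 (1 + 0 * _)) :=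
          (hsq.mul (hτl.const_add 1)).const_add 1
        rw [zero_mul, add_zero] at h1
        refine h1.congr fun δ => ?_
        rw [← hs1]
        ring
      · filter_upwards [hball w, self_mem_nhdsWithin] with δ hw hδ
        have hδ : 0 < δ := hδ
        have h2 : 0 < δ ^ 2 * (1 + τ δ w) := by
          have := hτ0 δ w hw
          positivity
        rw [← hs1] at h2
        show 1 < s δ w
        linarith
    have h1 : Tendsto (fun δ : ℝ => Ψ (x + δ • w)) (𝓝[>] 0) (𝓝 (Ψ x)) :=
      ((hΨc.continuousAt (Metric.isOpen_ball.mem_nhds hx)).tendsto).comp (hpt w)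
    have h2 : Tendsto (fun δ : ℝ => (((1 + τ δ w) ^ (-r) : ℝ) : ℂ)) (𝓝[>] 0)
        (𝓝 (((1 + 2 / lam x ^ 2 * ‖w‖ ^ 2) ^ (-r) : ℝ) : ℂ)) :=
      (Complex.continuous_ofReal.tendsto _).comp
        ((hτl.const_add 1).rpow_const (Or.inl (by positivity)))
    have h3 := tendsto_rpow_mul_greenDefect hn hz hsq hsl
    refine ((h1.mul h2).mul h3).congr' ?_
    filter_upwards [hball w, self_mem_nhdsWithin] with δ hw hδ
    exact (hform δ w hδ hw).symm
  have hbound : ∀ δ : ℝ, 0 < δ → δ ≤ 1 → ∀ w : E n, ‖((δ ^ n : ℝ) : ℂ) * Φ δ (x + δ • w)‖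
      ≤ |B| * C * (1 + ‖w‖ ^ 2) ^ (-((n : ℝ) + 2) / 2) := by
    intro δ hδ hδ1 w
    have hp := Real.rpow_nonneg (show (0 : ℝ) ≤ 1 + ‖w‖ ^ 2 by positivity) (-((n : ℝ) + 2) / 2)
    by_cases hK : x + δ • w ∈ cutoffSupport n R
    · have hw := hKb hK
      have hK' : 1 ≤ R * lam (x + δ • w) := hK
      have hlw := lam_pos hw
      have hτ1 := hτ0 δ w hw
      have hτ2 : ‖w‖ ^ 2 ≤ τ δ w := by
        simp only [hτ]
        rw [le_div_iff₀ (by positivity)]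
        have h3 : lam x * lam (x + δ • w) ≤ 1 := mul_le_one₀ (lam_le_one x) hlw.le (lam_le_one _)
        nlinarith [sq_nonneg ‖w‖]
      have hs2 : 0 < s δ w - 1 := by
        rw [hs1]
        positivity
      have hs3 : s δ w ≤ 2 + 8 * R / lam x := by
        simp only [hs, hCosh]
        have h4 : ‖x + δ • w - x‖ ≤ 2 := by
          linarith [norm_sub_le (x + δ • w) x, norm_lt_one hx, norm_lt_one hw]
        have h5 : ‖x + δ • w - x‖ ^ 2 ≤ 4 := by nlinarith [norm_nonneg (x + δ • w - x)]
        have h6 : 2 * ‖x + δ • w - x‖ ^ 2 / (lam x * lam (x + δ • w)) ≤ 8 * R / lam x := by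
          rw [div_le_div_iff₀ (by positivity) hlx]
          nlinarith [mul_le_mul_of_nonneg_right hK' hlx.le, mul_le_mul_of_nonneg_right h5 hlx.le]
        nlinarith
      rw [hform δ w hδ hw, norm_mul, norm_mul, Complex.norm_real,
        Real.norm_of_nonneg (Real.rpow_nonneg (by linarith) _)]
      have b1 : ‖(((s δ w - 1) ^ r : ℝ) : ℂ) * greenDefect n z (δ ^ 2) (s δ w)‖ ≤ C := by
        have := hC (δ ^ 2) (s δ w) (by positivity) (by nlinarith) (by linarith) hs3
        rw [norm_mul, Complex.norm_real, Real.norm_of_nonneg (Real.rpow_nonneg hs2.le _)]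
        calc _ ≤ (s δ w - 1) ^ r * (C * (s δ w - 1) ^ (-r)) :=
              mul_le_mul_of_nonneg_left this (Real.rpow_nonneg hs2.le _)
          _ = C * ((s δ w - 1) ^ r * (s δ w - 1) ^ (-r)) := by ring
          _ = C := by rw [← Real.rpow_add hs2, add_neg_cancel, Real.rpow_zero, mul_one]
      have b2 : (1 + τ δ w) ^ (-r) ≤ (1 + ‖w‖ ^ 2) ^ (-((n : ℝ) + 2) / 2) := by
        rw [show -((n : ℝ) + 2) / 2 = -r by rw [hr]; ring]
        exact Real.rpow_le_rpow_of_nonpos (by positivity) (by linarith)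
          (by rw [hr]; have : (0 : ℝ) ≤ n := by positivity
              linarith)
      have b3 : ‖Ψ (x + δ • w)‖ ≤ |B| := (hB _ hK).trans (le_abs_self B)
      calc _ ≤ |B| * (1 + ‖w‖ ^ 2) ^ (-((n : ℝ) + 2) / 2) * C :=
            mul_le_mul (mul_le_mul b3 b2 (Real.rpow_nonneg (by linarith) _) (abs_nonneg B)) b1
              (norm_nonneg _) (by positivity)
        _ = _ := by ring
    · simp only [hΦ]
      rw [hΨ0 _ hK, zero_mul, mul_zero, norm_zero]
      positivity
  have hmain : Tendsto (fun δ : ℝ => ∫ w, ((δ ^ n : ℝ) : ℂ) * Φ δ (x + δ • w)) (𝓝[>] 0)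
      (𝓝 (∫ w : E n, Ψ x * (((1 + 2 / lam x ^ 2 * ‖w‖ ^ 2) ^ (-r) : ℝ) : ℂ)
        * ((2 ^ (-((n : ℝ) / 2)) / V : ℝ) : ℂ))) := by
    refine tendsto_integral_filter_of_dominated_convergence
      (fun w => |B| * C * (1 + ‖w‖ ^ 2) ^ (-((n : ℝ) + 2) / 2)) ?_ ?_ ?_ (ae_of_all _ hlim)
    · filter_upwards [self_mem_nhdsWithin] with δ hδ
      have h1 := (hΦm δ hδ).comp (g := Φ δ) (f := fun w : E n => x + δ • w) (by fun_prop)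
      exact (h1.const_mul _).aestronglyMeasurable
    · have h1 : ∀ᶠ δ : ℝ in 𝓝[>] 0, δ ≤ 1 :=
        (eventually_le_nhds one_pos).filter_mono nhdsWithin_le_nhds
      filter_upwards [self_mem_nhdsWithin, h1] with δ hδ hδ1
      exact ae_of_all _ (hbound δ hδ hδ1)
    · refine (integrable_rpow_neg_one_add_norm_sq (E := E n) (μ := volume) ?_).const_mul _
      rw [finrank_euclideanSpace_fin]
      linarith
  have hval : ∫ w : E n, Ψ x * (((1 + 2 / lam x ^ 2 * ‖w‖ ^ 2) ^ (-r) : ℝ) : ℂ)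
        * ((2 ^ (-((n : ℝ) / 2)) / V : ℝ) : ℂ) = ψ x := by
    have hVpos : 0 < V :=
      ENNReal.toReal_pos (Metric.measure_ball_pos _ _ one_pos).ne' measure_ball_lt_top.ne
    rw [integral_mul_const, integral_const_mul, integral_complex_ofReal, hr,
      integral_one_add_mul_norm_sq_rpow hn (by positivity), ← hV]
    simp only [hΨ]
    rw [Complex.real_smul]
    have e : (2 / lam x) ^ n * ((2 / lam x ^ 2) ^ (-((n : ℝ) / 2)) * V) *
        (2 ^ (-((n : ℝ) / 2)) / V) = 1 := by
      have e1 : (2 / lam x ^ 2) ^ (-((n : ℝ) / 2)) * (2 : ℝ) ^ (-((n : ℝ) / 2))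
          = ((2 / lam x) ^ n)⁻¹ := by
        rw [← Real.mul_rpow (by positivity) (by norm_num),
          show 2 / lam x ^ 2 * 2 = (2 / lam x) ^ 2 by ring, ← Real.rpow_natCast (2 / lam x) 2,
          ← Real.rpow_mul (by positivity), ← Real.rpow_natCast (2 / lam x) n,
          ← Real.rpow_neg (by positivity)]
        congr 1
        push_cast
        ring
      have e2 : (2 / lam x) ^ n * ((2 / lam x ^ 2) ^ (-((n : ℝ) / 2)) * V) *
          (2 ^ (-((n : ℝ) / 2)) / V)
          = (2 / lam x) ^ n * ((2 / lam x ^ 2) ^ (-((n : ℝ) / 2)) * 2 ^ (-((n : ℝ) / 2))) := by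
        field_simp
      rw [e2, e1, mul_inv_cancel₀ (by positivity)]
    have e' := congrArg (fun t : ℝ => (t : ℂ)) e
    push_cast at e' ⊢
    linear_combination ψ x * e'
  rw [hval] at hmain
  have hsqrt : Tendsto Real.sqrt (𝓝[>] 0) (𝓝[>] 0) := by
    refine tendsto_nhdsWithin_iff.2 ⟨?_, ?_⟩
    · have := Real.continuous_sqrt.tendsto 0
      rw [Real.sqrt_zero] at this
      exact this.mono_left nhdsWithin_le_nhds
    · filter_upwards [self_mem_nhdsWithin] with ε hε
      exact Real.sqrt_pos.2 hε
  refine (hmain.comp hsqrt).congr' ?_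
  filter_upwards [self_mem_nhdsWithin] with ε hε
  have hε : 0 < ε := hε
  have := hscale (Real.sqrt ε) (Real.sqrt_pos.2 hε)
  rw [Real.sq_sqrt hε.le] at this
  rw [Function.comp_apply, ← this]

end concentration

/-! ### Integrals over shells near the sphere at infinity -/

section estimates

variable {n : ℕ}

theorem integrable_shellWeight_mul {R : ℝ} (hR : 0 < R) {F : E n → ℝ}
    (hF : ContinuousOn F (hBall n)) : Integrable (fun y => shellWeight R y * F y) (hVol n) :=
  integrable_hVol_of_isCompact (isCompact_cutoffSupport hR) (cutoffSupport_subset hR)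
    (continuous_shellWeight.continuousOn.mul hF) fun y _ hy => by
      rw [shellWeight_eq_zero (Or.inl (not_le.1 hy).le), zero_mul]

/-- Integrals over the shells are compared through pointwise bounds on the shell only. -/
theorem integral_shellWeight_mono {R : ℝ} (hR : 0 < R) {F G : E n → ℝ}
    (hF : ContinuousOn F (hBall n)) (hG : ContinuousOn G (hBall n))
    (h : ∀ y ∈ hBall n, lam y ≤ 2 / R → F y ≤ G y) :
    ∫ y, shellWeight R y * F y ∂(hVol n) ≤ ∫ y, shellWeight R y * G y ∂(hVol n) := by
  refine integral_mono_ae (integrable_shellWeight_mul hR hF) (integrable_shellWeight_mul hR hG) ?_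
  filter_upwards [ae_hVol_mem_hBall] with y hy
  rcases le_or_gt (lam y) (2 / R) with h1 | h1
  · exact mul_le_mul_of_nonneg_left (h y hy h1) (shellWeight_nonneg hR y)
  · rw [div_lt_iff₀ hR, mul_comm] at h1
    rw [shellWeight_eq_zero (Or.inr h1.le)]
    simp

theorem norm_integral_shellWeight_le {R : ℝ} (hR : 0 < R) {F : E n → ℂ} {G : E n → ℝ}
    (hG : ContinuousOn G (hBall n))
    (h : ∀ y ∈ hBall n, lam y ≤ 2 / R → ‖F y‖ ≤ G y) :
    ‖∫ y, (shellWeight R y : ℂ) * F y ∂(hVol n)‖ ≤ ∫ y, shellWeight R y * G y ∂(hVol n) := by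
  refine norm_integral_le_of_norm_le (integrable_shellWeight_mul hR hG) ?_
  filter_upwards [ae_hVol_mem_hBall] with y hy
  rw [norm_mul, Complex.norm_real, Real.norm_of_nonneg (shellWeight_nonneg hR y)]
  rcases le_or_gt (lam y) (2 / R) with h1 | h1
  · exact mul_le_mul_of_nonneg_left (h y hy h1) (shellWeight_nonneg hR y)
  · rw [div_lt_iff₀ hR, mul_comm] at h1
    rw [shellWeight_eq_zero (Or.inr h1.le)]
    simp

theorem continuousOn_lam_pow (k : ℕ) : ContinuousOn (fun y : E n => lam y ^ k) (hBall n) :=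
  (continuous_lam.pow k).continuousOn

/-- The shell `1 / R ≤ 1 - |y|² ≤ 2 / R` has Euclidean volume `O(1 / R)`, hence hyperbolic volume
`O(R^(n-1))`. -/
theorem exists_integral_shellWeight_le (hn : 2 ≤ n) :
    ∃ K, 0 ≤ K ∧ ∀ R : ℝ, 2 ≤ R → ∫ y, shellWeight R y * lam y ^ (n - 2) ∂(hVol n) ≤ K := by
  obtain ⟨m, rfl⟩ : ∃ m, n = m + 2 := ⟨n - 2, by omega⟩
  obtain ⟨M, hM0, hM⟩ := exists_deriv_smoothTransition_le
  set V := (volume (Metric.ball (0 : E (m + 2)) 1)).toReal with hV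
  have hV0 : 0 ≤ V := ENNReal.toReal_nonneg
  refine ⟨2 ^ (m + 2) * M * (m + 2) * V, by positivity, fun R hR => ?_⟩
  have hR0 : 0 < R := by linarith
  set δ := 2 / R with hδ
  have hδ1 : δ ≤ 1 := by rw [hδ, div_le_one hR0]; exact hR
  have hδ0 : 0 < δ := by positivity
  set A : Set (E (m + 2)) := Metric.ball 0 1 \ Metric.ball 0 (1 - δ) with hA
  have hAm : MeasurableSet A := measurableSet_ball.diff measurableSet_ball
  have hvolA : (volume A).toReal ≤ V * ((m + 2) * δ) := by
    have hsub : Metric.ball (0 : E (m + 2)) (1 - δ) ⊆ Metric.ball 0 1 :=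
      Metric.ball_subset_ball (by linarith)
    have h1 : (volume (Metric.ball (0 : E (m + 2)) (1 - δ))).toReal = (1 - δ) ^ (m + 2) * V := by
      rw [Measure.addHaar_ball _ _ (by linarith), finrank_euclideanSpace_fin, ENNReal.toReal_mul,
        ENNReal.toReal_ofReal (pow_nonneg (by linarith) _)]
    rw [hA, measure_sdiff hsub measurableSet_ball.nullMeasurableSet measure_ball_lt_top.ne,
      ENNReal.toReal_sub_of_le (measure_mono hsub) measure_ball_lt_top.ne, h1, ← hV]
    have h2 := one_add_mul_le_pow (a := -δ) (by linarith) (m + 2)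
    push_cast at h2
    rw [← sub_eq_add_neg] at h2
    nlinarith
  have hAfin : volume A ≠ ⊤ :=
    ne_top_of_le_ne_top (measure_ball_lt_top (x := (0 : E (m + 2))) (r := 1)).ne
      (measure_mono sdiff_subset)
  rw [integral_hVol]
  have hcongr : ∫ y in hBall (m + 2), ((2 / lam y) ^ (m + 2) : ℝ) •
      (shellWeight R y * lam y ^ (m + 2 - 2))
      = ∫ y in hBall (m + 2), 2 ^ (m + 1) * R * deriv Real.smoothTransition (R * lam y - 1) := by
    refine setIntegral_congr_fun measurableSet_ball fun y hy => ?_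
    have hl := (lam_pos hy).ne'
    unfold shellWeight
    rw [smul_eq_mul, Nat.add_sub_cancel, div_pow]
    field_simp
    ring
  rw [hcongr]
  have hind : ∫ y in hBall (m + 2), 2 ^ (m + 1) * R * deriv Real.smoothTransition (R * lam y - 1)
      ≤ ∫ y in hBall (m + 2), A.indicator (fun _ => 2 ^ (m + 1) * R * M) y := by
    refine integral_mono_of_nonneg (ae_of_all _ fun y => ?_) ?_ ?_
    · exact mul_nonneg (by positivity) Real.smoothTransition.monotone.deriv_nonneg
    · exact ((integrable_indicator_iff hAm).2 (integrableOn_const hAfin)).integrableOn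
    · refine (ae_restrict_iff' measurableSet_ball).2 (ae_of_all _ fun y hy => ?_)
      by_cases hyA : y ∈ A
      · rw [indicator_of_mem hyA]
        exact mul_le_mul_of_nonneg_left (hM _) (by positivity)
      · rw [indicator_of_notMem hyA]
        have h1 : ‖y‖ < 1 - δ := by
          by_contra h
          exact hyA ⟨hy, fun h' => h (by simpa using h')⟩
        have h2 : δ ≤ lam y := by
          unfold lam
          nlinarith [norm_nonneg y]
        have h3 : 2 ≤ R * lam y := by
          rw [hδ, div_le_iff₀ hR0] at h2
          linarith
        have h4 := deriv_smoothTransition_of_one_le (t := R * lam y - 1) (by linarith)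
        simp only [h4, mul_zero, le_refl]
  refine hind.trans ?_
  rw [setIntegral_indicator hAm, setIntegral_const, inter_eq_self_of_subset_right sdiff_subset,
    smul_eq_mul, measureReal_def]
  calc (volume A).toReal * (2 ^ (m + 1) * R * M)
      ≤ V * ((m + 2) * δ) * (2 ^ (m + 1) * R * M) :=
        mul_le_mul_of_nonneg_right hvolA (by positivity)
    _ = 2 ^ (m + 2) * M * (m + 2) * V := by
        rw [hδ]
        field_simp
        ring

/-- The factor `sinh ρ tanh (ρ / 2) = cosh ρ - 1` at `y`. -/
def coshSubOne (y : E n) : ℝ := 2 * ‖y‖ ^ 2 / lam y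

theorem continuousOn_coshSubOne : ContinuousOn (coshSubOne : E n → ℝ) (hBall n) := by
  unfold coshSubOne
  exact ContinuousOn.div (by fun_prop) continuous_lam.continuousOn fun y hy => (lam_pos hy).ne'

theorem inv_lam_le_coshSubOne {y : E n} (hy : y ∈ hBall n) (h : lam y ≤ 1 / 2) :
    1 / lam y ≤ coshSubOne y := by
  unfold coshSubOne
  refine div_le_div_of_nonneg_right ?_ (lam_pos hy).le
  unfold lam at h
  linarith

theorem coshSubOne_le {y : E n} (hy : y ∈ hBall n) : coshSubOne y ≤ 2 / lam y := by
  unfold coshSubOne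
  refine div_le_div_of_nonneg_right ?_ (lam_pos hy).le
  nlinarith [norm_lt_one hy, norm_nonneg y]

theorem rpow_lam_sq (hn : 2 ≤ n) {y : E n} (hy : y ∈ hBall n) :
    lam y ^ (((n : ℝ) - 1) / 2) * lam y ^ (((n : ℝ) - 1) / 2) = lam y * lam y ^ (n - 2) := by
  have h := lam_pos hy
  rw [← Real.rpow_add h, ← Real.rpow_natCast, ← Real.rpow_one_add' h.le (by positivity)]
  congr 1
  push_cast [hn]
  ring

/-- The radiation condition in Euclidean terms. -/
theorem Radiating.exists_norm_le {μ : ℝ} {u : E n → ℂ} (hrad : Radiating μ u)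
    (hu : ContDiffOn ℝ 2 u (hBall n)) {η : ℝ} (hη : 0 < η) :
    ∃ R₀ : ℝ, 4 ≤ R₀ ∧ ∀ y ∈ hBall n, lam y ≤ 2 / R₀ →
      ‖fderiv ℝ u y y - ((μ : ℂ) * Complex.I - ((n : ℂ) - 1) / 2) * (coshSubOne y : ℝ) * u y‖
        ≤ 2 * η * lam y ^ (((n : ℝ) - 1) / 2) / lam y := by
  have h1 := hrad.def hη
  unfold atInfinity at h1
  rw [eventually_inf_principal, eventually_comap] at h1
  obtain ⟨ρ₀, hρ₀⟩ := eventually_atTop.1 h1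
  refine ⟨max 4 (2 * Real.exp ρ₀), le_max_left _ _, fun y hy hlam => ?_⟩
  have hR0 : (0 : ℝ) < max 4 (2 * Real.exp ρ₀) := lt_max_of_lt_left (by norm_num)
  have hl := lam_pos hy
  have hy1 := norm_lt_one hy
  have hl1 : lam y ≤ 1 / 2 := hlam.trans (by
    rw [div_le_div_iff₀ hR0 two_pos]
    linarith [le_max_left 4 (2 * Real.exp ρ₀)])
  have hl2 : Real.exp ρ₀ ≤ 1 / lam y := by
    rw [le_div_iff₀ hl]
    rw [le_div_iff₀ hR0] at hlam
    nlinarith [le_max_right 4 (2 * Real.exp ρ₀), Real.exp_pos ρ₀]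
  have hyn : 1 / 2 ≤ ‖y‖ := by
    unfold lam at hl1
    nlinarith [norm_nonneg y]
  have hy0 : y ≠ 0 := fun h => by
    rw [h, norm_zero] at hyn
    norm_num at hyn
  have hρ : ρ₀ ≤ hRadius y := by
    rw [← Real.exp_le_exp, exp_hRadius hy1]
    refine hl2.trans ?_
    rw [div_le_div_iff₀ hl (by linarith)]
    unfold lam
    nlinarith [norm_nonneg y]
  have h2 := hρ₀ (hRadius y) hρ y rfl hy
  have hsinh := sinh_hRadius hy1
  have hσ1 : 1 / lam y ≤ Real.sinh (hRadius y) := by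
    rw [hsinh]
    exact div_le_div_of_nonneg_right (by linarith) hl.le
  have hσ2 : Real.sinh (hRadius y) ≤ 2 / lam y := by
    rw [hsinh]
    exact div_le_div_of_nonneg_right (by linarith) hl.le
  have hσ0 : 0 < Real.sinh (hRadius y) := lt_of_lt_of_le (by positivity) hσ1
  have hr := radialDeriv_mul_sinh hy hy0
    ((contDiffAt_of_mem_hBall hu hy).differentiableAt (by norm_num))
  have e : fderiv ℝ u y y - ((μ : ℂ) * Complex.I - ((n : ℂ) - 1) / 2) * (coshSubOne y : ℝ) * u y
      = (radialDeriv u y - ((μ : ℂ) * Complex.I - ((n : ℂ) - 1) / 2) *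
        ((Real.tanh (hRadius y / 2) : ℝ) : ℂ) * u y) * ((Real.sinh (hRadius y) : ℝ) : ℂ) := by
    have e1 : coshSubOne y = Real.tanh (hRadius y / 2) * Real.sinh (hRadius y) := by
      rw [tanh_half_hRadius hy1, hsinh]
      unfold coshSubOne lam
      ring
    rw [← hr, e1, Complex.ofReal_mul]
    ring
  rw [e, norm_mul, Complex.norm_real, Real.norm_of_nonneg hσ0.le]
  have hn0 : (0 : ℝ) ≤ ((n : ℝ) - 1) / 2 ∨ n = 0 := by
    rcases Nat.eq_zero_or_pos n with h | h
    · exact Or.inr h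
    · have : (1 : ℝ) ≤ n := by exact_mod_cast h
      exact Or.inl (by linarith)
  rcases hn0 with hn0 | hn0
  swap
  · subst hn0
    exact absurd (Subsingleton.elim y 0) hy0
  have h3 : ‖Real.sinh (hRadius y) ^ (-(((n : ℝ) - 1) / 2))‖ ≤ lam y ^ (((n : ℝ) - 1) / 2) := by
    rw [Real.norm_of_nonneg (Real.rpow_nonneg hσ0.le _)]
    refine (Real.rpow_le_rpow_of_nonpos (by positivity) hσ1 (by linarith)).trans ?_
    rw [one_div, Real.inv_rpow hl.le, Real.rpow_neg hl.le, inv_inv]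
  have hd := Real.rpow_nonneg hl.le (((n : ℝ) - 1) / 2)
  calc _ ≤ η * lam y ^ (((n : ℝ) - 1) / 2) * (2 / lam y) :=
        mul_le_mul (h2.trans (mul_le_mul_of_nonneg_left h3 hη.le)) hσ2 hσ0.le (by positivity)
    _ = _ := by ring

end estimates

/-! ### The energy flux of a radiating solution -/

section flux

variable {n : ℕ} {μ : ℝ} {f u : E n → ℂ} {x y : E n}

theorem fderiv_conj_apply (hu : DifferentiableAt ℝ u y) (v : E n) :
    fderiv ℝ (fun y => (starRingEnd ℂ) (u y)) y v = (starRingEnd ℂ) (fderiv ℝ u y v) := by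
  have h := (Complex.conjCLE.toContinuousLinearMap.hasFDerivAt (x := u y)).comp y hu.hasFDerivAt
  rw [show (fun y => (starRingEnd ℂ) (u y)) = Complex.conjCLE.toContinuousLinearMap ∘ u from rfl,
    h.fderiv]
  simp

theorem hLaplacian_conj (hu : ContDiffOn ℝ 2 u (hBall n)) (hy : y ∈ hBall n) :
    hLaplacian (fun y => (starRingEnd ℂ) (u y)) y = (starRingEnd ℂ) (hLaplacian u y) := by
  have hc := contDiffAt_of_mem_hBall hu hy
  have h := hc.laplacian_CLM_comp_left (l := Complex.conjCLE.toContinuousLinearMap)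
  unfold hLaplacian
  rw [fderiv_conj_apply (hc.differentiableAt (by norm_num)),
    show (fun y => (starRingEnd ℂ) (u y)) = Complex.conjCLE.toContinuousLinearMap ∘ u from rfl, h]
  simp [map_ofNat]

theorem contDiffOn_conj (hu : ContDiffOn ℝ 2 u (hBall n)) :
    ContDiffOn ℝ 2 (fun y => (starRingEnd ℂ) (u y)) (hBall n) :=
  Complex.conjCLE.toContinuousLinearMap.contDiff.comp_contDiffOn hu

theorem integrable_mul_isTestFun (hu : ContinuousOn u (hBall n)) (hf : IsTestFun f) :
    Integrable (fun y => u y * f y) (hVol n) :=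
  integrable_hVol_of_isCompact hf.compact hf.support_subset
    (hu.mul hf.smooth.continuous.continuousOn) fun y _ hy => by
      rw [image_eq_zero_of_notMem_tsupport hy, mul_zero]

theorem IsRadiatingSolution.hLaplacian_eq (h : IsRadiatingSolution μ f u) (hy : y ∈ hBall n) :
    hLaplacian u y = -f y - (((n : ℂ) - 1) ^ 2 / 4 + (μ : ℂ) ^ 2) * u y := by
  have h1 := h.equation y hy
  unfold helmholtz at h1
  linear_combination -h1

/-- Green's identity for `u` and its conjugate: the energy flux through the shells is controlled by
the source. -/
theorem abs_integral_shellWeight_im_le (hn : 2 ≤ n) (hf : IsTestFun f)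
    (h : IsRadiatingSolution μ f u) {R : ℝ} (hR : 0 < R) :
    |∫ y, shellWeight R y * (2 * ((starRingEnd ℂ) (u y) * fderiv ℝ u y y).im) ∂(hVol n)|
      ≤ ∫ y, 2 * ‖u y * f y‖ ∂(hVol n) := by
  have hu := h.contDiffOn
  have hG := green_identity hn hR (contDiffOn_conj hu) hu
  have e1 : ∫ y, (shellWeight R y : ℂ) * ((starRingEnd ℂ) (u y) * fderiv ℝ u y y
      - u y * fderiv ℝ (fun y => (starRingEnd ℂ) (u y)) y y) ∂(hVol n)
      = ((∫ y, shellWeight R y * (2 * ((starRingEnd ℂ) (u y) * fderiv ℝ u y y).im) ∂(hVol n) : ℝ)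
        : ℂ) * Complex.I := by
    rw [← integral_complex_ofReal, ← integral_mul_const]
    refine integral_congr_ae ?_
    filter_upwards [ae_hVol_mem_hBall] with y hy
    rw [fderiv_conj_apply ((contDiffAt_of_mem_hBall hu hy).differentiableAt (by norm_num))]
    have h2 := Complex.sub_conj ((starRingEnd ℂ) (u y) * fderiv ℝ u y y)
    rw [map_mul, Complex.conj_conj] at h2
    rw [h2]
    push_cast
    ring
  have e2 : |∫ y, shellWeight R y * (2 * ((starRingEnd ℂ) (u y) * fderiv ℝ u y y).im) ∂(hVol n)|
      = ‖∫ y, (cutoff R y : ℂ) * ((starRingEnd ℂ) (u y) * hLaplacian u y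
        - u y * hLaplacian (fun y => (starRingEnd ℂ) (u y)) y) ∂(hVol n)‖ := by
    rw [hG, e1, norm_mul, Complex.norm_I, mul_one, Complex.norm_real, Real.norm_eq_abs]
  rw [e2]
  refine norm_integral_le_of_norm_le
    ((integrable_mul_isTestFun hu.continuousOn hf).norm.const_mul 2) ?_
  filter_upwards [ae_hVol_mem_hBall] with y hy
  rw [hLaplacian_conj hu hy, h.hLaplacian_eq hy]
  have e3 : (starRingEnd ℂ) (u y) * (-f y - (((n : ℂ) - 1) ^ 2 / 4 + (μ : ℂ) ^ 2) * u y)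
      - u y * (starRingEnd ℂ) (-f y - (((n : ℂ) - 1) ^ 2 / 4 + (μ : ℂ) ^ 2) * u y)
      = (starRingEnd ℂ) (u y * (starRingEnd ℂ) (-f y)) - u y * (starRingEnd ℂ) (-f y) := by
    simp only [map_sub, map_mul, map_add, map_neg, map_pow, map_div₀, map_one, map_natCast,
      map_ofNat, Complex.conj_ofReal, Complex.conj_conj]
    ring
  rw [e3, norm_mul, Complex.norm_real, Real.norm_eq_abs]
  have h3 : ‖u y * (starRingEnd ℂ) (-f y)‖ = ‖u y * f y‖ := by simp
  calc _ ≤ 1 * (‖u y * f y‖ + ‖u y * f y‖) := by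
        refine mul_le_mul (abs_cutoff_le_one y) ((norm_sub_le _ _).trans_eq ?_) (norm_nonneg _)
          zero_le_one
        rw [RCLike.norm_conj, h3]
    _ = 2 * ‖u y * f y‖ := by ring

/-- The radiation condition turns the bound on the energy flux into a bound on the mean of `|u|²`
over the shells. -/
theorem IsRadiatingSolution.exists_integral_shellWeight_norm_sq_le (hn : 2 ≤ n) (hμ : 0 < μ)
    (hf : IsTestFun f) (h : IsRadiatingSolution μ f u) :
    ∃ C R₀ : ℝ, 0 ≤ C ∧ ∀ R, R₀ ≤ R →
      ∫ y, shellWeight R y * (coshSubOne y * ‖u y‖ ^ 2) ∂(hVol n) ≤ C := by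
  have hu := h.contDiffOn
  obtain ⟨R₀, hR₀, hE⟩ := h.radiating.exists_norm_le hu one_pos
  obtain ⟨K, hK0, hK⟩ := exists_integral_shellWeight_le hn
  set F := ∫ y, 2 * ‖u y * f y‖ ∂(hVol n) with hF
  have hF0 : 0 ≤ F := integral_nonneg fun y => by positivity
  refine ⟨F / μ + 4 / μ ^ 2 * K, R₀, by positivity, fun R hR => ?_⟩
  have hRpos : 0 < R := by linarith
  have hcI : ContinuousOn (fun y => 2 * ((starRingEnd ℂ) (u y) * fderiv ℝ u y y).im) (hBall n) :=
    continuousOn_const.mul (Complex.continuous_im.comp_continuousOn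
      ((Complex.continuous_conj.comp_continuousOn hu.continuousOn).mul
        (continuousOn_fderiv_apply_self hu)))
  have hmono := integral_shellWeight_mono hRpos
    (F := fun y => coshSubOne y * ‖u y‖ ^ 2)
    (G := fun y => 1 / μ * (2 * ((starRingEnd ℂ) (u y) * fderiv ℝ u y y).im)
      + 4 / μ ^ 2 * lam y ^ (n - 2))
    (continuousOn_coshSubOne.mul (hu.continuousOn.norm.pow 2))
    ((continuousOn_const.mul hcI).add (continuousOn_const.mul (continuousOn_lam_pow _)))
    fun y hy hly => by
      have hl := lam_pos hy
      have hly' : lam y ≤ 2 / R₀ := hly.trans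
        (div_le_div_of_nonneg_left two_pos.le (by linarith) hR)
      have hl1 : lam y ≤ 1 / 2 := hly'.trans (by
        rw [div_le_div_iff₀ (by linarith) two_pos]
        linarith)
      have hp := inv_lam_le_coshSubOne hy hl1
      set D := fderiv ℝ u y y
      set p := coshSubOne y
      set d := lam y ^ (((n : ℝ) - 1) / 2) with hd
      have hd0 : 0 ≤ d := Real.rpow_nonneg hl.le _
      have hdd : d * d = lam y * lam y ^ (n - 2) := rpow_lam_sq hn hy
      set e := D - ((μ : ℂ) * Complex.I - ((n : ℂ) - 1) / 2) * (p : ℝ) * u y with he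
      have hEy : ‖e‖ ≤ 2 * 1 * d / lam y := hE y hy hly'
      have him : ((starRingEnd ℂ) (u y) * D).im
          = ((starRingEnd ℂ) (u y) * e).im + μ * p * ‖u y‖ ^ 2 := by
        have e1 : (starRingEnd ℂ) (u y) * D = (starRingEnd ℂ) (u y) * e
            + ((μ : ℂ) * Complex.I - ((n : ℂ) - 1) / 2) * ((p * ‖u y‖ ^ 2 : ℝ) : ℂ) := by
          rw [he]
          push_cast
          rw [← Complex.conj_mul' (u y)]
          ring
        have e2 : ((μ : ℂ) * Complex.I - ((n : ℂ) - 1) / 2).im = μ := by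
          rw [show ((μ : ℂ) * Complex.I - ((n : ℂ) - 1) / 2)
            = ((-(((n : ℝ) - 1) / 2) : ℝ) : ℂ) + (μ : ℂ) * Complex.I by push_cast; ring]
          simp
        rw [e1, Complex.add_im, Complex.im_mul_ofReal, e2]
        ring
      have h1 : -(‖u y‖ * (2 * d / lam y)) ≤ ((starRingEnd ℂ) (u y) * e).im := by
        have h2 := (abs_le.1 (Complex.abs_im_le_norm ((starRingEnd ℂ) (u y) * e))).1
        rw [norm_mul, RCLike.norm_conj] at h2
        have := mul_le_mul_of_nonneg_left hEy (norm_nonneg (u y))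
        rw [mul_one] at this
        linarith
      -- the arithmetic-geometric mean inequality, with the weight that leaves half of `μ p |u|²`
      have h3 : ‖u y‖ * (2 * d / lam y)
          ≤ μ / 2 * (1 / lam y * ‖u y‖ ^ 2) + 2 / μ * lam y ^ (n - 2) := by
        have e3 : lam y ^ (n - 2) = d * d / lam y := by
          rw [hdd]
          field_simp
        rw [e3]
        have e4 : μ / 2 * (1 / lam y * ‖u y‖ ^ 2) + 2 / μ * (d * d / lam y)
            - ‖u y‖ * (2 * d / lam y) = (μ * ‖u y‖ - 2 * d) ^ 2 / (2 * μ * lam y) := by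
          field_simp
          ring
        have : 0 ≤ (μ * ‖u y‖ - 2 * d) ^ 2 / (2 * μ * lam y) := by positivity
        linarith
      have h4 : 1 / lam y * ‖u y‖ ^ 2 ≤ p * ‖u y‖ ^ 2 :=
        mul_le_mul_of_nonneg_right hp (sq_nonneg _)
      have h5 : μ / 2 * (p * ‖u y‖ ^ 2) ≤ ((starRingEnd ℂ) (u y) * D).im
          + 2 / μ * lam y ^ (n - 2) := by
        have := mul_le_mul_of_nonneg_left h4 (half_pos hμ).le
        nlinarith
      calc p * ‖u y‖ ^ 2 = 2 / μ * (μ / 2 * (p * ‖u y‖ ^ 2)) := by field_simp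
        _ ≤ 2 / μ * (((starRingEnd ℂ) (u y) * D).im + 2 / μ * lam y ^ (n - 2)) :=
          mul_le_mul_of_nonneg_left h5 (by positivity)
        _ = _ := by field_simp; ring
  refine hmono.trans ?_
  have hsplit : ∫ y, shellWeight R y * (1 / μ * (2 * ((starRingEnd ℂ) (u y) * fderiv ℝ u y y).im)
      + 4 / μ ^ 2 * lam y ^ (n - 2)) ∂(hVol n)
      = 1 / μ * ∫ y, shellWeight R y * (2 * ((starRingEnd ℂ) (u y) * fderiv ℝ u y y).im) ∂(hVol n)
        + 4 / μ ^ 2 * ∫ y, shellWeight R y * lam y ^ (n - 2) ∂(hVol n) := by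
    rw [← integral_const_mul, ← integral_const_mul, ← integral_add]
    · exact integral_congr_ae (ae_of_all _ fun y => by ring)
    · exact (integrable_shellWeight_mul hRpos hcI).const_mul _
    · exact (integrable_shellWeight_mul hRpos (continuousOn_lam_pow _)).const_mul _
  rw [hsplit]
  have h1 := (le_abs_self _).trans (abs_integral_shellWeight_im_le hn hf h hRpos)
  have h2 := hK R (by linarith)
  calc _ ≤ 1 / μ * F + 4 / μ ^ 2 * K := by gcongr
    _ = _ := by ring

end flux

/-! ### The radiation condition of the Green function -/

section boundary

variable {n : ℕ} {μ : ℝ} {z : ℂ} {f u : E n → ℂ} {x y : E n}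

/-- Along the Euler field, `cosh ρ(x, y)` grows like `cosh ρ(y) - 1` times itself, up to a bounded
multiple of `cosh ρ(y)`. -/
theorem abs_hCoshDeriv_self_sub_le (hx : x ∈ hBall n) (hy : y ∈ hBall n) {ε : ℝ} (hε : 0 < ε)
    (hε1 : ε ≤ 1) :
    |hCoshDeriv x y y - coshSubOne y * (hCosh x y + ε)| ≤ 12 / (lam x * lam y) := by
  have h1 := lam_pos hx
  have h2 := lam_pos hy
  have h3 := lam_le_one x
  have hy1 := norm_lt_one hy
  have hx1 := norm_lt_one hx
  have e : hCoshDeriv x y y - coshSubOne y * (hCosh x y + ε)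
      = (4 * inner ℝ (y - x) y - 2 * ‖y‖ ^ 2 * (1 + ε) * lam x) / (lam x * lam y) := by
    rw [hCoshDeriv_apply, real_inner_self_eq_norm_sq]
    unfold coshSubOne hCosh
    field_simp
    ring
  rw [e, abs_div, abs_of_pos (mul_pos h1 h2)]
  refine div_le_div_of_nonneg_right ?_ (mul_pos h1 h2).le
  have h4 : |inner ℝ (y - x) y| ≤ 2 := by
    refine (abs_real_inner_le_norm _ _).trans ?_
    have := norm_sub_le y x
    nlinarith [norm_nonneg y, norm_nonneg (y - x)]
  have h5 : 2 * ‖y‖ ^ 2 * (1 + ε) * lam x ≤ 4 := by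
    have h6 : ‖y‖ ^ 2 ≤ 1 := by nlinarith [norm_nonneg y]
    calc 2 * ‖y‖ ^ 2 * (1 + ε) * lam x ≤ 2 * 1 * (1 + 1) * 1 := by gcongr
      _ = 4 := by norm_num
  have h6 : 0 ≤ 2 * ‖y‖ ^ 2 * (1 + ε) * lam x := by positivity
  rw [abs_le] at h4 ⊢
  constructor <;> linarith

/-- The regularized Green function satisfies the radiation condition near the sphere at infinity,
uniformly in the regularization parameter. -/
theorem exists_norm_greenReg_le (hn : 2 ≤ n) (hz : z.re = 0) (hx : x ∈ hBall n) :
    ∃ C R₀ : ℝ, 0 ≤ C ∧ 0 < R₀ ∧ ∀ y ∈ hBall n, lam y ≤ 2 / R₀ → ∀ ε : ℝ, 0 < ε → ε ≤ 1 →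
      ‖greenReg n z x ε y‖ ≤ C * lam y ^ (((n : ℝ) - 1) / 2) ∧
      ‖fderiv ℝ (greenReg n z x ε) y y
          + (((n : ℂ) - 1) / 2 + z) * (coshSubOne y : ℝ) * greenReg n z x ε y‖
        ≤ C * lam y ^ (((n : ℝ) - 1) / 2) := by
  have hx1 := norm_lt_one hx
  have hx0 := norm_nonneg x
  have hlx := lam_pos hx
  have hlx1 := lam_le_one x
  set r := (1 + ‖x‖) / 2 with hr
  have hr1 : r < 1 := by rw [hr]; linarith
  have hr0 : 0 < r := by rw [hr]; linarith
  have hr2 : 0 < 1 - r ^ 2 := by nlinarith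
  set b := (1 - ‖x‖) ^ 2 / 2 with hb
  have hb0 : 0 < b := by
    have : 0 < 1 - ‖x‖ := by linarith
    positivity
  set N := π * ‖greenConst n z‖ with hN
  set N' := π * ‖(((n : ℂ) - 1) / 2 + z) * greenConst n z‖ with hN'
  have hN0 : 0 ≤ N := by positivity
  have hN'0 : 0 ≤ N' := by positivity
  have hn1 : (2 : ℝ) ≤ n := by exact_mod_cast hn
  set C₁ := N * b ^ (-(((n : ℝ) - 1) / 2)) with hC₁
  set C₂ := N' * b ^ (-(((n : ℝ) + 1) / 2)) * (2 + 12 / lam x) with hC₂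
  have hC₁0 : 0 ≤ C₁ := by positivity
  have hC₂0 : 0 ≤ C₂ := by positivity
  refine ⟨max C₁ C₂, 2 / (1 - r ^ 2), le_max_of_le_left hC₁0, by positivity,
    fun y hy hly ε hε hε1 => ?_⟩
  have hl := lam_pos hy
  rw [div_div_cancel₀ two_ne_zero] at hly
  have hry : r ≤ ‖y‖ := by
    unfold lam at hly
    exact le_of_sq_le_sq (by linarith) (norm_nonneg y)
  have hyx : (1 - ‖x‖) / 2 ≤ ‖y - x‖ := by
    have := norm_sub_norm_le y x
    rw [hr] at hry
    linarith
  have hc : b / lam y ≤ hCosh x y + ε - 1 := by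
    have h1 : b / lam y ≤ 2 * ‖y - x‖ ^ 2 / (lam x * lam y) := by
      refine div_le_div₀ (by positivity) ?_ (by positivity) ?_
      · rw [hb]
        nlinarith
      · nlinarith
    unfold hCosh
    linarith
  have hc1 : 1 < hCosh x y + ε := by linarith [one_le_hCosh hx hy]
  set d := lam y ^ (((n : ℝ) - 1) / 2) with hd
  have hd0 : 0 ≤ d := Real.rpow_nonneg hl.le _
  have hpow : ∀ s : ℝ, 0 ≤ s → (hCosh x y + ε - 1) ^ (-s) ≤ b ^ (-s) * lam y ^ s := fun s hs => by
    refine (Real.rpow_le_rpow_of_nonpos (by positivity) hc (by linarith)).trans_eq ?_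
    rw [Real.div_rpow hb0.le hl.le, Real.rpow_neg hl.le s, div_inv_eq_mul]
  have h1 : ‖greenReg n z x ε y‖ ≤ C₁ * d := by
    refine (norm_greenFun_le hn hz hc1).trans ?_
    have := mul_le_mul_of_nonneg_left (hpow (((n : ℝ) - 1) / 2) (by linarith)) hN0
    rwa [← mul_assoc] at this
  have hdl : lam y ^ (((n : ℝ) + 1) / 2) = d * lam y := by
    rw [hd, ← Real.rpow_add_one hl.ne']
    congr 1
    ring
  set B := N' * (b ^ (-(((n : ℝ) + 1) / 2)) * (d * lam y)) with hB
  have hB0 : 0 ≤ B := by positivity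
  have hpow' : N' * (hCosh x y + ε - 1) ^ (-(((n : ℝ) + 1) / 2)) ≤ B := by
    have := hpow (((n : ℝ) + 1) / 2) (by linarith)
    rw [hdl] at this
    exact mul_le_mul_of_nonneg_left this hN'0
  have h2 := (norm_greenFunDeriv_le hn hz hc1).trans hpow'
  have h3 := (norm_greenFun_radiation_le hn hz hc1).trans hpow'
  have h4 := abs_hCoshDeriv_self_sub_le hx hy hε hε1
  have hp := coshSubOne_le hy
  have hp0 : 0 ≤ coshSubOne y := by
    unfold coshSubOne
    positivity
  refine ⟨h1.trans (mul_le_mul_of_nonneg_right (le_max_left _ _) hd0), ?_⟩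
  refine le_trans ?_ (mul_le_mul_of_nonneg_right (le_max_right C₁ C₂) hd0)
  rw [fderiv_greenReg hz hx hy hε]
  set c := hCosh x y + ε with hcdef
  have e : greenFunDeriv n z c * ((hCoshDeriv x y y : ℝ) : ℂ)
      + (((n : ℂ) - 1) / 2 + z) * (coshSubOne y : ℝ) * greenReg n z x ε y
      = (coshSubOne y : ℝ) * (c * greenFunDeriv n z c + (((n : ℂ) - 1) / 2 + z) * greenFun n z c)
        + greenFunDeriv n z c * ((hCoshDeriv x y y - coshSubOne y * c : ℝ) : ℂ) := by
    unfold greenReg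
    rw [← hcdef]
    push_cast
    ring
  rw [e]
  refine (norm_add_le _ _).trans ?_
  rw [norm_mul, norm_mul, Complex.norm_real, Complex.norm_real, Real.norm_of_nonneg hp0,
    Real.norm_eq_abs]
  calc _ ≤ 2 / lam y * B + B * (12 / (lam x * lam y)) := by gcongr
    _ = C₂ * d := by
        rw [hB, hC₂]
        field_simp

end boundary

/-! ### The representation formula -/

section representation

variable {n : ℕ} {μ : ℝ} {f u : E n → ℂ} {x : E n}

/-- The boundary terms of Green's identity between a radiating solution and the regularized Green
function vanish at infinity, uniformly in the regularization parameter. -/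
theorem IsRadiatingSolution.exists_norm_boundary_le (hn : 2 ≤ n) (hμ : 0 < μ) (hf : IsTestFun f)
    (h : IsRadiatingSolution μ f u) (hx : x ∈ hBall n) {e : ℝ} (he : 0 < e) :
    ∃ R₀ : ℝ, 0 < R₀ ∧ ∀ R, R₀ ≤ R → ∀ ε : ℝ, 0 < ε → ε ≤ 1 →
      ‖∫ y, (shellWeight R y : ℂ) *
        (greenReg n (-((μ : ℂ) * Complex.I)) x ε y * fderiv ℝ u y y
          - u y * fderiv ℝ (greenReg n (-((μ : ℂ) * Complex.I)) x ε) y y) ∂(hVol n)‖ ≤ e := by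
  have hu := h.contDiffOn
  have hz : (-((μ : ℂ) * Complex.I)).re = 0 := by simp
  obtain ⟨C, R₁, hC0, hR₁, hC⟩ := exists_norm_greenReg_le hn hz hx
  obtain ⟨K, hK0, hK⟩ := exists_integral_shellWeight_le hn
  obtain ⟨F, R₂, hF0, hF⟩ := h.exists_integral_shellWeight_norm_sq_le hn hμ hf
  set η := e / (4 * (C * K + 1)) with hη
  have hη0 : 0 < η := by positivity
  obtain ⟨R₃, hR₃, hE⟩ := h.radiating.exists_norm_le hu hη0
  refine ⟨max (max R₁ R₂) (max R₃ (2 * C * (K + F) / e)), lt_max_of_lt_left (lt_max_of_lt_left hR₁),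
    fun R hR ε hε hε1 => ?_⟩
  have hRR₁ : R₁ ≤ R := (le_max_left _ _).trans ((le_max_left _ _).trans hR)
  have hRR₂ : R₂ ≤ R := (le_max_right _ _).trans ((le_max_left _ _).trans hR)
  have hRR₃ : R₃ ≤ R := (le_max_left _ _).trans ((le_max_right _ _).trans hR)
  have hRR₄ : 2 * C * (K + F) / e ≤ R := (le_max_right _ _).trans ((le_max_right _ _).trans hR)
  have hRpos : 0 < R := hR₁.trans_le hRR₁
  have hcS : ContinuousOn (fun y : E n => coshSubOne y * ‖u y‖ ^ 2) (hBall n) :=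
    continuousOn_coshSubOne.mul (hu.continuousOn.norm.pow 2)
  refine (norm_integral_shellWeight_le hRpos
    (G := fun y => (2 * C * η + C / R) * lam y ^ (n - 2) + C / R * (coshSubOne y * ‖u y‖ ^ 2))
    ((continuousOn_const.mul (continuousOn_lam_pow _)).add (continuousOn_const.mul hcS))
    fun y hy hly => ?_).trans ?_
  · have hl := lam_pos hy
    have hly₁ : lam y ≤ 2 / R₁ := hly.trans (div_le_div_of_nonneg_left two_pos.le hR₁ hRR₁)
    have hly₃ : lam y ≤ 2 / R₃ :=
      hly.trans (div_le_div_of_nonneg_left two_pos.le (by linarith) hRR₃)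
    have hl1 : lam y ≤ 1 / 2 := hly₃.trans (by
      rw [div_le_div_iff₀ (by linarith) two_pos]
      linarith)
    have hp := inv_lam_le_coshSubOne hy hl1
    obtain ⟨hg, hDg⟩ := hC y hy hly₁ ε hε hε1
    have hEy := hE y hy hly₃
    set g := greenReg n (-((μ : ℂ) * Complex.I)) x ε with hgdef
    set D := fderiv ℝ u y y
    set Dg := fderiv ℝ g y y
    set p := coshSubOne y
    set d := lam y ^ (((n : ℝ) - 1) / 2) with hd
    have hd0 : 0 ≤ d := Real.rpow_nonneg hl.le _
    have hdd : d * d = lam y * lam y ^ (n - 2) := rpow_lam_sq hn hy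
    -- the radiation conditions of `u` and `g` have the same leading coefficient, which cancels
    have e1 : g y * D - u y * Dg
        = g y * (D - ((μ : ℂ) * Complex.I - ((n : ℂ) - 1) / 2) * (p : ℝ) * u y)
          - u y * (Dg + (((n : ℂ) - 1) / 2 + -((μ : ℂ) * Complex.I)) * (p : ℝ) * g y) := by ring
    have h1 : ‖g y * (D - ((μ : ℂ) * Complex.I - ((n : ℂ) - 1) / 2) * (p : ℝ) * u y)‖
        ≤ 2 * C * η * lam y ^ (n - 2) := by
      rw [norm_mul]
      calc _ ≤ C * d * (2 * η * d / lam y) := mul_le_mul hg hEy (norm_nonneg _) (by positivity)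
        _ = 2 * C * η * (d * d / lam y) := by ring
        _ = 2 * C * η * lam y ^ (n - 2) := by
          rw [hdd]
          field_simp
    have h2 : ‖u y * (Dg + (((n : ℂ) - 1) / 2 + -((μ : ℂ) * Complex.I)) * (p : ℝ) * g y)‖
        ≤ C / R * (p * ‖u y‖ ^ 2) + C / R * lam y ^ (n - 2) := by
      rw [norm_mul]
      have h3 : ‖u y‖ * d ≤ ‖u y‖ ^ 2 / 2 + d * d / 2 := by nlinarith [sq_nonneg (‖u y‖ - d)]
      have h4 : lam y / 2 ≤ 1 / R := by
        rw [le_div_iff₀ hRpos]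
        rw [le_div_iff₀ hRpos] at hly
        linarith
      have h5 : ‖u y‖ ^ 2 / 2 ≤ 1 / R * (p * ‖u y‖ ^ 2) := by
        have h6 : 1 ≤ lam y * p := by
          rwa [div_le_iff₀ hl, mul_comm] at hp
        calc ‖u y‖ ^ 2 / 2 ≤ lam y * p * (‖u y‖ ^ 2 / 2) :=
              le_mul_of_one_le_left (by positivity) h6
          _ = lam y / 2 * (p * ‖u y‖ ^ 2) := by ring
          _ ≤ _ := by
            have : 0 ≤ p := le_trans (by positivity) hp
            gcongr
      have h6 : d * d / 2 ≤ 1 / R * lam y ^ (n - 2) := by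
        rw [hdd, mul_div_right_comm]
        gcongr
      calc _ ≤ ‖u y‖ * (C * d) := mul_le_mul_of_nonneg_left hDg (norm_nonneg _)
        _ = C * (‖u y‖ * d) := by ring
        _ ≤ C * (1 / R * (p * ‖u y‖ ^ 2) + 1 / R * lam y ^ (n - 2)) :=
          mul_le_mul_of_nonneg_left (by linarith) hC0
        _ = _ := by ring
    rw [e1]
    refine (norm_sub_le _ _).trans ?_
    linarith
  · have hsplit : ∫ y, shellWeight R y * ((2 * C * η + C / R) * lam y ^ (n - 2)
        + C / R * (coshSubOne y * ‖u y‖ ^ 2)) ∂(hVol n)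
        = (2 * C * η + C / R) * ∫ y, shellWeight R y * lam y ^ (n - 2) ∂(hVol n)
          + C / R * ∫ y, shellWeight R y * (coshSubOne y * ‖u y‖ ^ 2) ∂(hVol n) := by
      rw [← integral_const_mul, ← integral_const_mul, ← integral_add]
      · exact integral_congr_ae (ae_of_all _ fun y => by ring)
      · exact (integrable_shellWeight_mul hRpos (continuousOn_lam_pow _)).const_mul _
      · exact (integrable_shellWeight_mul hRpos hcS).const_mul _
    rw [hsplit]
    have h1 := hK R (by linarith)
    have h2 := hF R hRR₂
    have h3 : 2 * C * η * K ≤ e / 2 := by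
      rw [hη, mul_div_assoc', div_mul_eq_mul_div, div_le_div_iff₀ (by positivity) two_pos]
      nlinarith
    have h4 : C / R * (K + F) ≤ e / 2 := by
      rw [div_le_iff₀ he] at hRR₄
      rw [div_mul_eq_mul_div, div_le_div_iff₀ hRpos two_pos]
      linarith
    calc _ ≤ (2 * C * η + C / R) * K + C / R * F := by gcongr
      _ = 2 * C * η * K + C / R * (K + F) := by ring
      _ ≤ e := by linarith

/-- On a ball containing `x` and the support of the source, the volume term of Green's identity
between `u` and the regularized Green function tends to `u x` minus the Green potential of the
source. -/
theorem IsRadiatingSolution.tendsto_integral_cutoff (hn : 2 ≤ n) (hf : IsTestFun f)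
    (h : IsRadiatingSolution μ f u) (hx : x ∈ hBall n) {R : ℝ} (hR : 0 < R)
    (hxR : 2 ≤ R * lam x) (hfR : ∀ y ∈ tsupport f, 2 ≤ R * lam y) :
    Tendsto (fun ε : ℝ => ∫ y, (cutoff R y : ℂ) *
        (greenReg n (-((μ : ℂ) * Complex.I)) x ε y * hLaplacian u y
          - u y * hLaplacian (greenReg n (-((μ : ℂ) * Complex.I)) x ε) y) ∂(hVol n)) (𝓝[>] 0)
      (𝓝 (u x - ∫ y, greenFun n (-((μ : ℂ) * Complex.I)) (hCosh x y) * f y ∂(hVol n))) := by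
  have hu := h.contDiffOn
  set z := -((μ : ℂ) * Complex.I) with hzdef
  have hz : z.re = 0 := by simp [hzdef]
  have hz2 : z ^ 2 = -(μ : ℂ) ^ 2 := by
    rw [hzdef, neg_sq, mul_pow, Complex.I_sq, mul_neg_one]
  have hcutc : Continuous fun y : E n => (cutoff R y : ℂ) :=
    Complex.continuous_ofReal.comp contDiff_cutoff.continuous
  have hψ : ContinuousOn (fun y => (cutoff R y : ℂ) * u y) (hBall n) :=
    hcutc.continuousOn.mul hu.continuousOn
  have hψ0 : ∀ y, y ∉ cutoffSupport n R → (cutoff R y : ℂ) * u y = 0 := fun y hy => by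
    rw [cutoff_eq_zero (not_le.1 hy).le]
    simp
  have hψx : (cutoff R x : ℂ) * u x = u x := by rw [cutoff_eq_one hxR]; simp
  have h1 := tendsto_integral_greenDefect hn hz hx hR hψ hψ0
  have h2 := (tendsto_integral_greenReg hn hz hx hf.smooth.continuous hf.compact
    hf.support_subset).2
  have h3 := h1.sub h2
  simp only [hψx] at h3
  refine h3.congr' ?_
  filter_upwards [self_mem_nhdsWithin] with ε hε
  have hε : 0 < ε := hε
  have hgc := contDiffOn_greenReg (n := n) hz hx hε
  have hi2 : Integrable (fun y => greenReg n z x ε y * f y) (hVol n) :=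
    integrable_mul_isTestFun hgc.continuousOn hf
  have hpt : ∀ y ∈ hBall n, (cutoff R y : ℂ) * (greenReg n z x ε y * hLaplacian u y
      - u y * hLaplacian (greenReg n z x ε) y)
      = (cutoff R y : ℂ) * u y * (ε * greenDefect n z ε (hCosh x y + ε))
        - greenReg n z x ε y * f y := fun y hy => by
    have hfy : (cutoff R y : ℂ) * f y = f y := by
      by_cases hys : y ∈ tsupport f
      · rw [cutoff_eq_one (hfR y hys)]
        simp
      · rw [image_eq_zero_of_notMem_tsupport hys, mul_zero]
    rw [h.hLaplacian_eq hy, hLaplacian_greenReg hz hx hy hε, hz2]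
    linear_combination (-greenReg n z x ε y) * hfy
  have hi1 : Integrable (fun y => (cutoff R y : ℂ) * u y *
      (ε * greenDefect n z ε (hCosh x y + ε))) (hVol n) := by
    have hi : Integrable (fun y => (cutoff R y : ℂ) * (greenReg n z x ε y * hLaplacian u y
        - u y * hLaplacian (greenReg n z x ε) y)) (hVol n) := by
      refine integrable_hVol_of_isCompact (isCompact_cutoffSupport hR) (cutoffSupport_subset hR)
        (hcutc.continuousOn.mul ((hgc.continuousOn.mul (continuousOn_hLaplacian hu)).sub
          (hu.continuousOn.mul (continuousOn_hLaplacian hgc)))) fun y _ hy => ?_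
      rw [cutoff_eq_zero (not_le.1 hy).le]
      simp
    refine (hi.add hi2).congr ?_
    filter_upwards [ae_hVol_mem_hBall] with y hy
    simp only [Pi.add_apply, hpt y hy]
    ring
  rw [← integral_sub hi1 hi2]
  refine integral_congr_ae ?_
  filter_upwards [ae_hVol_mem_hBall] with y hy
  exact (hpt y hy).symm

/-- All sufficiently large balls on which the cutoff is `1` contain the support of the source. -/
theorem IsTestFun.exists_le_mul_lam (hf : IsTestFun f) :
    ∃ R₀ : ℝ, 0 < R₀ ∧ ∀ R, R₀ ≤ R → ∀ y ∈ tsupport f, 2 ≤ R * lam y := by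
  rcases (tsupport f).eq_empty_or_nonempty with h | h
  · exact ⟨1, one_pos, fun R _ y hy => by simp [h] at hy⟩
  · obtain ⟨y₀, hy₀, hmin⟩ := hf.compact.isCompact.exists_isMinOn h continuous_lam.continuousOn
    have hl := lam_pos (hf.support_subset hy₀)
    refine ⟨2 / lam y₀, by positivity, fun R hR y hy => ?_⟩
    have h1 : lam y₀ ≤ lam y := hmin hy
    rw [div_le_iff₀ hl] at hR
    have hRpos : 0 ≤ R := by
      by_contra hneg
      nlinarith
    exact hR.trans (mul_le_mul_of_nonneg_left h1 hRpos)

theorem IsRadiatingSolution.eq_integral_greenFun (hn : 2 ≤ n) (hμ : 0 < μ) (hf : IsTestFun f)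
    (h : IsRadiatingSolution μ f u) (hx : x ∈ hBall n) :
    u x = ∫ y, greenFun n (-((μ : ℂ) * Complex.I)) (hCosh x y) * f y ∂(hVol n) := by
  have hlx := lam_pos hx
  have hz : (-((μ : ℂ) * Complex.I)).re = 0 := by simp
  rw [← sub_eq_zero, ← norm_le_zero_iff]
  refine le_of_forall_pos_le_add fun e he => ?_
  rw [zero_add]
  obtain ⟨R₁, hR₁, hb⟩ := h.exists_norm_boundary_le hn hμ hf hx he
  obtain ⟨R₂, hR₂, hs⟩ := hf.exists_le_mul_lam
  set R := max (max R₁ R₂) (2 / lam x) with hRdef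
  have hRR₁ : R₁ ≤ R := (le_max_left _ _).trans (le_max_left _ _)
  have hRR₂ : R₂ ≤ R := (le_max_right _ _).trans (le_max_left _ _)
  have hRpos : 0 < R := hR₁.trans_le hRR₁
  have hxR : 2 ≤ R * lam x := by
    rw [← div_le_iff₀ hlx]
    exact le_max_right _ _
  have hlim := (h.tendsto_integral_cutoff hn hf hx hRpos hxR (hs R hRR₂)).norm
  refine le_of_tendsto hlim ?_
  filter_upwards [Ioc_mem_nhdsGT (zero_lt_one (α := ℝ))] with ε hε
  rw [green_identity hn hRpos (contDiffOn_greenReg hz hx hε.1) h.contDiffOn]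
  exact hb R hRR₁ ε hε.1 hε.2

theorem green_hDist_mul_ae_eq (hn : 2 ≤ n) (z : ℂ) (hx : x ∈ hBall n) :
    (fun y => greenFun n z (hCosh x y) * f y)
      =ᵐ[hVol n] fun y => green n z (hDist x y) * f y := by
  filter_upwards [ae_hVol_mem_hBall, ae_hVol_ne hn x] with y hy hxy
  rw [green_hDist hn z hx hy hxy]

theorem IsRadiatingSolution.representation (hn : 2 ≤ n) (hμ : 0 < μ) (hf : IsTestFun f)
    (h : IsRadiatingSolution μ f u) (hx : x ∈ hBall n) :
    Integrable (fun y => green n (-((μ : ℂ) * Complex.I)) (hDist x y) * f y) (hVol n) ∧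
      u x = ∫ y, green n (-((μ : ℂ) * Complex.I)) (hDist x y) * f y ∂(hVol n) := by
  have hz : (-((μ : ℂ) * Complex.I)).re = 0 := by simp
  have hae := green_hDist_mul_ae_eq (f := f) hn (-((μ : ℂ) * Complex.I)) hx
  refine ⟨(tendsto_integral_greenReg hn hz hx hf.smooth.continuous hf.compact
    hf.support_subset).1.congr hae, ?_⟩
  rw [← integral_congr_ae hae]
  exact h.eq_integral_greenFun hn hμ hf hx

theorem isTestFun_zero : IsTestFun (fun _ : E n => (0 : ℂ)) where
  smooth := contDiff_const
  compact := HasCompactSupport.zero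
  support_subset := by
    rw [show (fun _ : E n => (0 : ℂ)) = 0 from rfl, tsupport_zero]
    exact empty_subset _

end representation

end HypScattering

end

theorem theorem3p2 (n : ℕ) (hn : 2 ≤ n) (μ : ℝ) (hμ : 0 < μ) :
    -- the representation of a radiating solution through the Green function
    (∀ f u : HypScattering.E n → ℂ, HypScattering.IsTestFun f →
      HypScattering.IsRadiatingSolution μ f u →
      ∀ x ∈ HypScattering.hBall n,
        Integrable
          (fun y => HypScattering.green n (-((μ : ℂ) * Complex.I)) (HypScattering.hDist x y) * f y)
          (HypScattering.hVol n) ∧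
        u x = ∫ y, HypScattering.green n (-((μ : ℂ) * Complex.I)) (HypScattering.hDist x y) * f y
          ∂(HypScattering.hVol n)) ∧
    -- uniqueness
    (∀ f u v : HypScattering.E n → ℂ, HypScattering.IsTestFun f →
      HypScattering.IsRadiatingSolution μ f u → HypScattering.IsRadiatingSolution μ f v →
      ∀ x ∈ HypScattering.hBall n, u x = v x) ∧
    -- radiating solutions of the homogeneous equation vanish
    (∀ u : HypScattering.E n → ℂ,
      HypScattering.IsRadiatingSolution μ (fun _ => 0) u →
      ∀ x ∈ HypScattering.hBall n, u x = 0) := by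
  refine ⟨fun f u hf hu x hx => hu.representation hn hμ hf hx, fun f u v hf hu hv x hx => ?_,
    fun u hu x hx => ?_⟩
  · rw [(hu.representation hn hμ hf hx).2, (hv.representation hn hμ hf hx).2]
  · rw [(hu.representation hn hμ HypScattering.isTestFun_zero hx).2]
    simp
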